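/- Let $G$ be a finite group and $K$ a field. For a group $H$ put $\mu_K(H)=H^2(H,K^\times)$ (trivial action). (1) A finite $\mu_K$-decorated $G$-set is a finite $G$-set $X$ with a frill $\pi_x\in\mu_K(G_x)$ for each $x\in X$ ($G_x$ the stabiliser), such that $\pi_{gx}$ is the image of $\pi_x$ under the conjugation isomorphism $G_{gx}\to G_x$, $h\mapsto g^{-1}hg$. Isomorphisms are $G$-equivariant bijections matching the frills. (2) For a finite $G$-set $X$, the action groupoid $\mathcal G_X$ has objects $X$ and arrows $(g,x)\colon x\to gx$. A central extension of $\mathcal G_X$ by $K^\times$ is a groupoid $\widetilde{\mathcal G}$ with object set $X$ and an exact sequence $1\to K^\times\times X\to\widetilde{\mathcal G}\to\mathcal G_X\to 1$ of groupoids over $X$, with $K^\times$ central. Isomorphisms of such extensions are isomorphisms of groupoids that are the identity on $K^\times$ and cover the isomorphism of action groupoids induced by an isomorphism of $G$-sets. (3) A semisimple split $G$-algebra is an associative unital $K$-algebra $A$ with an action of $G$ by $K$-algebra automorphisms, semisimple, with $\mathrm{End}_A(M)=K$ for every simple $A$-module $M$. For an $A$-module $M$ let $M^{[g]}$ be $M$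 with the action $a\cdot m=g(a)m$. Two such algebras $A,B$ are $G$-Morita equivalent if there is a $K$-linear equivalence $\Phi$ from the category of left $A$-modules to the category of left $B$-modules with natural isomorphisms $\beta_g\colon\Phi(M^{[g]})\to\Phi(M)^{[g]}$, $g\in G$, such that $\beta_{gh}(M)=\beta_g(M)^{[h]}\circ\beta_h(M^{[g]})$ under the identifications $(M^{[g]})^{[h]}=M^{[gh]}$. (4) Let $G\text{-Mod}$ be the tensor category of finite-dimensional representations of $G$ over $K$. For a subgroup $H\le G$ and $\eta\in\mu_K(H)$, let $H\text{-Mod}_\eta$ be the right module category over $G\text{-Mod}$ of finite-dimensional projective representations $\rho$ of $H$ with $\rho(g)\rho(h)=\theta(g,h)\rho(gh)$, where $\theta$ is a fixed cocycle representing $\eta$, and with $V\boxtimes W=V\otimes_K W|_H$. A $K$-linear right module category over $G\text{-Mod}$ is special if it is equivalent, as a module category, to a finite direct sum of such categories $H\text{-Mod}_\eta$. Theorem. There are natural bijections between the following four sets: (1) isomorphism classes of finite $\mu_K$-decorated $G$-sets; (2) isomorphism classes of central extensions by $K^\times$ of action groupoids of finite $G$-sets; (3) $G$-Morita equivalence classes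 of semisimple split $G$-algebras over $K$; (4) equivalence classes of special module categories over $G\text{-Mod}$. They are given as follows. A central extension $\widetilde{\mathcal G}$ of $\mathcal G_X$ corresponds to $X$ with $\pi_x$ the class of the extension $1\to K^\times\to\mathrm{Aut}_{\widetilde{\mathcal G}}(x)\to G_x\to 1$. A $G$-algebra $A$ corresponds to the set $\mathrm{Irr}(A)$ of isomorphism classes of simple $A$-modules, with $g[M]=[M^{[g^{-1}]}]$ and $\pi_{[M]}$ the class of the cocycle $\theta$ of any family of invertible linear maps $\rho(h)$ of $M$, $h\in G_{[M]}$, with $\rho(h)(am)=h(a)\rho(h)m$ and $\rho(g)\rho(h)=\theta(g,h)\rho(gh)$. The $G$-algebra $A$ corresponds to the module category $A*G\text{-Mod}$ of finite-dimensional modules over the skew group algebra, with $M\boxtimes V=M\otimes_K V$. A decorated set $X$ corresponds to the module category $\bigoplus_{x\in X_0}G_x\text{-Mod}_{\pi_x^{-1}}$, where $X_0\subseteq X$ is any set of representatives of the $G$-orbits. -/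

import Mathlib

open CategoryTheory MonoidalCategory
open scoped ModuleCat.Algebra

universe u v

noncomputable section

/-! ### The group `μ_K(H) = H²(H, Kˣ)` (trivial action) -/

/-- The group of `2`-cocycles of `H` with values in `Kˣ`, on which `H` acts trivially. -/
def cocycle (K : Type u) [Field K] (H : Type v) [Group H] : Subgroup (H → H → Kˣ) where
  carrier := {θ | ∀ g h k, θ g h * θ (g * h) k = θ h k * θ g (h * k)}
  one_mem' := by intro g h k; simp
  mul_mem' := by
    intro a b ha hb g h k
    simp only [Pi.mul_apply]
    rw [mul_mul_mul_comm, ha, hb, mul_mul_mul_comm]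
  inv_mem' := by
    intro a ha g h k
    simp only [Pi.inv_apply]
    rw [← mul_inv, ha, mul_inv]

/-- The subgroup of `2`-coboundaries. -/
def coboundary (K : Type u) [Field K] (H : Type v) [Group H] : Subgroup (H → H → Kˣ) where
  carrier := {θ | ∃ c : H → Kˣ, ∀ g h, θ g h = c g * c h * (c (g * h))⁻¹}
  one_mem' := ⟨1, by intro g h; simp⟩
  mul_mem' := by
    rintro a b ⟨c, hc⟩ ⟨d, hd⟩
    refine ⟨c * d, fun g h => ?_⟩
    simp only [Pi.mul_apply, hc, hd, mul_inv]
    ac_rfl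
  inv_mem' := by
    rintro a ⟨c, hc⟩
    refine ⟨c⁻¹, fun g h => ?_⟩
    simp only [Pi.inv_apply, hc, mul_inv]

/-- `μ_K(H) = H²(H, Kˣ)`, written multiplicatively. -/
abbrev SchurMul (K : Type u) [Field K] (H : Type v) [Group H] : Type (max u v) :=
  cocycle K H ⧸ (coboundary K H).subgroupOf (cocycle K H)

/-- The cohomology class of a cocycle. -/
def SchurMul.mk {K : Type u} [Field K] {H : Type v} [Group H] (θ : cocycle K H) : SchurMul K H :=
  QuotientGroup.mk θ

/-- Restriction of cocycles along a group homomorphism. -/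
def cocycle.pullback {K : Type u} [Field K] {H H' : Type v} [Group H] [Group H'] (φ : H →* H') :
    cocycle K H' →* cocycle K H where
  toFun θ := ⟨fun g h => θ.1 (φ g) (φ h), by
    intro g h k
    simpa using θ.2 (φ g) (φ h) (φ k)⟩
  map_one' := rfl
  map_mul' _ _ := rfl

/-- The homomorphism `μ_K(H') → μ_K(H)` induced by a group homomorphism `H → H'`. -/
def SchurMul.pullback {K : Type u} [Field K] {H H' : Type v} [Group H] [Group H'] (φ : H →* H') :
    SchurMul K H' →* SchurMul K H :=
  QuotientGroup.map _ _ (cocycle.pullback φ) (by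
    rintro ⟨θ, hθ⟩ ⟨c, hc⟩
    refine ⟨fun h => c (φ h), fun g h => ?_⟩
    simpa [cocycle.pullback] using hc (φ g) (φ h))

/-! ### Finite `μ_K`-decorated `G`-sets -/

/-- A finite `μ_K`-decorated `G`-set: every point `x` carries a frill in `μ_K(G_x)`, and
the frill of `g • x` is obtained from that of `x` by transport along the conjugation
`G_{g • x} ≃ G_x`, `h ↦ g⁻¹ h g`. -/
structure DecoratedSet (G : Type v) (K : Type u) [Group G] [Field K] where
  X : Type u
  [action : MulAction G X]
  [finite : Finite X]
  frill : ∀ x : X, SchurMul K (MulAction.stabilizer G x)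
  equivariant : ∀ (g : G) (x : X), frill (g • x) =
    SchurMul.pullback
      (MulAction.stabilizerEquivStabilizer (rfl : g • x = g • x)).symm.toMonoidHom (frill x)

attribute [instance] DecoratedSet.action DecoratedSet.finite

/-- An equivariant map sends the stabiliser of `x` into the stabiliser of its image. -/
def stabilizerMap {G : Type v} [Group G] {X Y : Type u} [MulAction G X] [MulAction G Y]
    (f : X → Y) (hf : ∀ (g : G) x, f (g • x) = g • f x) (x : X) :
    MulAction.stabilizer G x →* MulAction.stabilizer G (f x) :=
  Subgroup.inclusion (by
    intro g hg
    rw [MulAction.mem_stabilizer_iff] at hg ⊢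
    rw [← hf, hg])

/-- Isomorphism of decorated sets: an equivariant bijection matching the frills. -/
def DecoratedSet.Iso {G : Type v} {K : Type u} [Group G] [Field K] (X Y : DecoratedSet G K) :
    Prop :=
  ∃ (f : X.X ≃ Y.X) (hf : ∀ (g : G) x, f (g • x) = g • f x),
    ∀ x, X.frill x = SchurMul.pullback (stabilizerMap f hf x) (Y.frill (f x))

/-! ### Central extensions of action groupoids -/

/-- A central extension by `Kˣ` of the action groupoid of a finite `G`-set `X`. The action
groupoid has objects `X` and arrows `(g, x) : x ⟶ g • x`, with composition given by multiplication
in `G`. The extension is a groupoid with the same objects; `proj` gives, on arrows, the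
surjection to the action groupoid (an arrow `f : x ⟶ y` goes to `(proj f, x)`), and `incl` embeds the
trivial bundle of groups `Kˣ` over `X` as its kernel. -/
structure CentralExtension (G : Type v) (K : Type u) [Group G] [Field K] where
  X : Type u
  [action : MulAction G X]
  [finite : Finite X]
  [groupoid : Groupoid.{max u v} X]
  proj : ∀ {x y : X}, (x ⟶ y) → G
  proj_smul : ∀ {x y : X} (f : x ⟶ y), proj f • x = y
  proj_id : ∀ x : X, proj (𝟙 x) = 1
  proj_comp : ∀ {x y z : X} (f : x ⟶ y) (f' : y ⟶ z), proj (f ≫ f') = proj f' * proj f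
  proj_surjective : ∀ (g : G) (x : X), ∃ f : x ⟶ g • x, proj f = g
  incl : ∀ x : X, Kˣ →* End x
  incl_injective : ∀ x : X, Function.Injective (incl x)
  exact : ∀ {x : X} (f : x ⟶ x), proj f = 1 ↔ ∃ c : Kˣ, incl x c = f
  central : ∀ {x y : X} (f : x ⟶ y) (c : Kˣ), (incl x c : x ⟶ x) ≫ f = f ≫ (incl y c : y ⟶ y)

attribute [instance] CentralExtension.action CentralExtension.finite CentralExtension.groupoid

/-- Isomorphism of central extensions: an isomorphism of groupoids which is the identity
on `Kˣ` and lies over an isomorphism of action groupoids induced by an isomorphism of `G`-sets. -/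
def CentralExtension.Iso {G : Type v} {K : Type u} [Group G] [Field K]
    (E E' : CentralExtension G K) : Prop :=
  ∃ F : E.X ⥤ E'.X,
    Function.Bijective F.obj ∧
    (∀ x y : E.X, Function.Bijective (fun f : x ⟶ y => F.map f)) ∧
    (∀ (g : G) (x : E.X), F.obj (g • x) = g • F.obj x) ∧
    (∀ {x y : E.X} (f : x ⟶ y), E'.proj (F.map f) = E.proj f) ∧
    (∀ (x : E.X) (c : Kˣ), F.map (E.incl x c : x ⟶ x) = E'.incl (F.obj x) c)

/-- `E` is a central extension of the action groupoid of (a copy of) the `G`-set `X`, and for each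
point `x` the central extension `1 → Kˣ → Aut_E(x) → G_x → 1` has class `frill x`: for a suitable
set-theoretic section `s`, it is the class of `θ`, where `s(g) s(h) = θ(g, h) s(g h)`. -/
def CentralExtension.HasFrills {G : Type v} {K : Type u} [Group G] [Field K]
    (E : CentralExtension G K) (X : DecoratedSet G K) : Prop :=
  ∃ f : X.X ≃ E.X, (∀ (g : G) x, f (g • x) = g • f x) ∧
    ∀ x : X.X, ∃ (s : MulAction.stabilizer G x → (f x ⟶ f x))
      (θ : cocycle K (MulAction.stabilizer G x)),
      (∀ h, E.proj (s h) = h) ∧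
      (∀ g h, s h ≫ s g = s (g * h) ≫ (E.incl (f x) (θ.1 g h) : f x ⟶ f x)) ∧
      SchurMul.mk θ = X.frill x

/-! ### Semisimple split `G`-algebras and `G`-Morita equivalence -/

/-- A semisimple split `G`-algebra over `K`: an associative unital `K`-algebra with an action `α`
of `G` by algebra automorphisms, semisimple, all of whose simple modules are absolutely simple,
i.e. have only the scalars of `K` as endomorphisms. -/
structure SplitGAlgebra (G : Type v) (K : Type u) [Group G] [Field K] where
  A : Type u
  [ring : Ring A]
  [algebra : Algebra K A]
  α : G →* (A ≃ₐ[K] A)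
  semisimple : IsSemisimpleRing A
  split : ∀ (M : Type u) [AddCommGroup M] [Module A M] [IsSimpleModule A M] (f : M →ₗ[A] M),
    ∃ c : K, ∀ m, f m = algebraMap K A c • m

attribute [instance] SplitGAlgebra.ring SplitGAlgebra.algebra

namespace SplitGAlgebra

variable {G : Type v} {K : Type u} [Group G] [Field K]

/-- The twist `M ↦ M^[g]` of `A`-modules: `a` acts on `M^[g]` as `g(a)` acts on `M`. -/
def twist (A : SplitGAlgebra G K) (g : G) : ModuleCat.{u} A.A ⥤ ModuleCat.{u} A.A :=
  ModuleCat.restrictScalars (A.α g : A.A →+* A.A)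

/-- The identity maps `(M^[g])^[h] → M^[gh]`. -/
def twistMul (A : SplitGAlgebra G K) (g h : G) : A.twist g ⋙ A.twist h ≅ A.twist (g * h) :=
  (ModuleCat.restrictScalarsComp' (A.α h : A.A →+* A.A) (A.α g : A.A →+* A.A)
    (A.α (g * h) : A.A →+* A.A) (by ext a; simp)).symm

/-- `G`-Morita equivalence: there is a `K`-linear equivalence `Φ : A-Mod → B-Mod` of categories with
natural isomorphisms `β g : Φ(M^[g]) ≅ Φ(M)^[g]` compatible with the identifications
`(M^[g])^[h] = M^[gh]`. -/
def GMorita (A B : SplitGAlgebra G K) : Prop :=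
  ∃ (Φ : ModuleCat.{u} A.A ⥤ ModuleCat.{u} B.A) (_ : Φ.IsEquivalence) (_ : Φ.Additive)
    (_ : Φ.Linear K) (β : ∀ g : G, A.twist g ⋙ Φ ≅ Φ ⋙ B.twist g),
    ∀ (g h : G) (M : ModuleCat.{u} A.A),
      (β h).hom.app ((A.twist g).obj M) ≫ (B.twist h).map ((β g).hom.app M) ≫
          (B.twistMul g h).hom.app (Φ.obj M) =
        Φ.map ((A.twistMul g h).hom.app M) ≫ (β (g * h)).hom.app M

/-- The decorated set `X` is (a copy of) the decorated set `Irr(A)`. The family `M` represents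
every isomorphism class of simple `A`-modules exactly once; the action on points is
`g • [M] = [M^[g⁻¹]]`; and the frill of `x` is the class of the cocycle `θ` of a projective
representation `ρ` of the stabiliser on `M x` implementing the action of the stabiliser on `A`. -/
def HasIrr (A : SplitGAlgebra G K) (X : DecoratedSet G K) : Prop :=
  ∃ M : X.X → ModuleCat.{u} A.A,
    (∀ x, IsSimpleModule A.A (M x)) ∧
    (∀ x y, Nonempty (M x ≅ M y) → x = y) ∧
    (∀ N : ModuleCat.{u} A.A, IsSimpleModule A.A N → ∃ x, Nonempty (N ≅ M x)) ∧
    (∀ (g : G) x, Nonempty (M (g • x) ≅ (A.twist g⁻¹).obj (M x))) ∧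
    ∀ x, ∃ (ρ : MulAction.stabilizer G x → (M x ≃ₗ[K] M x))
      (θ : cocycle K (MulAction.stabilizer G x)),
      (∀ h (a : A.A) (m : M x), ρ h (a • m) = A.α h a • ρ h m) ∧
      (∀ g h (m : M x), ρ g (ρ h m) = (θ.1 g h : K) • ρ (g * h) m) ∧
      SchurMul.mk θ = X.frill x

end SplitGAlgebra

/-! ### Module categories over `G-Mod` -/

/-- A (right) `K`-linear module category over the tensor category `G-Mod` of finite-dimensional
representations of `G`. (Only module categories that are equivalent to direct sums of categories of
projective representations are used below; for these abelianness, and exactness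
of the action in both variables, are automatic.) -/
structure ModuleCategory (G : Type v) (K : Type u) [Group G] [Field K] where
  C : Type (max (u + 1) v)
  [category : Category.{u} C]
  [preadditive : Preadditive C]
  [linear : Linear K C]
  [act : MonoidalRightAction (FDRep K G) C]
  add_left : ∀ {M N : C} (f g : M ⟶ N) (W : FDRep K G),
    MonoidalRightAction.actionHomLeft (f + g) W =
      MonoidalRightAction.actionHomLeft f W + MonoidalRightAction.actionHomLeft g W
  smul_left : ∀ {M N : C} (c : K) (f : M ⟶ N) (W : FDRep K G),
    MonoidalRightAction.actionHomLeft (c • f) W = c • MonoidalRightAction.actionHomLeft f W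
  add_right : ∀ (M : C) {V W : FDRep K G} (f g : V ⟶ W),
    MonoidalRightAction.actionHomRight M (f + g) =
      MonoidalRightAction.actionHomRight M f + MonoidalRightAction.actionHomRight M g
  smul_right : ∀ (M : C) {V W : FDRep K G} (c : K) (f : V ⟶ W),
    MonoidalRightAction.actionHomRight M (c • f) = c • MonoidalRightAction.actionHomRight M f

attribute [instance] ModuleCategory.category ModuleCategory.preadditive ModuleCategory.linear
  ModuleCategory.act

/-- Equivalence of module categories: a `K`-linear equivalence of categories which is a
(strong) module functor. -/
def ModuleCategory.Equivalent {G : Type v} {K : Type u} [Group G] [Field K]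
    (M N : ModuleCategory G K) : Prop :=
  ∃ (F : M.C ⥤ N.C) (_ : F.IsEquivalence) (_ : F.Additive) (_ : F.Linear K),
    Nonempty (F.RightLinear (FDRep K G))

section DirectSum

instance piPreadditive {I : Type u} {C : I → Type v} [∀ i, Category.{u} (C i)]
    [∀ i, Preadditive (C i)] : Preadditive (∀ i, C i) where
  homGroup X Y := inferInstanceAs (AddCommGroup (∀ i, X i ⟶ Y i))
  add_comp := by intros; funext i; exact Preadditive.add_comp _ _ _ _ _ _
  comp_add := by intros; funext i; exact Preadditive.comp_add _ _ _ _ _ _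

instance piLinear {K : Type u} [Field K] {I : Type u} {C : I → Type v} [∀ i, Category.{u} (C i)]
    [∀ i, Preadditive (C i)] [∀ i, Linear K (C i)] : Linear K (∀ i, C i) where
  homModule X Y := inferInstanceAs (Module K (∀ i, X i ⟶ Y i))
  smul_comp := by intros; funext i; exact Linear.smul_comp _ _ _ _ _ _
  comp_smul := by intros; funext i; exact Linear.comp_smul _ _ _ _ _ _

open MonoidalRightAction in
instance piAction {T : Type*} [Category* T] [MonoidalCategory T] {I : Type u} {C : I → Type v}
    [∀ i, Category.{u} (C i)] [∀ i, MonoidalRightAction T (C i)] :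
    MonoidalRightAction T (∀ i, C i) where
  actionObj M W := fun i => actionObj (M i) W
  actionHomRight M _ _ f := fun i => actionHomRight (M i) f
  actionHomLeft f W := fun i => actionHomLeft (f i) W
  actionHom f g := fun i => actionHom (f i) g
  actionAssocIso M V W := Pi.isoMk fun i => actionAssocIso (M i) V W
  actionUnitIso M := Pi.isoMk fun i => actionUnitIso (M i)
  actionHom_def f g := by funext i; exact MonoidalRightAction.actionHom_def _ _
  actionHomRight_id c d := by funext i; exact MonoidalRightAction.actionHomRight_id _ _
  id_actionHomLeft c d := by funext i; exact MonoidalRightAction.id_actionHomLeft _ _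
  actionHom_comp _ _ _ _ := by funext i; exact MonoidalRightAction.actionHom_comp _ _ _ _
  actionAssocIso_hom_naturality _ _ _ := by
    funext i; exact MonoidalRightAction.actionAssocIso_hom_naturality _ _ _
  actionUnitIso_hom_naturality _ := by
    funext i; exact MonoidalRightAction.actionUnitIso_hom_naturality _
  actionHomRight_whiskerRight _ _ _ := by
    funext i; exact MonoidalRightAction.actionHomRight_whiskerRight _ _ _
  whiskerRight_actionHomLeft _ _ _ _ _ := by
    funext i; exact MonoidalRightAction.whiskerRight_actionHomLeft _ _ _
  actionHom_associator _ _ _ _ := by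
    funext i; exact MonoidalRightAction.actionHom_associator _ _ _ _
  actionHom_leftUnitor _ _ := by funext i; exact MonoidalRightAction.actionHom_leftUnitor _ _
  actionHom_rightUnitor _ _ := by funext i; exact MonoidalRightAction.actionHom_rightUnitor _ _

end DirectSum

/-- Direct sum of a finite family of module categories: objects and morphisms are families, and
`G-Mod` acts componentwise. -/
def ModuleCategory.directSum {G : Type v} {K : Type u} [Group G] [Field K] {I : Type u} [Finite I]
    (M : I → ModuleCategory G K) : ModuleCategory G K where
  C := ∀ i, (M i).C
  add_left _ _ _ := by funext i; exact (M i).add_left _ _ _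
  smul_left _ _ _ := by funext i; exact (M i).smul_left _ _ _
  add_right _ _ _ _ _ := by funext i; exact (M i).add_right _ _ _
  smul_right _ _ _ _ _ := by funext i; exact (M i).smul_right _ _ _

/-! ### Categories of projective representations and of `A * G`-modules -/

/-- For a group `H` acting by automorphisms `α` on a `K`-algebra `A` and a `2`-cocycle `θ` of `H`,
a finite-dimensional `θ`-twisted `H`-equivariant `A`-module: a finite-dimensional `K`-space `V` with
an `A`-module structure `act` and operators `ρ h` satisfying `ρ(g) ρ(h) = θ(g, h) ρ(g h)` and
`ρ(h) a = h(a) ρ(h)`. The value of `ρ 1` is what the first relation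
forces for invertible operators, so all `ρ h` are invertible. (The product of `End V` is the usual
composition of endomorphisms.) -/
structure TwistedModule {K : Type u} [Field K] {H : Type v} [Group H] {A : Type u} [Ring A]
    [Algebra K A] (α : H →* (A ≃ₐ[K] A)) (θ : cocycle K H) where
  V : FGModuleCat.{u} K
  act : A →ₐ[K] End V
  ρ : H → End V
  ρ_one : ρ 1 = (θ.1 1 1 : K) • (1 : End V)
  ρ_mul : ∀ g h, ρ g * ρ h = (θ.1 g h : K) • ρ (g * h)
  ρ_act : ∀ h a, ρ h * act a = act (α h a) * ρ h

namespace TwistedModule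

variable {K : Type u} [Field K] {H : Type v} [Group H] {A : Type u} [Ring A] [Algebra K A]
  {α : H →* (A ≃ₐ[K] A)} {θ : cocycle K H}

/-- Morphisms: linear maps commuting with `A` and `H`. -/
@[ext]
structure Hom (M N : TwistedModule α θ) where
  hom : M.V ⟶ N.V
  comm_act : ∀ a, (M.act a : M.V ⟶ M.V) ≫ hom = hom ≫ (N.act a : N.V ⟶ N.V)
  comm_ρ : ∀ h, (M.ρ h : M.V ⟶ M.V) ≫ hom = hom ≫ (N.ρ h : N.V ⟶ N.V)

instance : Category.{u} (TwistedModule α θ) where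
  Hom := Hom
  id M := ⟨𝟙 M.V, by simp, by simp⟩
  comp f g := ⟨f.hom ≫ g.hom,
    fun a => by rw [← Category.assoc, f.comm_act, Category.assoc, g.comm_act, Category.assoc],
    fun a => by rw [← Category.assoc, f.comm_ρ, Category.assoc, g.comm_ρ, Category.assoc]⟩

@[ext]
theorem hom_ext {M N : TwistedModule α θ} {f g : M ⟶ N} (h : f.hom = g.hom) : f = g :=
  Hom.ext h

@[simp] theorem id_hom (M : TwistedModule α θ) : Hom.hom (𝟙 M) = 𝟙 M.V := rfl
@[simp] theorem comp_hom {M N P : TwistedModule α θ} (f : M ⟶ N) (g : N ⟶ P) :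
    Hom.hom (f ≫ g) = f.hom ≫ g.hom := rfl

/-- Isomorphisms from isomorphisms of the underlying spaces. -/
@[simps]
def isoMk {M N : TwistedModule α θ} (e : M.V ≅ N.V)
    (h₁ : ∀ a, (M.act a : M.V ⟶ M.V) ≫ e.hom = e.hom ≫ (N.act a : N.V ⟶ N.V))
    (h₂ : ∀ h, (M.ρ h : M.V ⟶ M.V) ≫ e.hom = e.hom ≫ (N.ρ h : N.V ⟶ N.V)) : M ≅ N where
  hom := ⟨e.hom, h₁, h₂⟩
  inv := ⟨e.inv, fun a => by rw [Iso.eq_inv_comp, ← Category.assoc, ← h₁, Category.assoc,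
      Iso.hom_inv_id, Category.comp_id],
    fun a => by rw [Iso.eq_inv_comp, ← Category.assoc, ← h₂, Category.assoc,
      Iso.hom_inv_id, Category.comp_id]⟩

/-- The morphisms `M ⟶ N` form a linear subspace of the space of linear maps. -/
def homSubmodule (M N : TwistedModule α θ) : Submodule K (M.V ⟶ N.V) where
  carrier := {f | (∀ a, (M.act a : M.V ⟶ M.V) ≫ f = f ≫ (N.act a : N.V ⟶ N.V)) ∧
    ∀ h, (M.ρ h : M.V ⟶ M.V) ≫ f = f ≫ (N.ρ h : N.V ⟶ N.V)}
  add_mem' := by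
    rintro f g ⟨h₁, h₂⟩ ⟨h₃, h₄⟩
    exact ⟨fun a => by simp [h₁, h₃], fun a => by simp [h₂, h₄]⟩
  zero_mem' := by simp
  smul_mem' := by
    rintro c f ⟨h₁, h₂⟩
    exact ⟨fun a => by simp [h₁], fun a => by simp [h₂]⟩

/-- A morphism as an element of this subspace. -/
def homEquiv (M N : TwistedModule α θ) : (M ⟶ N) ≃ homSubmodule M N where
  toFun f := ⟨f.hom, f.comm_act, f.comm_ρ⟩
  invFun f := ⟨f.1, f.2.1, f.2.2⟩

instance : Preadditive (TwistedModule α θ) where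
  homGroup M N := (homEquiv M N).addCommGroup
  add_comp _ _ _ _ _ _ := hom_ext (Preadditive.add_comp _ _ _ _ _ _)
  comp_add _ _ _ _ _ _ := hom_ext (Preadditive.comp_add _ _ _ _ _ _)

instance : Linear K (TwistedModule α θ) where
  homModule M N := (homEquiv M N).module K
  smul_comp _ _ _ _ _ _ := hom_ext (Linear.smul_comp _ _ _ _ _ _)
  comp_smul _ _ _ _ _ _ := hom_ext (Linear.comp_smul _ _ _ _ _ _)

@[simp] theorem add_hom {M N : TwistedModule α θ} (f g : M ⟶ N) :
    Hom.hom (f + g) = f.hom + g.hom := rfl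
@[simp] theorem smul_hom {M N : TwistedModule α θ} (c : K) (f : M ⟶ N) :
    Hom.hom (c • f) = c • f.hom := rfl

/-- For a homomorphism `φ : H → G`, the tensor product `M ⊠ W` of a twisted module with a
representation of `G`: `A` acts on the first factor, `H` acts diagonally. -/
@[simps]
def tensor {G : Type v} [Group G] (φ : H →* G) (M : TwistedModule α θ) (W : FDRep K G) :
    TwistedModule α θ where
  V := M.V ⊗ W.V
  act := AlgHom.ofLinearMap
    { toFun := fun a => (M.act a : M.V ⟶ M.V) ▷ W.V
      map_add' := fun a b => by
        rw [map_add]; exact MonoidalPreadditive.add_whiskerRight _ _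
      map_smul' := fun c a => by
        rw [map_smul]; exact MonoidalLinear.smul_whiskerRight _ _ _ }
    (by
      simp only [LinearMap.coe_mk, AddHom.coe_mk, map_one]
      exact id_whiskerRight _ _)
    (fun a b => by
      simp only [LinearMap.coe_mk, AddHom.coe_mk, map_mul]
      exact comp_whiskerRight _ _ _)
  ρ h := (M.ρ h : M.V ⟶ M.V) ⊗ₘ (Action.ρ W (φ h) : W.V ⟶ W.V)
  ρ_one := by
    have h1 : (Action.ρ W (φ 1) : W.V ⟶ W.V) = 𝟙 _ := by rw [map_one, map_one]; rfl
    have h2 : (M.ρ 1 : M.V ⟶ M.V) = (θ.1 1 1 : K) • 𝟙 _ := M.ρ_one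
    rw [h1, h2, tensorHom_id, MonoidalLinear.smul_whiskerRight, id_whiskerRight]
    rfl
  ρ_mul g h := by
    have h1 : (Action.ρ W (φ (g * h)) : W.V ⟶ W.V) =
        (Action.ρ W (φ h) : W.V ⟶ W.V) ≫ (Action.ρ W (φ g) : W.V ⟶ W.V) := by
      rw [map_mul, map_mul]; rfl
    have h2 : (M.ρ h : M.V ⟶ M.V) ≫ (M.ρ g : M.V ⟶ M.V) = (θ.1 g h : K) • M.ρ (g * h) :=
      M.ρ_mul g h
    change ((M.ρ h : M.V ⟶ M.V) ⊗ₘ (Action.ρ W (φ h) : W.V ⟶ W.V)) ≫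
      ((M.ρ g : M.V ⟶ M.V) ⊗ₘ (Action.ρ W (φ g) : W.V ⟶ W.V)) = _
    rw [tensorHom_comp_tensorHom, h2, ← h1, MonoidalCategory.tensorHom_def, MonoidalLinear.smul_whiskerRight,
      Linear.smul_comp, ← MonoidalCategory.tensorHom_def]
  ρ_act h a := by
    have h2 : (M.act a : M.V ⟶ M.V) ≫ (M.ρ h : M.V ⟶ M.V) =
        (M.ρ h : M.V ⟶ M.V) ≫ (M.act (α h a) : M.V ⟶ M.V) := M.ρ_act h a
    change ((M.act a : M.V ⟶ M.V) ▷ W.V) ≫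
        ((M.ρ h : M.V ⟶ M.V) ⊗ₘ (Action.ρ W (φ h) : W.V ⟶ W.V)) =
      ((M.ρ h : M.V ⟶ M.V) ⊗ₘ (Action.ρ W (φ h) : W.V ⟶ W.V)) ≫
        ((M.act (α h a) : M.V ⟶ M.V) ▷ W.V)
    rw [← tensorHom_id, ← tensorHom_id, tensorHom_comp_tensorHom, tensorHom_comp_tensorHom, h2,
      Category.id_comp, Category.comp_id]

/-- The action `⊠` of `G-Mod` on twisted modules; the structure isomorphisms are those of vector
spaces. -/
@[reducible]
def rightAction {G : Type v} [Group G] (φ : H →* G) :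
    MonoidalRightAction (FDRep K G) (TwistedModule α θ) where
  actionObj M W := M.tensor φ W
  actionHomRight M W W' f := ⟨M.V ◁ f.hom,
    fun a => (whisker_exchange _ _).symm,
    fun h => by
      have h1 : (Action.ρ W (φ h) : W.V ⟶ W.V) ≫ f.hom = f.hom ≫ (Action.ρ W' (φ h) : W'.V ⟶ W'.V) :=
        f.comm (φ h)
      change ((M.ρ h : M.V ⟶ M.V) ⊗ₘ (Action.ρ W (φ h) : W.V ⟶ W.V)) ≫ M.V ◁ f.hom =
        M.V ◁ f.hom ≫ ((M.ρ h : M.V ⟶ M.V) ⊗ₘ (Action.ρ W' (φ h) : W'.V ⟶ W'.V))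
      rw [← id_tensorHom, tensorHom_comp_tensorHom, tensorHom_comp_tensorHom, h1,
        Category.id_comp, Category.comp_id]⟩
  actionHomLeft {M M'} f W := ⟨f.hom ▷ W.V,
    fun a => by
      change ((M.act a : M.V ⟶ M.V) ▷ W.V) ≫ f.hom ▷ W.V =
        f.hom ▷ W.V ≫ ((M'.act a : M'.V ⟶ M'.V) ▷ W.V)
      rw [← comp_whiskerRight, ← comp_whiskerRight, f.comm_act],
    fun h => by
      change ((M.ρ h : M.V ⟶ M.V) ⊗ₘ (Action.ρ W (φ h) : W.V ⟶ W.V)) ≫ f.hom ▷ W.V =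
        f.hom ▷ W.V ≫ ((M'.ρ h : M'.V ⟶ M'.V) ⊗ₘ (Action.ρ W (φ h) : W.V ⟶ W.V))
      rw [← tensorHom_id, tensorHom_comp_tensorHom, tensorHom_comp_tensorHom, f.comm_ρ,
        Category.id_comp, Category.comp_id]⟩
  actionAssocIso M W W' := isoMk (α_ M.V W.V W'.V).symm
    (fun a => by
      exact associator_inv_naturality_left (M.act a : M.V ⟶ M.V) W.V W'.V)
    (fun h => by
      exact associator_inv_naturality (M.ρ h : M.V ⟶ M.V) (Action.ρ W (φ h) : W.V ⟶ W.V)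
        (Action.ρ W' (φ h) : W'.V ⟶ W'.V))
  actionUnitIso M := isoMk (ρ_ M.V)
    (fun a => by
      exact rightUnitor_naturality (M.act a : M.V ⟶ M.V))
    (fun h => by
      have h1 : ((M.ρ h : M.V ⟶ M.V) ⊗ₘ 𝟙 (𝟙_ (FGModuleCat.{u} K))) ≫ (ρ_ M.V).hom =
          (ρ_ M.V).hom ≫ (M.ρ h : M.V ⟶ M.V) := by
        rw [tensorHom_id]; exact rightUnitor_naturality (M.ρ h : M.V ⟶ M.V)
      exact h1)
  actionHom_def f g := rfl
  actionHomRight_id c d := hom_ext (MonoidalCategory.whiskerLeft_id _ _)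
  id_actionHomLeft c d := hom_ext (MonoidalCategory.id_whiskerRight _ _)
  actionHom_comp {c c' c'' d d' d''} f₁ f₂ g₁ g₂ := by
    apply hom_ext
    change (f₁.hom ≫ f₂.hom) ▷ c.V ≫ d''.V ◁ (g₁.hom ≫ g₂.hom) =
      (f₁.hom ▷ c.V ≫ d'.V ◁ g₁.hom) ≫ (f₂.hom ▷ c'.V ≫ d''.V ◁ g₂.hom)
    rw [← MonoidalCategory.tensorHom_def, ← MonoidalCategory.tensorHom_def,
      ← MonoidalCategory.tensorHom_def, tensorHom_comp_tensorHom]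
  actionAssocIso_hom_naturality {d₁ d₂ c₁ c₂ c₃ c₄} f g h := by
    apply hom_ext
    change (f.hom ▷ (c₁.V ⊗ c₃.V) ≫ d₂.V ◁ (g.hom ⊗ₘ h.hom)) ≫ (α_ d₂.V c₂.V c₄.V).inv =
      (α_ d₁.V c₁.V c₃.V).inv ≫
        ((f.hom ▷ c₁.V ≫ d₂.V ◁ g.hom) ▷ c₃.V ≫ (d₂.V ⊗ c₂.V) ◁ h.hom)
    rw [← MonoidalCategory.tensorHom_def, ← MonoidalCategory.tensorHom_def,
      ← MonoidalCategory.tensorHom_def]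
    exact associator_inv_naturality _ _ _
  actionUnitIso_hom_naturality {d d'} f := hom_ext (rightUnitor_naturality f.hom).symm
  actionHomRight_whiskerRight {c' c''} f c d := by
    apply hom_ext
    change d.V ◁ (f.hom ▷ c.V) = (α_ d.V c'.V c.V).inv ≫ (d.V ◁ f.hom) ▷ c.V ≫
      (α_ d.V c''.V c.V).hom
    rw [MonoidalCategory.whisker_assoc, Category.assoc, Category.assoc, Iso.inv_hom_id,
      Category.comp_id, Iso.inv_hom_id_assoc]
  whiskerRight_actionHomLeft c {c' c''} f d := by
    apply hom_ext
    change d.V ◁ (c.V ◁ f.hom) = (α_ d.V c.V c'.V).inv ≫ (d.V ⊗ c.V) ◁ f.hom ≫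
      (α_ d.V c.V c''.V).hom
    rw [MonoidalCategory.tensor_whiskerLeft, Category.assoc, Category.assoc, Iso.inv_hom_id,
      Category.comp_id, Iso.inv_hom_id_assoc]
  actionHom_associator c₁ c₂ c₃ d := by
    apply hom_ext
    have h1 : (α_ c₁ c₂ c₃).hom.hom = (α_ c₁.V c₂.V c₃.V).hom := by simp
    change d.V ◁ (α_ c₁ c₂ c₃).hom.hom ≫ (α_ d.V c₁.V (c₂.V ⊗ c₃.V)).inv ≫
        (α_ (d.V ⊗ c₁.V) c₂.V c₃.V).inv =
      (α_ d.V (c₁.V ⊗ c₂.V) c₃.V).inv ≫ (α_ d.V c₁.V c₂.V).inv ▷ c₃.V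
    rw [h1]
    exact MonoidalCategory.pentagon_hom_inv_inv_inv_inv
  actionHom_leftUnitor c d := by
    apply hom_ext
    have h1 : (λ_ c).hom.hom = (λ_ c.V).hom := by simp
    change d.V ◁ (λ_ c).hom.hom = (α_ d.V (𝟙_ _) c.V).inv ≫ (ρ_ d.V).hom ▷ c.V
    rw [h1]
    exact (MonoidalCategory.triangle_assoc_comp_right _ _).symm
  actionHom_rightUnitor c d := by
    apply hom_ext
    have h1 : (ρ_ c).hom.hom = (ρ_ c.V).hom := by simp
    change d.V ◁ (ρ_ c).hom.hom = (α_ d.V c.V (𝟙_ _)).inv ≫ (ρ_ (d.V ⊗ c.V)).hom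
    rw [h1]
    exact MonoidalCategory.whiskerLeft_rightUnitor _ _

end TwistedModule

/-- The module category of twisted modules; `G-Mod` acts through `φ : H → G`. -/
def twistedModuleCategory {G H : Type v} {K : Type u} [Group G] [Field K] [Group H] {A : Type u}
    [Ring A] [Algebra K A] (α : H →* (A ≃ₐ[K] A)) (θ : cocycle K H) (φ : H →* G) :
    ModuleCategory G K where
  C := TwistedModule α θ
  act := TwistedModule.rightAction φ
  add_left _ _ _ := TwistedModule.hom_ext (MonoidalPreadditive.add_whiskerRight _ _)
  smul_left _ _ _ := TwistedModule.hom_ext (MonoidalLinear.smul_whiskerRight _ _ _)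
  add_right _ _ _ _ _ := TwistedModule.hom_ext (MonoidalPreadditive.whiskerLeft_add _ _)
  smul_right _ _ _ _ _ := TwistedModule.hom_ext (MonoidalLinear.whiskerLeft_smul _ _ _)

/-- `H-Mod_θ` for a subgroup `H` of `G`: finite-dimensional projective representations of `H` with
cocycle `θ` (twisted modules over `K` itself, on which `H` acts trivially). -/
def projMod {G : Type v} {K : Type u} [Group G] [Field K] (H : Subgroup G) (θ : cocycle K H) :
    ModuleCategory G K :=
  twistedModuleCategory (A := K) 1 θ H.subtype

/-- `A * G-Mod` for a `G`-algebra `A`: finite-dimensional spaces with actions of `A` and `G`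
satisfying `g a = g(a) g`, i.e. finite-dimensional modules over the skew group algebra `A * G`. -/
def SplitGAlgebra.skewMod {G : Type v} {K : Type u} [Group G] [Field K] (A : SplitGAlgebra G K) :
    ModuleCategory G K :=
  twistedModuleCategory A.α 1 (MonoidHom.id G)

/-- A module category is special if it is equivalent to a (finite) direct sum of module
categories `H-Mod_η`, for subgroups `H` of `G` and `η ∈ μ_K(H)`. -/
def ModuleCategory.IsSpecial {G : Type v} {K : Type u} [Group G] [Field K]
    (M : ModuleCategory G K) : Prop :=
  ∃ (I : Type u) (_ : Finite I) (H : I → Subgroup G) (θ : ∀ i, cocycle K (H i)),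
    M.Equivalent (directSum fun i => projMod (H i) (θ i))

/-- Special module categories over `G-Mod`. -/
def SpecialModuleCategory (G : Type v) (K : Type u) [Group G] [Field K] :=
  {M : ModuleCategory G K // M.IsSpecial}

/-- Equivalence of special module categories. -/
def SpecialModuleCategory.Equivalent {G : Type v} {K : Type u} [Group G] [Field K]
    (M N : SpecialModuleCategory G K) : Prop :=
  M.1.Equivalent N.1

end

noncomputable section

/-! ### Bijections between quotients from correspondences -/

/-! All four kinds of object are governed by a 2-cocycle `Θ g h x` with values in `Kˣ` on the action
groupoid of a `G`-set. A section of a central extension, or a choice of semilinear isomorphisms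
between simple modules, satisfies σ_g σ_h = Θ(g,h) σ_gh, and changing the choice changes `Θ` by a
coboundary. Each orbit of the action groupoid is equivalent to the isotropy group of one of its
points. Hence the classes of `Θ` on the stabilisers determine it up to coboundary
(`IsActionCocycle.exists_eq_mul`), and every equivariant system of frills occurs
(`DecoratedSet.exists_hasClass`). For extensions this is already the classification: two extensions
with a common cocycle are isomorphic (`CentralExtension.HasCocycle.iso`).

For algebras, the semilinear isomorphisms between simple modules form a central extension
(`semilinearExtension`), with kernel exactly `Kˣ` by Schur's lemma and splitness, so the frills of
Irr(A) are frills of an extension. If A and B have simple modules M_x and N_x with the same `Θ`,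
then V ↦ ∏ N_x ⊗ Hom_A(M_x, V) is a `G`-Morita equivalence (`SplitGAlgebra.HasCocycle.gMorita`): the
scalars `Θ` on N_x and `Θ`⁻¹ on Hom_A(M_x, V) cancel. An algebra with given frills is a product of
matrix algebras on which `G` acts by conjugation with a twisted regular representation
(`DecoratedSet.exists_hasIrr`).

For module categories, V ↦ Hom_A(M_x, V), with x running over orbit representatives, identifies A *
G-Mod with a direct sum of categories of projective representations
(`skewMod_equivalent_directSum`). Here h acts by f ↦ h f ρ(h)⁻¹, and this is where the inverse of
the frill comes from. Conversely, A * G-Mod determines the decorated set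
(`HasIrr.iso_of_skewMod_equivalent`). Indeed Hom(V ⊠ K[G], V') is Hom_A(V, V'); right translation on
K[G] induces conjugation by `G`, and the diagonal comultiplication induces composition. An
equivalence F of module categories therefore identifies End_A(V) with End_B(F V) as `G`-algebras. If
every simple module occurs in V, the simple modules of End_A(V) are the spaces Hom_A(M_x, V), so
they form the decorated set with inverse frills. Choosing V large enough on both sides makes the two
inverse decorated sets isomorphic.

Each correspondence is thus a relation that is total and unique on both sides, and
`exists_quot_equiv` turns it into a bijection of classes. -/

/-- A relation that is total on both sides and single-valued up to the given equivalences
induces a bijection of quotients. -/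
theorem exists_quot_equiv {α : Type*} {β : Type*} {r : α → α → Prop} {s : β → β → Prop}
    (hr : Equivalence r) (hs : Equivalence s) (R : α → β → Prop)
    (left_total : ∀ a, ∃ b, R a b) (right_total : ∀ b, ∃ a, R a b)
    (congr_right : ∀ {a b b'}, R a b → s b b' → R a b')
    (congr_left : ∀ {a a' b}, R a b → r a a' → R a' b)
    (left_unique : ∀ {a a' b}, R a b → R a' b → r a a')
    (right_unique : ∀ {a b b'}, R a b → R a b' → s b b') :
    ∃ e : Quot r ≃ Quot s, ∀ a b, e (Quot.mk _ a) = Quot.mk _ b ↔ R a b := by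
  have hr' : ∀ a a', Quot.mk r a = Quot.mk r a' ↔ r a a' := fun a a' => by
    rw [Quot.eq, hr.eqvGen_iff]
  have hs' : ∀ a a', Quot.mk s a = Quot.mk s a' ↔ s a a' := fun a a' => by
    rw [Quot.eq, hs.eqvGen_iff]
  choose f hf using left_total
  choose g hg using right_total
  refine ⟨⟨Quot.lift (fun a => Quot.mk s (f a)) fun a a' h => ?_,
    Quot.lift (fun b => Quot.mk r (g b)) fun b b' h => ?_, ?_, ?_⟩, fun a b => ?_⟩
  · exact (hs' _ _).2 (right_unique (congr_left (hf a) h) (hf a'))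
  · exact (hr' _ _).2 (left_unique (congr_right (hg b) h) (hg b'))
  · rintro ⟨a⟩
    exact (hr' _ _).2 (left_unique (hg _) (hf a))
  · rintro ⟨b⟩
    exact (hs' _ _).2 (right_unique (hf _) (hg b))
  · exact (hs' _ _).trans ⟨fun h => congr_right (hf a) h, fun h => right_unique (hf a) h⟩

/-! ### Cocycles on action groupoids -/

section ActionCocycle

variable {G : Type v} [Group G] {K : Type u} [Field K]

theorem SchurMul.mk_eq_mk_iff {H : Type v} [Group H] {θ θ' : cocycle K H} :
    SchurMul.mk θ = SchurMul.mk θ' ↔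
      ∃ c : H → Kˣ, ∀ g h, θ'.1 g h = θ.1 g h * (c g * c h * (c (g * h))⁻¹) := by
  unfold SchurMul.mk
  rw [QuotientGroup.eq]
  refine exists_congr fun c => forall_congr' fun g => forall_congr' fun h => ?_
  exact inv_mul_eq_iff_eq_mul

theorem SchurMul.mk_surjective {H : Type v} [Group H] (a : SchurMul K H) :
    ∃ θ : cocycle K H, SchurMul.mk θ = a :=
  QuotientGroup.mk_surjective a

theorem SchurMul.pullback_mk {H H' : Type v} [Group H] [Group H'] (φ : H →* H')
    (θ : cocycle K H') : SchurMul.pullback φ (SchurMul.mk θ) = SchurMul.mk (cocycle.pullback φ θ) :=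
  rfl

theorem SchurMul.mk_inv {H : Type v} [Group H] (θ : cocycle K H) :
    SchurMul.mk θ⁻¹ = (SchurMul.mk θ)⁻¹ := rfl

variable {X : Type u} [MulAction G X]

/-- A `2`-cocycle with values in `Kˣ` on the action groupoid of `X`. -/
def IsActionCocycle (Θ : G → G → X → Kˣ) : Prop :=
  ∀ g h k x, Θ g h (k • x) * Θ (g * h) k x = Θ h k x * Θ g (h * k) x

namespace IsActionCocycle

variable {Θ Θ' : G → G → X → Kˣ}

theorem inv (hΘ : IsActionCocycle Θ) : IsActionCocycle Θ⁻¹ := fun g h k x => by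
  simp only [Pi.inv_apply]
  rw [← mul_inv, hΘ, mul_inv]

theorem div (hΘ : IsActionCocycle Θ) (hΘ' : IsActionCocycle Θ') : IsActionCocycle (Θ / Θ') :=
  fun g h k x => by
    simp only [Pi.div_apply]
    rw [div_mul_div_comm, hΘ, hΘ', div_mul_div_comm]

/-- Cocycles are not assumed normalised; this and `one_right` measure the failure, which is why
factors `Θ 1 1 x` appear in units and inverses below. -/
theorem one_left (hΘ : IsActionCocycle Θ) (k : G) (x : X) : Θ 1 k x = Θ 1 1 (k • x) := by
  have := hΘ 1 1 k x
  simp only [one_mul] at this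
  exact (mul_right_cancel this).symm

theorem one_right (hΘ : IsActionCocycle Θ) (g : G) (x : X) : Θ g 1 x = Θ 1 1 x := by
  have := hΘ g 1 1 x
  simp only [one_smul, mul_one] at this
  exact mul_right_cancel this

theorem comp {Y : Type u} [MulAction G Y] (hΘ : IsActionCocycle Θ) (f : Y → X)
    (hf : ∀ (g : G) y, f (g • y) = g • f y) : IsActionCocycle fun g h y => Θ g h (f y) :=
  fun g h k y => by
    change Θ g h (f (k • y)) * _ = _
    rw [hf]
    exact hΘ g h k (f y)

/-- Restriction of a cocycle to the stabiliser of a point. -/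
def res (hΘ : IsActionCocycle Θ) (x : X) : cocycle K (MulAction.stabilizer G x) :=
  ⟨fun g h => Θ g h x, fun g h k => by
    have := hΘ g h k x
    rwa [show (k : G) • x = x from k.2] at this⟩

/-- If σ is a section with cocycle `Θ` and h' = g⁻¹hg, then σ_h and σ_g σ_h' σ_g⁻¹ lie over the same
arrow and differ by the factor Θ(h,g)/Θ(g,h'). This factor is the cochain comparing the two
restrictions. -/
theorem res_smul (hΘ : IsActionCocycle Θ) (g : G) (x : X) :
    SchurMul.mk (hΘ.res (g • x)) = SchurMul.pullback
      (MulAction.stabilizerEquivStabilizer (rfl : g • x = g • x)).symm.toMonoidHom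
        (SchurMul.mk (hΘ.res x)) := by
  rw [SchurMul.pullback_mk, eq_comm, SchurMul.mk_eq_mk_iff]
  refine ⟨fun h => Θ h g x / Θ g (g⁻¹ * h * g) x, fun h k => ?_⟩
  have hk : (g⁻¹ * k * g) • x = x := by
    rw [mul_assoc, mul_smul, mul_smul, inv_smul_eq_iff]; exact k.2
  have hh : ∀ h : MulAction.stabilizer G (g • x),
    (((MulAction.stabilizerEquivStabilizer (rfl : g • x = g • x)).symm.toMonoidHom h :
      MulAction.stabilizer G x) : G) = g⁻¹ * h * g := fun h => by
        simp [MulAction.stabilizerEquivStabilizer]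
  change Θ h k (g • x) = Θ _ _ x * _
  rw [hh, hh]
  change Θ h k (g • x) = _ * (Θ h g x / Θ g (g⁻¹ * h * g) x *
    (Θ k g x / Θ g (g⁻¹ * k * g) x) * (Θ (h * k) g x / Θ g (g⁻¹ * (h * k) * g) x)⁻¹)
  have e1 := hΘ h k g x
  have e2 := hΘ h g (g⁻¹ * k * g) x
  have e3 := hΘ g (g⁻¹ * h * g) (g⁻¹ * k * g) x
  rw [hk] at e2 e3
  have e4 : g * (g⁻¹ * k * g) = k * g := by group
  have e5 : g * (g⁻¹ * h * g) = h * g := by group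
  have e6 : g⁻¹ * h * g * (g⁻¹ * k * g) = g⁻¹ * (h * k) * g := by group
  rw [e4] at e2
  rw [e5, e6] at e3
  rw [← eq_mul_inv_iff_mul_eq] at e1
  rw [eq_comm, ← eq_inv_mul_iff_mul_eq] at e2
  rw [← eq_inv_mul_iff_mul_eq] at e3
  rw [e1, e2, e3, inv_div]
  simp only [div_eq_mul_inv]
  ac_rfl

/-- A cocycle whose restrictions to all stabilisers are coboundaries is a coboundary. -/
theorem exists_eq_of_res (hΘ : IsActionCocycle Θ)
    (h1 : ∀ x, SchurMul.mk (hΘ.res x) = SchurMul.mk 1) :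
    ∃ c : G → X → Kˣ, ∀ g h x, Θ g h x = c g (h • x) * c h x * (c (g * h) x)⁻¹ := by
  classical
  -- The trivialising cochain on the stabiliser of `s`, extended by 1 to all of `G` to avoid
  -- subtypes.
  have hd : ∀ s : X, ∃ d : G → Kˣ, ∀ g h, g • s = s → h • s = s →
      Θ g h s * d (g * h) = d g * d h := fun s => by
    obtain ⟨c, hc⟩ := SchurMul.mk_eq_mk_iff.1 (h1 s).symm
    refine ⟨fun g => if hg : g • s = s then c ⟨g, hg⟩ else 1, fun g h hg hh => ?_⟩
    have hgh : (g * h) • s = s := by rw [mul_smul, hh, hg]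
    have := hc ⟨g, hg⟩ ⟨h, hh⟩
    change Θ g h s = 1 * _ at this
    beta_reduce
    erw [dif_pos hg, dif_pos hh, dif_pos hgh, this, one_mul]
    exact inv_mul_cancel_right _ _
  choose d hd using hd
  let o : X → X := fun x => (Quotient.mk (MulAction.orbitRel G X) x).out
  have ho : ∀ g x, o (g • x) = o x := fun g x => by
    refine congrArg Quotient.out (Quotient.sound ?_)
    exact ⟨g, rfl⟩
  have ht : ∀ x, ∃ t : G, t • o x = x := fun x => by
    have h := Quotient.mk_out (s := MulAction.orbitRel G X) x
    obtain ⟨t, ht⟩ := (MulAction.orbitRel G X).symm h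
    exact ⟨t, ht⟩
  choose t ht using ht
  -- In terms of a section σ: σ_k / e(k) is σ_t times the trivialised loop σ_l / d(l), where l =
  -- t⁻¹k and t is the chosen arrow from the representative to k • s. Thus σ / e is compatible with
  -- precomposition by loops at `s`, which is `he`.
  let e : G → X → Kˣ := fun k s =>
    d s ((t (k • s))⁻¹ * k) / Θ (t (k • s)) ((t (k • s))⁻¹ * k) s
  have he : ∀ k h s, h • s = s → o s = s → e (k * h) s * Θ k h s = e k s * d s h := by
    intro k h s hs hos
    have hks : (k * h) • s = k • s := by rw [mul_smul, hs]
    have hts : ((t (k • s))⁻¹ * k) • s = s := by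
      have := ht (k • s)
      rw [ho, hos] at this
      rw [mul_smul, inv_smul_eq_iff, this]
    have e1 := hd s _ h hts hs
    have e2 := hΘ (t (k • s)) ((t (k • s))⁻¹ * k) h s
    rw [hs, mul_inv_cancel_left, mul_assoc] at e2
    rw [mul_assoc] at e1
    simp only [e, hks]
    rw [← eq_inv_mul_iff_mul_eq] at e1 e2
    rw [e1, e2]
    apply Units.ext
    push_cast
    have n := fun (a b : G) (x : X) => (Θ a b x).ne_zero
    field_simp
  -- Chosen so that σ_g / c(g) carries the corrected arrow over `t x` to the one over `g * t x`. By
  -- `hc` any other arrow from the representative to `x` would give the same value; this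
  -- independence makes σ / c multiplicative.
  let c : G → X → Kˣ := fun g x => Θ g (t x) (o x) * e (g * t x) (o x) / e (t x) (o x)
  have hc : ∀ g x k, k • o x = x → c g x * e k (o x) = Θ g k (o x) * e (g * k) (o x) := by
    intro g x k hk
    have hoo : o (o x) = o x := by conv_rhs => rw [← ht x, ho]
    have hs : ((t x)⁻¹ * k) • o x = o x := by rw [mul_smul, hk, inv_smul_eq_iff, ht]
    have e1 := he (t x) _ _ hs hoo
    have e2 := he (g * t x) _ _ hs hoo
    have e3 := hΘ g (t x) ((t x)⁻¹ * k) (o x)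
    rw [mul_inv_cancel_left] at e1 e3
    rw [mul_assoc, mul_inv_cancel_left] at e2
    rw [hs] at e3
    rw [← eq_mul_inv_iff_mul_eq] at e1 e2
    rw [eq_comm, ← eq_inv_mul_iff_mul_eq] at e3
    simp only [c]
    rw [e1, e2, e3]
    apply Units.ext
    push_cast
    field_simp
  refine ⟨c, fun g h x => ?_⟩
  have e1 := hc h x (t x) (ht x)
  have e2 := hc (g * h) x (t x) (ht x)
  have e3 := hc g (h • x) (h * t x) (by rw [ho, mul_smul, ht])
  have e4 := hΘ g h (t x) (o x)
  rw [ht] at e4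
  rw [ho] at e3
  rw [mul_assoc] at e2
  rw [← eq_mul_inv_iff_mul_eq] at e1 e2 e3 e4
  rw [e1, e2, e3, e4]
  apply Units.ext
  push_cast
  field_simp

/-- Two cocycles with the same classes at all points are cohomologous. -/
theorem exists_eq_mul (hΘ : IsActionCocycle Θ) (hΘ' : IsActionCocycle Θ')
    (h : ∀ x, SchurMul.mk (hΘ.res x) = SchurMul.mk (hΘ'.res x)) :
    ∃ c : G → X → Kˣ, ∀ g h x, Θ' g h x = Θ g h x * (c g (h • x) * c h x * (c (g * h) x)⁻¹) := by
  obtain ⟨c, hc⟩ := (hΘ'.div hΘ).exists_eq_of_res fun x => by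
    obtain ⟨c, hc⟩ := SchurMul.mk_eq_mk_iff.1 (h x)
    refine (SchurMul.mk_eq_mk_iff.2 ⟨c, fun a b => ?_⟩).symm
    change Θ' a b x / Θ a b x = 1 * _
    rw [one_mul, div_eq_iff_eq_mul, mul_comm]
    exact hc a b
  exact ⟨c, fun g h x => by rw [← hc]; exact (mul_div_cancel _ _).symm⟩

end IsActionCocycle

/-- The class of an action cocycle is given by the frills of a decorated set. -/
def DecoratedSet.HasClass (X : DecoratedSet G K) {Θ : G → G → X.X → Kˣ}
    (hΘ : IsActionCocycle Θ) : Prop :=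
  ∀ x, SchurMul.mk (hΘ.res x) = X.frill x

/-- The decorated set defined by an action cocycle. -/
def DecoratedSet.ofCocycle [Finite X] {Θ : G → G → X → Kˣ} (hΘ : IsActionCocycle Θ) :
    DecoratedSet G K where
  X := X
  frill x := SchurMul.mk (hΘ.res x)
  equivariant := hΘ.res_smul

theorem DecoratedSet.frill_eq (X : DecoratedSet G K) {g : G} {x y : X.X} (h : y = g • x) :
    X.frill y = SchurMul.pullback
      (MulAction.stabilizerEquivStabilizer h).symm.toMonoidHom (X.frill x) := by
  subst h
  exact X.equivariant g x

/-- Every decorated set comes from an action cocycle. -/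
theorem DecoratedSet.exists_hasClass (X : DecoratedSet G K) :
    ∃ (Θ : G → G → X.X → Kˣ) (hΘ : IsActionCocycle Θ), X.HasClass hΘ := by
  classical
  have hd : ∀ s : X.X, ∃ (d : G → G → Kˣ) (θ : cocycle K (MulAction.stabilizer G s)),
      SchurMul.mk θ = X.frill s ∧ ∀ g h : MulAction.stabilizer G s, d g h = θ.1 g h := fun s => by
    obtain ⟨θ, hθ⟩ := SchurMul.mk_surjective (X.frill s)
    -- Extension by 1 off the stabiliser; only values at elements of the stabiliser are ever used.
    refine ⟨fun g h => if hgh : g ∈ MulAction.stabilizer G s ∧ h ∈ MulAction.stabilizer G s then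
      θ.1 ⟨g, hgh.1⟩ ⟨h, hgh.2⟩ else 1, θ, hθ, fun g h => ?_⟩
    exact dif_pos ⟨g.2, h.2⟩
  choose d θ hθ hd using hd
  let o : X.X → X.X := fun x => (Quotient.mk (MulAction.orbitRel G X.X) x).out
  have ho : ∀ (g : G) x, o (g • x) = o x := fun g x =>
    congrArg Quotient.out (Quotient.sound ⟨g, rfl⟩)
  have ht : ∀ x, ∃ t : G, t • o x = x := fun x => by
    have h := Quotient.mk_out (s := MulAction.orbitRel G X.X) x
    obtain ⟨t, ht⟩ := (MulAction.orbitRel G X.X).symm h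
    exact ⟨t, ht⟩
  choose t ht using ht
  have hs : ∀ g x, (t (g • x))⁻¹ * g * t x ∈ MulAction.stabilizer G (o x) := fun g x => by
    rw [MulAction.mem_stabilizer_iff, mul_smul, mul_smul, inv_smul_eq_iff, ht]
    have := ht (g • x)
    rw [ho] at this
    exact this.symm
  -- The pullback of the cocycle at the representative along the retraction of the orbit onto its
  -- isotropy group that sends an arrow `g` from `x` to the loop t(gx)⁻¹ g t(x).
  let Θ : G → G → X.X → Kˣ := fun g h x =>
    d (o x) ((t (g • h • x))⁻¹ * g * t (h • x)) ((t (h • x))⁻¹ * h * t x)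
  have hΘ : IsActionCocycle Θ := fun g h k x => by
    have m1 := hs k x
    have m2 := hs h (k • x)
    have m3 := hs g (h • k • x)
    rw [ho] at m2
    rw [ho, ho] at m3
    have := (θ (o x)).2 ⟨_, m3⟩ ⟨_, m2⟩ ⟨_, m1⟩
    simp only [← hd, Subgroup.coe_mul] at this
    simp only [Θ, ho, mul_smul]
    convert this using 3 <;> group
  refine ⟨Θ, hΘ, fun x => ?_⟩
  -- On the stabiliser of `x` the retraction is conjugation by `t x`, so equality holds already for
  -- cocycles, and equivariance of the frills finishes.
  rw [X.frill_eq (ht x).symm, ← hθ, SchurMul.pullback_mk]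
  congr 1
  ext1
  funext g h
  have hh : ∀ h : MulAction.stabilizer G x,
    (((MulAction.stabilizerEquivStabilizer (ht x).symm).symm.toMonoidHom h :
      MulAction.stabilizer G (o x)) : G) = (t x)⁻¹ * h * t x := fun h => by
        simp [MulAction.stabilizerEquivStabilizer]
  change Θ g h x = (θ (o x)).1 _ _
  rw [← hd, hh, hh]
  have h1 : (h : G) • x = x := h.2
  have h2 : (g : G) • x = x := g.2
  simp only [Θ, h1, h2]

theorem SchurMul.pullback_id {H : Type v} [Group H] {φ : H →* H} (hφ : ∀ h, φ h = h)
    (a : SchurMul K H) : SchurMul.pullback φ a = a := by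
  obtain ⟨θ, rfl⟩ := SchurMul.mk_surjective a
  rw [SchurMul.pullback_mk]
  congr 1
  ext1
  funext g h
  change θ.1 (φ g) (φ h) = _
  rw [hφ, hφ]

theorem SchurMul.pullback_pullback {H H' H'' : Type v} [Group H] [Group H'] [Group H'']
    (φ : H →* H') (ψ : H' →* H'') (a : SchurMul K H'') :
    SchurMul.pullback φ (SchurMul.pullback ψ a) = SchurMul.pullback (ψ.comp φ) a := by
  obtain ⟨θ, rfl⟩ := SchurMul.mk_surjective a
  rfl

/-- The frills at equal points lie in cohomology groups of different types; after pulling back to a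
common group they can be compared without casts. -/
theorem DecoratedSet.pullback_frill_congr (X : DecoratedSet G K) {H : Type v} [Group H]
    {x x' : X.X} (h : x' = x) (φ : H →* MulAction.stabilizer G x')
    (φ' : H →* MulAction.stabilizer G x) (hφ : ∀ g, (φ g : G) = φ' g) :
    SchurMul.pullback φ (X.frill x') = SchurMul.pullback φ' (X.frill x) := by
  subst h
  rw [show φ = φ' from MonoidHom.ext fun g => Subtype.ext (hφ g)]

theorem DecoratedSet.iso_equivalence : Equivalence (DecoratedSet.Iso (G := G) (K := K)) where
  refl X := ⟨Equiv.refl _, fun _ _ => rfl, fun x =>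
    (SchurMul.pullback_id (fun _ => rfl) _).symm⟩
  symm := by
    rintro X Y ⟨f, hf, h⟩
    refine ⟨f.symm, fun g y => by rw [Equiv.symm_apply_eq, hf, Equiv.apply_symm_apply],
      fun y => ?_⟩
    obtain ⟨x, rfl⟩ := f.surjective y
    rw [X.pullback_frill_congr (f.symm_apply_apply x) _ (Subgroup.inclusion fun g hg => by
      rw [MulAction.mem_stabilizer_iff] at hg ⊢
      exact f.injective (by rw [hf, hg])) (fun g => rfl), h, SchurMul.pullback_pullback,
      SchurMul.pullback_id fun _ => rfl]
  trans := by
    rintro X Y Z ⟨f, hf, h⟩ ⟨f', hf', h'⟩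
    refine ⟨f.trans f', fun g x => by simp [hf, hf'], fun x => ?_⟩
    rw [h, h', SchurMul.pullback_pullback]
    rfl

/-- The decorated set with the inverse frills. -/
def DecoratedSet.inv (X : DecoratedSet G K) : DecoratedSet G K where
  X := X.X
  frill x := (X.frill x)⁻¹
  equivariant g x := by rw [X.equivariant, map_inv]

theorem DecoratedSet.Iso.of_inv {X Y : DecoratedSet G K} (h : X.inv.Iso Y.inv) : X.Iso Y := by
  obtain ⟨f, hf, h⟩ := h
  refine ⟨f, hf, fun x => inv_injective ((h x).trans ?_)⟩
  exact map_inv _ _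

end ActionCocycle

/-! ### Central extensions and action cocycles -/

namespace CentralExtension

variable {G : Type v} [Group G] {K : Type u} [Field K] (E : CentralExtension G K)

/-- The product of an arrow with a scalar. -/
def scale {x y : E.X} (a : x ⟶ y) (c : Kˣ) : x ⟶ y := a ≫ (E.incl y c : y ⟶ y)

variable {E}

theorem incl_comp_incl (x : E.X) (c d : Kˣ) :
    (E.incl x c : x ⟶ x) ≫ (E.incl x d : x ⟶ x) = E.incl x (c * d) :=
  (map_mul (E.incl x) d c).symm.trans (congrArg _ (mul_comm d c))

theorem scale_comp {x y z : E.X} (a : x ⟶ y) (b : y ⟶ z) (c : Kˣ) :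
    E.scale a c ≫ b = E.scale (a ≫ b) c := by
  simp only [scale, Category.assoc]
  rw [E.central]

theorem comp_scale {x y z : E.X} (a : x ⟶ y) (b : y ⟶ z) (c : Kˣ) :
    a ≫ E.scale b c = E.scale (a ≫ b) c := by
  simp only [scale, Category.assoc]

theorem scale_scale {x y : E.X} (a : x ⟶ y) (c d : Kˣ) :
    E.scale (E.scale a c) d = E.scale a (c * d) := by
  simp only [scale, Category.assoc]
  rw [incl_comp_incl]

theorem scale_one {x y : E.X} (a : x ⟶ y) : E.scale a 1 = a := by
  have : (E.incl y 1 : y ⟶ y) = 𝟙 y := map_one (E.incl y)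
  rw [scale, this, Category.comp_id]

theorem proj_incl (x : E.X) (c : Kˣ) : E.proj (E.incl x c : x ⟶ x) = 1 :=
  (E.exact _).2 ⟨c, rfl⟩

theorem proj_scale {x y : E.X} (a : x ⟶ y) (c : Kˣ) : E.proj (E.scale a c) = E.proj a := by
  rw [scale, E.proj_comp, proj_incl, one_mul]

theorem scale_injective {x y : E.X} (a : x ⟶ y) : Function.Injective (E.scale a) :=
  fun _ _ h => E.incl_injective y ((cancel_epi a).1 h)

theorem proj_inv {x y : E.X} (a : x ⟶ y) : E.proj (inv a) = (E.proj a)⁻¹ := by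
  have := E.proj_comp a (inv a)
  rw [IsIso.hom_inv_id, E.proj_id] at this
  exact eq_inv_of_mul_eq_one_left this.symm

/-- The arrows over a given `g` form a `Kˣ`-torsor: b⁻¹a lies over 1, so by exactness it is a
scalar. -/
theorem exists_eq_scale {x y : E.X} {a b : x ⟶ y} (h : E.proj a = E.proj b) :
    ∃ c, a = E.scale b c := by
  obtain ⟨c, hc⟩ := (E.exact (inv b ≫ a)).1 (by
    rw [E.proj_comp, proj_inv, h, mul_inv_cancel])
  exact ⟨c, by rw [scale, hc, IsIso.hom_inv_id_assoc]⟩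

theorem exists_arrow {x y : E.X} {g : G} (h : g • x = y) : ∃ a : x ⟶ y, E.proj a = g := by
  subst h
  exact E.proj_surjective g x

variable {X : Type u} [MulAction G X]

/-- A section of the extension, along an identification `f` of the set of objects, has cocycle
`Θ`. -/
def HasCocycle (E : CentralExtension G K) (f : X ≃ E.X) (Θ : G → G → X → Kˣ) : Prop :=
  -- The target is a separate variable with an equation, because `(g * h) • x` and `g • h • x` are
  -- only propositionally equal.
  ∃ σ : ∀ (g : G) (x y : X), g • x = y → (f x ⟶ f y),
    (∀ g x y h, E.proj (σ g x y h) = g) ∧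
    ∀ g h x y z (hx : h • x = y) (hy : g • y = z),
      σ h x y hx ≫ σ g y z hy = E.scale (σ (g * h) x z (by rw [mul_smul, hx, hy])) (Θ g h x)

/-- Any set-theoretic section is multiplicative up to scalars, and the two bracketings of a triple
composite give the cocycle identity. -/
theorem exists_hasCocycle (f : X ≃ E.X) (hf : ∀ (g : G) x, f (g • x) = g • f x) :
    ∃ Θ : G → G → X → Kˣ, IsActionCocycle Θ ∧ E.HasCocycle f Θ := by
  have hσ : ∀ (g : G) (x y : X), g • x = y → ∃ a : f x ⟶ f y, E.proj a = g :=
    fun g x y h => exists_arrow (by rw [← hf, h])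
  choose σ hσ using hσ
  have hΘ : ∀ (g h : G) (x : X), ∃ c, σ h x (h • x) rfl ≫ σ g (h • x) (g • h • x) rfl =
      E.scale (σ (g * h) x (g • h • x) (mul_smul _ _ _)) c := fun g h x =>
    exists_eq_scale (by rw [E.proj_comp, hσ, hσ, hσ])
  choose Θ hΘ using hΘ
  have hΘ' : ∀ g h x y z (hx : h • x = y) (hy : g • y = z),
      σ h x y hx ≫ σ g y z hy = E.scale (σ (g * h) x z (by rw [mul_smul, hx, hy])) (Θ g h x) := by
    intro g h x y z hx hy
    subst hx hy
    exact hΘ g h x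
  refine ⟨Θ, fun g h k x => ?_, σ, hσ, hΘ'⟩
  have e1 := hΘ' h k x _ _ rfl rfl
  have e2 := hΘ' g h (k • x) _ _ rfl rfl
  have e3 := hΘ' (g * h) k x _ (g • h • k • x) rfl (mul_smul _ _ _)
  have e4 := hΘ' g (h * k) x (h • k • x) (g • h • k • x) (mul_smul _ _ _) rfl
  have := Category.assoc (σ k x _ rfl) (σ h (k • x) _ rfl) (σ g (h • k • x) _ rfl)
  rw [e1, e2, scale_comp, comp_scale, e3, e4, scale_scale, scale_scale] at this
  have h4 : (g * (h * k)) • x = g • h • k • x := by simp only [mul_smul]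
  have h3 : ∀ (a b : G) (hab : a = b) (ha : a • x = g • h • k • x) (hb : b • x = g • h • k • x),
      σ a _ _ ha = σ b _ _ hb := by rintro a _ rfl _ _; rfl
  rw [h3 _ _ (mul_assoc g h k) _ h4] at this
  have := scale_injective _ this
  rw [mul_comm, ← this, mul_comm]

theorem HasCocycle.mul {f : X ≃ E.X} {Θ Θ' : G → G → X → Kˣ} (h : E.HasCocycle f Θ)
    {c : G → X → Kˣ}
    (hc : ∀ g h x, Θ' g h x = Θ g h x * (c g (h • x) * c h x * (c (g * h) x)⁻¹)) :
    E.HasCocycle f Θ' := by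
  obtain ⟨σ, hσ, h⟩ := h
  refine ⟨fun g x y hx => E.scale (σ g x y hx) (c g x), fun g x y hx => ?_,
    fun g k x y z hx hy => ?_⟩
  · rw [proj_scale, hσ]
  · simp only [scale_comp, comp_scale, scale_scale, h, hc]
    congr 1
    rw [← hx]
    apply Units.ext
    push_cast
    field_simp

/-- If an extension has cocycle `Θ`, then the classes of its isotropy groups are those of `Θ`. -/
theorem HasCocycle.res_eq {f : X ≃ E.X} {Θ : G → G → X → Kˣ} (hΘ : IsActionCocycle Θ)
    (h : E.HasCocycle f Θ) (x : X) {s : MulAction.stabilizer G x → (f x ⟶ f x)}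
    {θ : cocycle K (MulAction.stabilizer G x)} (hs : ∀ h, E.proj (s h) = h)
    (hθ : ∀ g h, s h ≫ s g = s (g * h) ≫ (E.incl (f x) (θ.1 g h) : f x ⟶ f x)) :
    SchurMul.mk (hΘ.res x) = SchurMul.mk θ := by
  obtain ⟨σ, hσ, h⟩ := h
  have hst : ∀ g : MulAction.stabilizer G x, (g : G) • x = x := fun g => g.2
  have hc : ∀ g : MulAction.stabilizer G x, ∃ c, s g = E.scale (σ g x x (hst g)) c :=
    fun g => exists_eq_scale (by rw [hs, hσ])
  choose c hc using hc
  refine SchurMul.mk_eq_mk_iff.2 ⟨c, fun g k => ?_⟩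
  have := hθ g k
  change _ = E.scale _ _ at this
  rw [hc, hc, hc, scale_comp, comp_scale, h, scale_scale, scale_scale, scale_scale] at this
  have := scale_injective _ this
  change _ = Θ g k x * _
  rw [← mul_assoc, eq_mul_inv_iff_mul_eq, mul_comm, ← this]

theorem HasCocycle.hasFrills {X : DecoratedSet G K} {f : X.X ≃ E.X}
    (hf : ∀ (g : G) x, f (g • x) = g • f x) {Θ : G → G → X.X → Kˣ}
    {hΘ : IsActionCocycle Θ} (h : E.HasCocycle f Θ) (hX : X.HasClass hΘ) : E.HasFrills X := by
  obtain ⟨σ, hσ, h⟩ := h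
  exact ⟨f, hf, fun x => ⟨fun g => σ g x x g.2, hΘ.res x, fun g => hσ _ _ _ _,
    fun g k => h g k x x x k.2 g.2, hX x⟩⟩

/-- The classes at points fix the cocycle up to a coboundary, and a coboundary is absorbed by
rescaling the section. So any prescribed cocycle with the right classes is realised exactly. -/
theorem HasFrills.exists_hasCocycle {X : DecoratedSet G K} (h : E.HasFrills X)
    {Θ : G → G → X.X → Kˣ} {hΘ : IsActionCocycle Θ} (hX : X.HasClass hΘ) :
    ∃ f : X.X ≃ E.X, (∀ (g : G) x, f (g • x) = g • f x) ∧ E.HasCocycle f Θ := by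
  obtain ⟨f, hf, h⟩ := h
  obtain ⟨Θ', hΘ', hE⟩ := CentralExtension.exists_hasCocycle f hf
  obtain ⟨c, hc⟩ := hΘ'.exists_eq_mul hΘ fun x => by
    obtain ⟨s, θ, hs, hθ, hx⟩ := h x
    rw [hE.res_eq hΘ' x hs hθ, hX x, hx]
  exact ⟨f, hf, hE.mul hc⟩

theorem HasCocycle.comp {Y : Type u} [MulAction G Y] {f : X ≃ E.X} {Θ : G → G → X → Kˣ}
    (h : E.HasCocycle f Θ) (e : Y ≃ X) (he : ∀ (g : G) y, e (g • y) = g • e y) :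
    E.HasCocycle (e.trans f) (fun g k y => Θ g k (e y)) := by
  obtain ⟨σ, hσ, h⟩ := h
  exact ⟨fun g x y hy => σ g (e x) (e y) (by rw [← he, hy]), fun g x y _ => hσ _ _ _ _,
    fun g k x y z _ _ => h _ _ _ _ _ _ _⟩

/-- The isomorphism sends σ_g · c to σ'_g · c; equality of the cocycles makes it a functor. -/
theorem HasCocycle.iso_of_refl {E E' : CentralExtension G K} {f : E.X ≃ E'.X}
    (hf : ∀ (g : G) x, f (g • x) = g • f x) {Θ : G → G → E.X → Kˣ}
    (h : E.HasCocycle (Equiv.refl _) Θ) (h' : E'.HasCocycle f Θ) : E.Iso E' := by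
  obtain ⟨σ, hσ, h⟩ : ∃ σ : ∀ (g : G) (x y : E.X), g • x = y → (x ⟶ y),
    (∀ g x y h, E.proj (σ g x y h) = g) ∧ ∀ g h x y z (hx : h • x = y) (hy : g • y = z),
      σ h x y hx ≫ σ g y z hy = E.scale (σ (g * h) x z (by rw [mul_smul, hx, hy])) (Θ g h x) := h
  obtain ⟨σ', hσ', h'⟩ := h'
  -- The image is characterised for every presentation of `a` as a multiple of some σ_g, so that it
  -- can later be computed without rewriting along `E.proj a = g`.
  have hm : ∀ {x y : E.X} (a : x ⟶ y), ∃ b : f x ⟶ f y, ∀ g (hg : g • x = y) (c : Kˣ),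
      a = E.scale (σ g x y hg) c → b = E'.scale (σ' g x y hg) c := by
    intro x y a
    obtain ⟨c, hc⟩ := exists_eq_scale (a := a) (b := σ _ x y (E.proj_smul a)) (hσ _ _ _ _).symm
    refine ⟨E'.scale (σ' _ x y (E.proj_smul a)) c, fun g hg c' hc' => ?_⟩
    obtain rfl : E.proj a = g := by rw [hc', proj_scale, hσ]
    rw [scale_injective _ (hc.symm.trans hc')]
  let m : ∀ {x y : E.X}, (x ⟶ y) → (f x ⟶ f y) := fun a => (hm a).choose
  replace hm : ∀ {x y : E.X} (a : x ⟶ y) g (hg : g • x = y) (c : Kˣ),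
      a = E.scale (σ g x y hg) c → m a = E'.scale (σ' g x y hg) c := fun a => (hm a).choose_spec
  have ha : ∀ {x y : E.X} (a : x ⟶ y), ∃ c, a = E.scale (σ _ x y (E.proj_smul a)) c :=
    fun {x y} a => exists_eq_scale (hσ _ _ _ _).symm
  have hcomp : ∀ {x y z : E.X} (a : x ⟶ y) (b : y ⟶ z), m (a ≫ b) = m a ≫ m b := by
    intro x y z a b
    obtain ⟨c, hc⟩ := ha a
    obtain ⟨d, hd⟩ := ha b
    have e : a ≫ b = E.scale (σ (E.proj b * E.proj a) x z (by
        rw [mul_smul, E.proj_smul, E.proj_smul])) (Θ (E.proj b) (E.proj a) x * (d * c)) :=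
      (congrArg₂ (· ≫ ·) hc hd).trans (by
        rw [scale_comp, comp_scale, h, scale_scale, scale_scale])
    rw [hm _ _ _ _ e, hm a _ _ _ hc, hm b _ _ _ hd, scale_comp, comp_scale, h', scale_scale,
      scale_scale]
  -- An idempotent arrow of a groupoid is an identity; this avoids the value of the unnormalised
  -- section at 1.
  have hid : ∀ x : E.X, m (𝟙 x) = 𝟙 (f x) := fun x => by
    have := hcomp (𝟙 x) (𝟙 x)
    rw [Category.comp_id] at this
    rw [← cancel_mono (m (𝟙 x)), ← this, Category.id_comp]
  refine ⟨{ obj := f, map := m, map_id := hid, map_comp := hcomp }, f.bijective,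
    fun x y => ⟨fun a b hab => ?_, fun b => ?_⟩, hf, fun {x y} a => ?_, fun x c => ?_⟩
  · obtain ⟨c, hc⟩ := ha a
    obtain ⟨d, hd⟩ := ha b
    have hab : m a = m b := hab
    rw [hm a _ _ _ hc, hm b _ _ _ hd] at hab
    have hp : E.proj a = E.proj b := by
      have := congrArg E'.proj hab
      rwa [proj_scale, proj_scale, hσ', hσ'] at this
    obtain ⟨e, he⟩ := exists_eq_scale (E := E) hp
    have h1 := hm a (E.proj b) (E.proj_smul b) (d * e) (by rw [he, ← scale_scale, ← hd])
    rw [← hm a _ _ _ hc, h1] at hab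
    have := scale_injective _ hab
    rw [he, mul_eq_left.1 this, scale_one]
  · have hg : E'.proj b • x = y := f.injective (by rw [hf]; exact E'.proj_smul b)
    obtain ⟨c, hc⟩ := exists_eq_scale (E := E') (a := b) (b := σ' _ x y hg) (hσ' _ _ _ _).symm
    exact ⟨E.scale (σ _ x y hg) c, (hm _ _ _ _ rfl).trans hc.symm⟩
  · obtain ⟨c, hc⟩ := ha a
    exact (congrArg E'.proj (hm a _ _ _ hc)).trans (by rw [proj_scale, hσ'])
  · obtain ⟨d, hd⟩ := ha (𝟙 x)
    have h1 : (E.incl x c : x ⟶ x) = E.scale (𝟙 x) c := (Category.id_comp _).symm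
    have h2 : (E'.incl (f x) c : f x ⟶ f x) = E'.scale (𝟙 (f x)) c := (Category.id_comp _).symm
    change m _ = _
    refine Eq.trans ?_ h2.symm
    rw [← hid x, hm _ _ _ _ hd, scale_scale]
    refine hm _ _ _ _ ?_
    rw [← scale_scale, ← hd, h1]

theorem HasCocycle.iso {E E' : CentralExtension G K} {f : X ≃ E.X} {f' : X ≃ E'.X}
    (hf : ∀ (g : G) x, f (g • x) = g • f x) (hf' : ∀ (g : G) x, f' (g • x) = g • f' x)
    {Θ : G → G → X → Kˣ} (h : E.HasCocycle f Θ) (h' : E'.HasCocycle f' Θ) : E.Iso E' := by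
  have hs : ∀ (g : G) y, f.symm (g • y) = g • f.symm y := fun g y => by
    rw [Equiv.symm_apply_eq, hf, Equiv.apply_symm_apply]
  have h1 := h.comp f.symm hs
  rw [Equiv.symm_trans_self] at h1
  exact h1.iso_of_refl (fun g x => by simp [hf', hs]) (h'.comp f.symm hs)

theorem HasFrills.congr_left {X Y : DecoratedSet G K} (h : E.HasFrills X) (hXY : X.Iso Y) :
    E.HasFrills Y := by
  obtain ⟨f, hf, h⟩ := h
  obtain ⟨e, he, hfr⟩ := DecoratedSet.iso_equivalence.symm hXY
  refine ⟨e.trans f, fun g y => by simp [he, hf], fun y => ?_⟩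
  obtain ⟨s, θ, hs, hθ, hx⟩ := h (e y)
  refine ⟨fun g => s (stabilizerMap e he y g), cocycle.pullback (stabilizerMap e he y) θ,
    fun g => hs _, fun g k => ?_, ?_⟩
  · exact (hθ _ _).trans (by rw [← map_mul]; rfl)
  · rw [hfr, ← hx]
    rfl

theorem HasFrills.congr_right {X : DecoratedSet G K} {E E' : CentralExtension G K}
    (h : E.HasFrills X) (hE : E.Iso E') : E'.HasFrills X := by
  obtain ⟨f, hf, h⟩ := h
  obtain ⟨F, hF, hF', hFG, hFp, hFi⟩ := hE
  refine ⟨f.trans (Equiv.ofBijective _ hF), fun g x => ?_, fun x => ?_⟩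
  · simp [hf, hFG]
  · obtain ⟨s, θ, hs, hθ, hx⟩ := h x
    refine ⟨fun g => F.map (s g), θ, fun g => ?_, fun g k => ?_, hx⟩
    · exact (hFp _).trans (hs g)
    · have := congrArg F.map (hθ g k)
      rw [F.map_comp, F.map_comp, hFi] at this
      exact this

/-- Both decorated sets are compared with the one defined by a cocycle of `E` on its own set of
objects. -/
theorem HasFrills.left_unique {X Y : DecoratedSet G K} (h : E.HasFrills X) (h' : E.HasFrills Y) :
    X.Iso Y := by
  obtain ⟨Θ, hΘ, hE⟩ := CentralExtension.exists_hasCocycle (Equiv.refl E.X) fun _ _ => rfl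
  have key : ∀ {X : DecoratedSet G K}, E.HasFrills X → X.Iso (DecoratedSet.ofCocycle hΘ) := by
    rintro X ⟨f, hf, h⟩
    refine ⟨f, hf, fun x => ?_⟩
    obtain ⟨s, θ, hs, hθ, hx⟩ := h x
    rw [← hx, ← (hE.comp f hf).res_eq (IsActionCocycle.comp hΘ f hf) x hs hθ]
    rfl
  exact DecoratedSet.iso_equivalence.trans (key h) (DecoratedSet.iso_equivalence.symm (key h'))

theorem HasFrills.right_unique {X : DecoratedSet G K} {E E' : CentralExtension G K}
    (h : E.HasFrills X) (h' : E'.HasFrills X) : E.Iso E' := by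
  obtain ⟨Θ, hΘ, hX⟩ := X.exists_hasClass
  obtain ⟨f, hf, h⟩ := h.exists_hasCocycle hX
  obtain ⟨f', hf', h'⟩ := h'.exists_hasCocycle hX
  exact h.iso hf hf' h'

theorem exists_hasFrills (E : CentralExtension G K) : ∃ X : DecoratedSet G K, E.HasFrills X := by
  obtain ⟨Θ, hΘ, h⟩ := CentralExtension.exists_hasCocycle (Equiv.refl E.X) fun _ _ => rfl
  exact ⟨DecoratedSet.ofCocycle hΘ, h.hasFrills (X := DecoratedSet.ofCocycle hΘ) (hΘ := hΘ)
    (fun _ _ => rfl) fun _ => rfl⟩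

/-- The central extension defined by an action cocycle. -/
def ofCocycle [Finite X] {Θ : G → G → X → Kˣ} (hΘ : IsActionCocycle Θ) :
    CentralExtension G K where
  X := X
  groupoid :=
    { Hom := fun x y => { p : G × Kˣ // p.1 • x = y }
      -- The factor corrects for `Θ` not being normalised. The same factor occurs in `incl` and in
      -- the inverses.
      id := fun x => ⟨(1, (Θ 1 1 x)⁻¹), one_smul _ _⟩
      comp := fun {x y z} a b => ⟨(b.1.1 * a.1.1, b.1.2 * a.1.2 * Θ b.1.1 a.1.1 x), by
        rw [mul_smul, a.2, b.2]⟩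
      id_comp := by
        rintro x y ⟨⟨g, c⟩, h⟩
        refine Subtype.ext (Prod.ext (mul_one _) ?_)
        change c * (Θ 1 1 x)⁻¹ * Θ g 1 x = c
        rw [hΘ.one_right g, inv_mul_cancel_right]
      comp_id := by
        rintro x y ⟨⟨g, c⟩, h⟩
        refine Subtype.ext (Prod.ext (one_mul _) ?_)
        have h : g • x = y := h
        change (Θ 1 1 y)⁻¹ * c * Θ 1 g x = c
        rw [hΘ.one_left g, h]
        rw [mul_right_comm, inv_mul_cancel, one_mul]
      assoc := by
        rintro w x y z ⟨⟨k, a⟩, h₁⟩ ⟨⟨h, b⟩, h₂⟩ ⟨⟨g, c⟩, h₃⟩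
        refine Subtype.ext (Prod.ext (mul_assoc _ _ _).symm ?_)
        have h₁ : k • w = x := h₁
        have := hΘ g h k w
        rw [h₁] at this
        change c * (b * a * Θ h k w) * Θ g (h * k) w =
          c * b * Θ g h x * a * Θ (g * h) k w
        rw [← mul_assoc c, mul_assoc _ (Θ h k w), ← this]
        ac_rfl
      inv := fun {x y} a => ⟨(a.1.1⁻¹, (a.1.2 * Θ a.1.1⁻¹ a.1.1 x * Θ 1 1 x)⁻¹), by
        rw [inv_smul_eq_iff]; exact a.2.symm⟩
      inv_comp := by
        rintro x y ⟨⟨g, c⟩, h⟩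
        refine Subtype.ext (Prod.ext (mul_inv_cancel _) ?_)
        have h : g • x = y := h
        subst h
        have := hΘ g g⁻¹ g x
        rw [mul_inv_cancel, inv_mul_cancel, hΘ.one_left, hΘ.one_right g] at this
        change c * (c * Θ g⁻¹ g x * Θ 1 1 x)⁻¹ * Θ g g⁻¹ (g • x) = (Θ 1 1 (g • x))⁻¹
        rw [← eq_mul_inv_iff_mul_eq] at this
        rw [this]
        apply Units.ext
        push_cast
        field_simp
      comp_inv := by
        rintro x y ⟨⟨g, c⟩, h⟩
        refine Subtype.ext (Prod.ext (inv_mul_cancel _) ?_)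
        change (c * Θ g⁻¹ g x * Θ 1 1 x)⁻¹ * c * Θ g⁻¹ g x = (Θ 1 1 x)⁻¹
        apply Units.ext
        push_cast
        field_simp }
  proj a := a.1.1
  proj_smul a := a.2
  proj_id _ := rfl
  proj_comp _ _ := rfl
  proj_surjective g x := ⟨⟨(g, 1), rfl⟩, rfl⟩
  incl x :=
    { toFun := fun c => ⟨(1, c * (Θ 1 1 x)⁻¹), one_smul _ _⟩
      map_one' := Subtype.ext (Prod.ext rfl (one_mul _))
      map_mul' := fun c d => Subtype.ext (Prod.ext (mul_one 1).symm (by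
        change c * d * (Θ 1 1 x)⁻¹ = c * (Θ 1 1 x)⁻¹ * (d * (Θ 1 1 x)⁻¹) * Θ 1 1 x
        apply Units.ext
        push_cast
        field_simp)) }
  incl_injective x c d h := mul_right_cancel (congrArg (fun a => a.1.2) h)
  exact {x} a := by
    obtain ⟨⟨g, c⟩, h⟩ := a
    refine ⟨fun hg => ⟨c * Θ 1 1 x, Subtype.ext (Prod.ext hg.symm (mul_inv_cancel_right _ _))⟩, ?_⟩
    rintro ⟨d, hd⟩
    exact (congrArg (fun a => a.1.1) hd).symm
  central {x y} a c := by
    obtain ⟨⟨g, d⟩, h⟩ := a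
    have h : g • x = y := h
    refine Subtype.ext (Prod.ext ((mul_one g).trans (one_mul g).symm) ?_)
    change d * (c * (Θ 1 1 x)⁻¹) * Θ g 1 x = c * (Θ 1 1 y)⁻¹ * d * Θ 1 g x
    rw [hΘ.one_left g, hΘ.one_right g, h]
    apply Units.ext
    push_cast
    field_simp

theorem hasCocycle_ofCocycle [Finite X] {Θ : G → G → X → Kˣ} (hΘ : IsActionCocycle Θ) :
    (ofCocycle hΘ).HasCocycle (Equiv.refl X) Θ := by
  refine ⟨fun g x y h => ⟨(g, 1), h⟩, fun _ _ _ _ => rfl, fun g h x y z hx hy => ?_⟩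
  refine Subtype.ext (Prod.ext (one_mul _).symm ?_)
  change 1 * 1 * Θ g h x = Θ g h x * (Θ 1 1 z)⁻¹ * 1 * Θ 1 (g * h) x
  have hz : (g * h) • x = z := by rw [mul_smul, hx, hy]
  rw [hΘ.one_left (g * h), hz]
  apply Units.ext
  push_cast
  field_simp

theorem _root_.DecoratedSet.exists_hasFrills (X : DecoratedSet G K) :
    ∃ E : CentralExtension G K, E.HasFrills X := by
  obtain ⟨Θ, hΘ, hX⟩ := X.exists_hasClass
  exact ⟨ofCocycle hΘ, (hasCocycle_ofCocycle hΘ).hasFrills (E := ofCocycle hΘ)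
    (f := Equiv.refl X.X) (fun _ _ => rfl) hX⟩

/-- Symmetry and transitivity follow from the classification: isomorphic extensions share a
decorated set, and extensions with the same decorated set are isomorphic. No functor has to be
inverted. -/
theorem iso_equivalence : Equivalence (CentralExtension.Iso (G := G) (K := K)) where
  refl E := ⟨𝟭 _, Function.bijective_id, fun _ _ => Function.bijective_id, fun _ _ => rfl,
    fun _ => rfl, fun _ _ => rfl⟩
  symm {E E'} h := by
    obtain ⟨X, hX⟩ := E.exists_hasFrills
    exact (hX.congr_right h).right_unique hX
  trans {E E' E''} h h' := by
    obtain ⟨X, hX⟩ := E.exists_hasFrills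
    exact hX.right_unique ((hX.congr_right h).congr_right h')

end CentralExtension

/-! ### Equivalences of categories with twists -/

section TwistEquivalent

variable (K : Type*) [Field K] {G : Type*} [Group G]
variable {C D E : Type*} [Category* C] [Category* D] [Category* E] [Preadditive C]
  [Preadditive D] [Preadditive E] [Linear K C] [Linear K D] [Linear K E]

/-- `K`-linear equivalence of categories compatible with families of functors `T g`. -/
def TwistEquivalent (T : G → C ⥤ C) (m : ∀ g h, T g ⋙ T h ≅ T (g * h))
    (T' : G → D ⥤ D) (m' : ∀ g h, T' g ⋙ T' h ≅ T' (g * h)) : Prop :=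
  ∃ (Φ : C ⥤ D) (_ : Φ.IsEquivalence) (_ : Φ.Additive)
    (_ : Φ.Linear K) (β : ∀ g : G, T g ⋙ Φ ≅ Φ ⋙ T' g),
    ∀ (g h : G) (M : C),
      (β h).hom.app ((T g).obj M) ≫ (T' h).map ((β g).hom.app M) ≫
          (m' g h).hom.app (Φ.obj M) =
        Φ.map ((m g h).hom.app M) ≫ (β (g * h)).hom.app M

variable {K}
variable {T : G → C ⥤ C} {m : ∀ g h, T g ⋙ T h ≅ T (g * h)}
  {T' : G → D ⥤ D} {m' : ∀ g h, T' g ⋙ T' h ≅ T' (g * h)}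
  {T'' : G → E ⥤ E} {m'' : ∀ g h, T'' g ⋙ T'' h ≅ T'' (g * h)}

theorem TwistEquivalent.refl : TwistEquivalent K T m T m :=
  ⟨𝟭 C, inferInstance, inferInstance, inferInstance, fun _ => Iso.refl _, fun g h M => by
    simp⟩

theorem TwistEquivalent.trans (h₁ : TwistEquivalent K T m T' m')
    (h₂ : TwistEquivalent K T' m' T'' m'') : TwistEquivalent K T m T'' m'' := by
  obtain ⟨Φ, _, _, _, β, hβ⟩ := h₁
  obtain ⟨Ψ, _, _, _, γ, hγ⟩ := h₂
  refine ⟨Φ ⋙ Ψ, inferInstance, inferInstance, inferInstance, fun g =>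
    NatIso.ofComponents (fun M => Ψ.mapIso ((β g).app M) ≪≫ (γ g).app (Φ.obj M)) ?_, ?_⟩
  · intro M N f
    have e1 := (β g).hom.naturality f
    have e2 := (γ g).hom.naturality (Φ.map f)
    dsimp at e1 e2 ⊢
    rw [← Ψ.map_comp_assoc, e1, Ψ.map_comp, Category.assoc, e2, Category.assoc]
  · intro g h M
    have e1 := hβ g h M
    have e2 := hγ g h (Φ.obj M)
    have e3 := (γ h).hom.naturality ((β g).hom.app M)
    dsimp at e1 e2 e3 ⊢
    simp only [Functor.map_comp, Category.assoc]
    rw [← reassoc_of% e3, e2, ← Ψ.map_comp_assoc, ← Ψ.map_comp_assoc, ← Ψ.map_comp_assoc, ← e1]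
    simp only [Functor.map_comp, Category.assoc]

/-- Of the quasi-inverse only the counit and its naturality in both directions are kept; this
suffices for transporting twists and module structures alike. -/
theorem exists_linear_inverse (Φ : C ⥤ D) [Φ.IsEquivalence] [Φ.Additive] [Φ.Linear K] :
    ∃ (Ψ : D ⥤ C) (_ : Ψ.IsEquivalence) (_ : Ψ.Additive) (_ : Ψ.Linear K)
      (ε : ∀ N, Φ.obj (Ψ.obj N) ≅ N),
      (∀ {N N' : D} (f : N ⟶ N'), Φ.map (Ψ.map f) ≫ (ε N').hom = (ε N).hom ≫ f) ∧
      ∀ {N N' : D} (f : N ⟶ N'), (ε N).inv ≫ Φ.map (Ψ.map f) = f ≫ (ε N').inv := by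
  have hadd : Φ.asEquivalence.functor.Additive := ‹Φ.Additive›
  have hlin : Φ.asEquivalence.functor.Linear K := ‹Φ.Linear K›
  have h : ∀ {N N' : D} (f : N ⟶ N'), Φ.map (Φ.asEquivalence.inverse.map f) ≫
      (Φ.asEquivalence.counitIso.app N').hom = (Φ.asEquivalence.counitIso.app N).hom ≫ f :=
    fun f => Φ.asEquivalence.counitIso.hom.naturality f
  exact ⟨Φ.asEquivalence.inverse, inferInstance, inferInstance, inferInstance,
    fun N => Φ.asEquivalence.counitIso.app N, h,
    fun {N N'} f => (Φ.asEquivalence.counitIso.inv.naturality f).symm⟩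

theorem TwistEquivalent.symm (h : TwistEquivalent K T m T' m') :
    TwistEquivalent K T' m' T m := by
  obtain ⟨Φ, _, _, _, β, hβ⟩ := h
  obtain ⟨Ψ, _, _, _, ε, hε, hε'⟩ := exists_linear_inverse (K := K) Φ
  -- The isomorphism for the inverse is the preimage under `Φ` of β⁻¹ conjugated by the counit;
  -- naturality and coherence can then be checked after applying the faithful functor `Φ`.
  have hγ : ∀ g N, ∃ γ : Ψ.obj ((T' g).obj N) ≅ (T g).obj (Ψ.obj N),
      Φ.map γ.hom = (ε ((T' g).obj N)).hom ≫ (T' g).map (ε N).inv ≫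
        (β g).inv.app (Ψ.obj N) := fun g N =>
    ⟨Φ.preimageIso (ε ((T' g).obj N) ≪≫ (T' g).mapIso (ε N).symm ≪≫
      ((β g).app (Ψ.obj N)).symm), by simp⟩
  choose γ hγ using hγ
  refine ⟨Ψ, inferInstance, inferInstance, inferInstance, fun g =>
    NatIso.ofComponents (fun N => γ g N) ?_, ?_⟩
  · intro N N' f
    apply Φ.map_injective
    have e1 := (β g).inv.naturality (Ψ.map f)
    dsimp at e1 ⊢
    rw [Φ.map_comp, Φ.map_comp, hγ, hγ, reassoc_of% (hε ((T' g).map f)), Category.assoc,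
      Category.assoc, ← e1, ← Functor.map_comp_assoc, ← Functor.map_comp_assoc, hε']
  · intro g h N
    apply Φ.map_injective
    have e1 := (β h).inv.naturality (γ g N).hom
    have e2 := hβ g h (Ψ.obj N)
    have e3 := (m' g h).hom.naturality (ε N).inv
    dsimp at e1 e2 e3 ⊢
    rw [Φ.map_comp, Φ.map_comp, Φ.map_comp, hγ, hγ, reassoc_of% (hε ((m' g h).hom.app N)),
      Category.assoc, Category.assoc, ← reassoc_of% e1, hγ]
    rw [← Functor.map_comp_assoc (T' h), Iso.inv_hom_id_assoc, Functor.map_comp, Category.assoc]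
    rw [← reassoc_of% e3]
    have e5 : Φ.map ((m g h).hom.app (Ψ.obj N)) = (β h).hom.app ((T g).obj (Ψ.obj N)) ≫
      (T' h).map ((β g).hom.app (Ψ.obj N)) ≫ (m' g h).hom.app (Φ.obj (Ψ.obj N)) ≫
        (β (g * h)).inv.app (Ψ.obj N) := by
      rw [← cancel_mono ((β (g * h)).hom.app (Ψ.obj N)), ← e2]
      simp
    rw [e5]
    simp only [Iso.inv_hom_id_app_assoc, ← Functor.map_comp_assoc]
    rw [Iso.inv_hom_id_app]
    erw [Category.comp_id]

end TwistEquivalent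

namespace SplitGAlgebra

variable {G : Type v} {K : Type u} [Group G] [Field K]

theorem gMorita_equivalence : Equivalence (GMorita (G := G) (K := K)) where
  refl _ := TwistEquivalent.refl
  symm h := TwistEquivalent.symm h
  trans h h' := TwistEquivalent.trans h h'

end SplitGAlgebra

/-! ### Functors linear over an action -/

section RightLinear

open MonoidalRightAction Functor.LaxRightLinear Functor.OplaxRightLinear

variable {T : Type*} [Category* T] [MonoidalCategory T]
  {C : Type*} {D : Type*} {E : Type*} [Category* C] [Category* D] [Category* E]
  [MonoidalRightAction T C] [MonoidalRightAction T D] [MonoidalRightAction T E]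

/-- A linear functor from a natural family of isomorphisms satisfying the axioms of a lax linear
functor. -/
@[reducible]
def rightLinearOfIso (F : C ⥤ D) (μ : ∀ (d : C) (c : T), F.obj d ⊙ᵣ c ≅ F.obj (d ⊙ᵣ c))
    (h₁ : ∀ (d : C) {c c' : T} (f : c ⟶ c'),
      F.obj d ⊴ᵣ f ≫ (μ d c').hom = (μ d c).hom ≫ F.map (d ⊴ᵣ f))
    (h₂ : ∀ {d d' : C} (f : d ⟶ d') (c : T),
      F.map f ⊵ᵣ c ≫ (μ d' c).hom = (μ d c).hom ≫ F.map (f ⊵ᵣ c))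
    (h₃ : ∀ (d : C) (c c' : T), (μ d (c ⊗ c')).hom ≫ F.map (αᵣ _ _ _).hom =
      (αᵣ (F.obj d) c c').hom ≫ (μ d c).hom ⊵ᵣ c' ≫ (μ (d ⊙ᵣ c) c').hom)
    (h₄ : ∀ d : C, (ρᵣ (F.obj d)).hom = (μ d (𝟙_ T)).hom ≫ F.map (ρᵣ d).hom) :
    F.RightLinear T where
  μᵣ d c := (μ d c).hom
  μᵣ_naturality_right := h₁
  μᵣ_naturality_left := h₂
  μᵣ_associativity := h₃
  μᵣ_unitality := h₄
  δᵣ d c := (μ d c).inv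
  δᵣ_naturality_right d c c' f := by
    rw [Iso.eq_inv_comp, ← Category.assoc, ← h₁, Category.assoc, Iso.hom_inv_id, Category.comp_id]
  δᵣ_naturality_left f c := by
    rw [Iso.eq_inv_comp, ← Category.assoc, ← h₂, Category.assoc, Iso.hom_inv_id, Category.comp_id]
  δᵣ_associativity d c c' := by
    have e : (μ d c).hom ⊵ᵣ c' ≫ (μ d c).inv ⊵ᵣ c' = 𝟙 _ := by
      rw [← comp_actionHomLeft, Iso.hom_inv_id, id_actionHomLeft]
    rw [Iso.inv_comp_eq, ← Category.assoc, h₃, Category.assoc, Category.assoc,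
      Iso.hom_inv_id_assoc, e, Category.comp_id]
  δᵣ_unitality_inv d := by
    rw [Iso.eq_comp_inv, Iso.inv_comp_eq, h₄, Category.assoc, ← F.map_comp, Iso.hom_inv_id,
      F.map_id, Category.comp_id]
  μᵣ_comp_δᵣ d c := (μ d c).hom_inv_id
  δᵣ_comp_μᵣ d c := (μ d c).inv_hom_id

@[reducible]
def rightLinearId : (𝟭 C).RightLinear T :=
  rightLinearOfIso (𝟭 C) (fun _ _ => Iso.refl _) (fun _ _ _ _ => by simp) (fun _ _ => by simp)
    (fun _ _ _ => by simp) (fun _ => by simp)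

@[reducible]
def rightLinearComp (F : C ⥤ D) (F' : D ⥤ E) [F.RightLinear T] [F'.RightLinear T] :
    (F ⋙ F').RightLinear T :=
  rightLinearOfIso (F ⋙ F')
    (fun d c => Functor.RightLinear.μᵣIso F' (F.obj d) c ≪≫
      F'.mapIso (Functor.RightLinear.μᵣIso F d c))
    (fun d c c' f => by simp [← Functor.map_comp])
    (fun f c => by simp [← Functor.map_comp])
    (fun d c c' => by
      have := μᵣ_associativity F d c c'
      simp only [Iso.trans_hom, Functor.mapIso_hom, Functor.comp_map, Category.assoc]
      rw [← F'.map_comp, this]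
      simp)
    (fun _ => by simp [← Functor.map_comp])

/-- The structure map of the inverse is the preimage of that of `F`, inverted and conjugated by ε.
Each axiom is verified after applying `F` and composing with ε, where it becomes an oplax axiom for
`F`. -/
theorem nonempty_rightLinear_inverse {F : C ⥤ D} [F.IsEquivalence] [F.RightLinear T]
    (Ψ : D ⥤ C) (ε : ∀ N, F.obj (Ψ.obj N) ≅ N)
    (hε : ∀ {N N' : D} (f : N ⟶ N'), F.map (Ψ.map f) ≫ (ε N').hom = (ε N).hom ≫ f) :
    Nonempty (Ψ.RightLinear T) := by
  have hν : ∀ (N : D) (c : T), ∃ ν : Ψ.obj N ⊙ᵣ c ≅ Ψ.obj (N ⊙ᵣ c),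
      F.map ν.hom ≫ (ε (N ⊙ᵣ c)).hom = δᵣ F (Ψ.obj N) c ≫ (ε N).hom ⊵ᵣ c := fun N c => by
    refine ⟨F.preimageIso ((Functor.RightLinear.μᵣIso F (Ψ.obj N) c).symm ≪≫
      ⟨(ε N).hom ⊵ᵣ c, (ε N).inv ⊵ᵣ c, ?_, ?_⟩ ≪≫ (ε (N ⊙ᵣ c)).symm), ?_⟩
    · rw [← comp_actionHomLeft, Iso.hom_inv_id, id_actionHomLeft]
    · rw [← comp_actionHomLeft, Iso.inv_hom_id, id_actionHomLeft]
    · simp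
  choose ν hν using hν
  refine ⟨rightLinearOfIso Ψ ν ?_ ?_ ?_ ?_⟩
  · intro N c c' f
    apply F.map_injective
    rw [← cancel_mono (ε _).hom]
    simp only [Functor.map_comp, Category.assoc, hν, hε, reassoc_of% (hν N c)]
    rw [δᵣ_naturality_right_assoc, action_exchange]
  · intro N N' f c
    apply F.map_injective
    rw [← cancel_mono (ε _).hom]
    simp only [Functor.map_comp, Category.assoc, hν, hε, reassoc_of% (hν N c)]
    rw [δᵣ_naturality_left_assoc, ← comp_actionHomLeft, hε, comp_actionHomLeft]
  · intro N c c'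
    apply F.map_injective
    rw [← cancel_mono (ε _).hom]
    simp only [Functor.map_comp, Category.assoc, hν, hε, reassoc_of% (hν N (c ⊗ c'))]
    rw [actionHomLeft_tensor, δᵣ_naturality_left_assoc, ← comp_actionHomLeft, hν,
      comp_actionHomLeft, ← δᵣ_associativity_assoc]
    simp
  · intro N
    apply F.map_injective
    rw [← cancel_mono (ε _).hom]
    simp only [Functor.map_comp, Category.assoc, hε, reassoc_of% (hν N)]
    rw [unit_actionHomRight, ← δᵣ_unitality_hom_assoc]
    simp

end RightLinear

theorem ModuleCategory.equivalent_equivalence {G : Type v} {K : Type u} [Group G] [Field K] :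
    Equivalence (ModuleCategory.Equivalent (G := G) (K := K)) where
  refl M := ⟨𝟭 _, inferInstance, inferInstance, inferInstance, ⟨rightLinearId⟩⟩
  symm := by
    rintro M N ⟨F, _, _, _, ⟨_⟩⟩
    obtain ⟨Ψ, h₁, h₂, h₃, ε, hε, -⟩ := exists_linear_inverse (K := K) F
    exact ⟨Ψ, h₁, h₂, h₃, nonempty_rightLinear_inverse Ψ ε hε⟩
  trans := by
    rintro M N P ⟨F, _, _, _, ⟨_⟩⟩ ⟨F', _, _, _, ⟨_⟩⟩
    exact ⟨F ⋙ F', inferInstance, inferInstance, inferInstance, ⟨rightLinearComp F F'⟩⟩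

theorem SpecialModuleCategory.equivalent_equivalence {G : Type v} {K : Type u} [Group G]
    [Field K] : Equivalence (SpecialModuleCategory.Equivalent (G := G) (K := K)) :=
  ModuleCategory.equivalent_equivalence.comap Subtype.val

/-! ### Simple modules of split semisimple algebras -/

open scoped TensorProduct

section HomTensor

variable {K : Type*} [Field K] {A : Type*} [Ring A] [Algebra K A]
  {N V : Type*} [AddCommGroup N] [Module K N] [Module A N] [IsScalarTower K A N]
  [AddCommGroup V] [Module K V] [Module A V] [IsScalarTower K A V]
  {W : Type*} [AddCommGroup W] [Module K W]

variable (A) in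
/-- The `A`-linear map `V → V ⊗ W`, `v ↦ v ⊗ w`. -/
def tmulRight (V : Type*) [AddCommGroup V] [Module K V] [Module A V] [IsScalarTower K A V]
    (w : W) : V →ₗ[A] V ⊗[K] W where
  toFun v := v ⊗ₜ w
  map_add' _ _ := TensorProduct.add_tmul _ _ _
  map_smul' _ _ := rfl

@[simp] theorem tmulRight_apply (w : W) (v : V) : tmulRight A V w v = v ⊗ₜ[K] w := rfl

variable (K A N V W) in
/-- The map `Hom_A(N, V) ⊗ W → Hom_A(N, V ⊗ W)`. -/
def homTensor : (N →ₗ[A] V) ⊗[K] W →ₗ[K] (N →ₗ[A] V ⊗[K] W) :=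
  TensorProduct.lift (LinearMap.mk₂ K (fun f w => tmulRight A V w ∘ₗ f)
    (fun _ _ _ => by ext; simp [TensorProduct.add_tmul])
    (fun _ _ _ => by ext; simp [TensorProduct.smul_tmul'])
    (fun _ _ _ => by ext; simp [TensorProduct.tmul_add])
    (fun _ _ _ => by ext; simp))

omit [Module K N] [IsScalarTower K A N] in
@[simp] theorem homTensor_tmul (f : N →ₗ[A] V) (w : W) (n : N) :
    homTensor K A N V W (f ⊗ₜ w) n = f n ⊗ₜ w := rfl

/-- Hom_A(N, V) embeds in Hom_K(N, V), tensoring with `W` preserves injectivity over a field, and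
over `K` the map is an isomorphism for finite-dimensional `N`. -/
theorem homTensor_injective [Module.Finite K N] : Function.Injective (homTensor K A N V W) := by
  let r : (N →ₗ[A] V) →ₗ[K] (N →ₗ[K] V) := LinearMap.restrictScalarsₗ K A N V K
  have hr : Function.Injective r := LinearMap.restrictScalars_injective K
  have h1 := Module.Flat.rTensor_preserves_injective_linearMap (M := W) r hr
  have h2 := (rTensorHomEquivHomRTensor K N V W).injective.comp h1
  intro x y hxy
  apply h2
  have key : ∀ x, (rTensorHomEquivHomRTensor K N V W) (r.rTensor W x) =
      (homTensor K A N V W x).restrictScalars K := fun x => by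
    induction x with
    | zero => simp
    | add x y hx hy => simp only [map_add, hx, hy]; rfl
    | tmul f w => ext n; simp [r]
  change rTensorHomEquivHomRTensor K N V W (r.rTensor W x) =
    rTensorHomEquivHomRTensor K N V W (r.rTensor W y)
  rw [key, key, hxy]

/-- Expand the values of `f` along a basis of `W`: the coordinate maps are `A`-linear, and only
finitely many of them are nonzero on generators of `N`. -/
theorem homTensor_surjective [Module.Finite K N] : Function.Surjective (homTensor K A N V W) := by
  classical
  intro f
  let b := Module.Basis.ofVectorSpace K W
  let p : ∀ l, V ⊗[K] W →ₗ[A] V := fun l =>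
    (TensorProduct.AlgebraTensorModule.rid K A V).toLinearMap ∘ₗ
      TensorProduct.AlgebraTensorModule.lTensor A V (b.coord l)
  have hp : ∀ l x, p l x = TensorProduct.equivFinsuppOfBasisRight b x l := fun l x => by
    induction x with
    | zero => simp
    | add x y hx hy => simp only [map_add, hx, hy]; rfl
    | tmul v w => simp [p]
  obtain ⟨s, hs⟩ := Module.Finite.fg_top (R := K) (M := N)
  let t : Finset _ := s.biUnion fun n => (TensorProduct.equivFinsuppOfBasisRight b (f n)).support
  refine ⟨∑ l ∈ t, (p l ∘ₗ f) ⊗ₜ b l, ?_⟩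
  have : ∀ n ∈ (⊤ : Submodule K N),
      homTensor K A N V W (∑ l ∈ t, (p l ∘ₗ f) ⊗ₜ b l) n = f n := fun n hn => by
    rw [← hs] at hn
    induction hn using Submodule.span_induction with
    | mem n hn =>
      have h1 := (TensorProduct.equivFinsuppOfBasisRight b).symm_apply_apply (f n)
      rw [TensorProduct.equivFinsuppOfBasisRight_symm_apply, Finsupp.sum_of_support_subset _
        (Finset.subset_biUnion_of_mem
          (fun n => (TensorProduct.equivFinsuppOfBasisRight b (f n)).support) hn) _ (by simp)] at h1
      rw [map_sum, LinearMap.sum_apply]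
      simpa [hp] using h1
    | zero => simp
    | add x y _ _ hx hy => rw [map_add, map_add, hx, hy]
    | smul c x _ hx =>
      rw [LinearMap.map_smul_of_tower, LinearMap.map_smul_of_tower, hx]
  ext n
  exact this n trivial

variable (K A N V W) in
/-- `Hom_A(N, V) ⊗ W ≃ Hom_A(N, V ⊗ W)` for a finite-dimensional module `N`. -/
def homTensorEquiv [Module.Finite K N] : (N →ₗ[A] V) ⊗[K] W ≃ₗ[K] (N →ₗ[A] V ⊗[K] W) :=
  LinearEquiv.ofBijective (homTensor K A N V W) ⟨homTensor_injective, homTensor_surjective⟩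

end HomTensor

/-- A family of representatives of the simple modules of a split algebra. -/
structure IsIrrFamily (K : Type*) [Field K] (A : Type*) [Ring A] [Algebra K A] {ι : Type*}
    (M : ι → Type u) [∀ i, AddCommGroup (M i)] [∀ i, Module K (M i)] [∀ i, Module A (M i)]
    [∀ i, IsScalarTower K A (M i)] : Prop where
  isSemisimpleRing : IsSemisimpleRing A
  isSimpleModule : ∀ i, IsSimpleModule A (M i)
  finite : ∀ i, Module.Finite K (M i)
  exists_smul : ∀ i (f : M i →ₗ[A] M i), ∃ c : K, ∀ m, f m = c • m
  hom_eq_zero : ∀ i j, i ≠ j → ∀ f : M i →ₗ[A] M j, f = 0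
  exists_equiv : ∀ (N : Type u) [AddCommGroup N] [Module A N], IsSimpleModule A N →
    ∃ i, Nonempty (N ≃ₗ[A] M i)

namespace IsIrrFamily

variable {K : Type*} [Field K] {A : Type*} [Ring A] [Algebra K A] {ι : Type u}
  {M : ι → Type u} [∀ i, AddCommGroup (M i)] [∀ i, Module K (M i)] [∀ i, Module A (M i)]
  [∀ i, IsScalarTower K A (M i)] (hM : IsIrrFamily K A M)
  {V V' : Type u} [AddCommGroup V] [Module K V] [Module A V] [IsScalarTower K A V]
  [AddCommGroup V'] [Module K V'] [Module A V'] [IsScalarTower K A V']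
  (U : ι → Type u) [∀ i, AddCommGroup (U i)] [∀ i, Module K (U i)]

include hM

/-- Hom_A(M_i, M_i ⊗ W) = Hom_A(M_i, M_i) ⊗ W = W, since the simple module has only scalar
endomorphisms. -/
theorem exists_tmul (i : ι) {W : Type*} [AddCommGroup W] [Module K W]
    (f : M i →ₗ[A] M i ⊗[K] W) : ∃ w : W, ∀ m, f m = m ⊗ₜ w := by
  have := hM.finite i
  obtain ⟨x, rfl⟩ := homTensor_surjective f
  induction x with
  | zero => exact ⟨0, fun m => by simp⟩
  | add x y hx hy =>
    obtain ⟨w, hw⟩ := hx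
    obtain ⟨w', hw'⟩ := hy
    exact ⟨w + w', fun m => by rw [map_add, LinearMap.add_apply, hw, hw', TensorProduct.tmul_add]⟩
  | tmul f w =>
    obtain ⟨c, hc⟩ := hM.exists_smul i f
    exact ⟨c • w, fun m => by rw [homTensor_tmul, hc, TensorProduct.smul_tmul]⟩

theorem hom_tensor_eq_zero {i j : ι} (h : i ≠ j) {W : Type*} [AddCommGroup W] [Module K W]
    (f : M i →ₗ[A] M j ⊗[K] W) : f = 0 := by
  have := hM.finite i
  obtain ⟨x, rfl⟩ := homTensor_surjective f
  induction x with
  | zero => simp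
  | add x y hx hy => rw [map_add, hx, hy, add_zero]
  | tmul f w => ext m; rw [homTensor_tmul, hM.hom_eq_zero i j h f]; simp

theorem tmul_injective (i : ι) {W : Type*} [AddCommGroup W] [Module K W] {w w' : W}
    (h : ∀ m : M i, m ⊗ₜ[K] w = m ⊗ₜ[K] w') : w = w' := by
  have := hM.isSimpleModule i
  have := IsSimpleModule.nontrivial A (M i)
  obtain ⟨m, hm⟩ := exists_ne (0 : M i)
  obtain ⟨f, hf⟩ : ∃ f : Module.Dual K (M i), f m ≠ 0 := by
    by_contra! hc
    exact hm ((Module.forall_dual_apply_eq_zero_iff K m).1 hc)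
  have := congrArg ((TensorProduct.lid K W).toLinearMap ∘ₗ f.rTensor W) (h m)
  simp only [LinearMap.comp_apply, LinearMap.rTensor_tmul, LinearEquiv.coe_coe,
    TensorProduct.lid_tmul] at this
  exact smul_right_injective W hf this

omit [Module K V] [IsScalarTower K A V] in
theorem exists_injective_of_nontrivial [Nontrivial V] :
    ∃ (i : ι) (f : M i →ₗ[A] V), Function.Injective f := by
  have := hM.isSemisimpleRing
  obtain ⟨S, hS⟩ := IsSemisimpleModule.exists_simple_submodule A V
  obtain ⟨i, ⟨e⟩⟩ := hM.exists_equiv S hS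
  exact ⟨i, S.subtype ∘ₗ e.symm.toLinearMap, S.injective_subtype.comp e.symm.injective⟩

omit [Module K V] [IsScalarTower K A V] [Module K V'] [IsScalarTower K A V'] in
/-- Linear maps agree if they agree on all images of simple modules. -/
theorem hom_ext {F F' : V →ₗ[A] V'} (h : ∀ (i : ι) (f : M i →ₗ[A] V), F ∘ₗ f = F' ∘ₗ f) :
    F = F' := by
  have := hM.isSemisimpleRing
  have key : sSup {m : Submodule A V | IsSimpleModule A m} ≤ LinearMap.eqLocus F F' := by
    refine sSup_le fun S hS => ?_
    obtain ⟨i, ⟨e⟩⟩ := hM.exists_equiv S hS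
    intro v hv
    have := DFunLike.congr_fun (h i (S.subtype ∘ₗ e.symm.toLinearMap)) (e ⟨v, hv⟩)
    simpa using this
  rw [IsSemisimpleModule.sSup_simples_eq_top] at key
  ext v
  exact key trivial

variable [DecidableEq ι]

theorem exists_single (i : ι) (f : M i →ₗ[A] (∀ j, M j ⊗[K] U j)) :
    ∃ u : U i, ∀ m, f m = Pi.single i (m ⊗ₜ u) := by
  obtain ⟨u, hu⟩ := hM.exists_tmul i (LinearMap.proj i ∘ₗ f)
  refine ⟨u, fun m => funext fun j => ?_⟩
  by_cases h : i = j
  · subst h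
    rw [Pi.single_eq_same, ← hu]; rfl
  · rw [Pi.single_eq_of_ne (Ne.symm h)]
    exact DFunLike.congr_fun (hM.hom_tensor_eq_zero h (LinearMap.proj j ∘ₗ f)) m

omit hM in
variable (K A V) in
/-- The evaluation map `N ⊗ Hom(N, V) → V`. -/
def evalHom (N : Type*) [AddCommGroup N] [Module K N] [Module A N] [IsScalarTower K A N] :
    N ⊗[K] (N →ₗ[A] V) →ₗ[A] V :=
  let e : N ⊗[K] (N →ₗ[A] V) →ₗ[K] V := TensorProduct.lift (LinearMap.mk₂ K (fun n f => f n)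
    (fun _ _ f => map_add f _ _) (fun c n f => LinearMap.map_smul_of_tower f c n)
    (fun _ _ _ => rfl) (fun _ _ _ => rfl))
  { e with
    map_smul' := fun a x => by
      change e (a • x) = a • e x
      induction x with
      | zero => simp
      | add x y hx hy => rw [smul_add, map_add, hx, hy, map_add, smul_add]
      | tmul n f => exact map_smul f a n }

variable [Fintype ι]

omit hM in
variable (K A M V) in
/-- The evaluation map `⨁ M i ⊗ Hom(M i, V) → V`. -/
def eval : (∀ i, M i ⊗[K] (M i →ₗ[A] V)) →ₗ[A] V :=
  ∑ i, evalHom K A V (M i) ∘ₗ LinearMap.proj i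

omit hM in
theorem eval_single (i : ι) (m : M i) (f : M i →ₗ[A] V) :
    eval K A M V (Pi.single i (m ⊗ₜ f)) = f m := by
  rw [eval, LinearMap.sum_apply, Finset.sum_eq_single i]
  · simp only [LinearMap.comp_apply, LinearMap.proj_apply, Pi.single_eq_same]
    rfl
  · intro j _ hj
    simp [Pi.single_eq_of_ne hj]
  · simp

/-- A nonzero kernel would contain a copy of some M_i, embedded as m ↦ m ⊗ u in the `i`-th factor;
lying in the kernel means u = 0, a contradiction. Surjectivity holds because `V` is the sum of its
simple submodules. -/
theorem eval_bijective : Function.Bijective (eval K A M V) := by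
  have := hM.isSemisimpleRing
  constructor
  · rw [← LinearMap.ker_eq_bot]
    by_contra hk
    have : Nontrivial (LinearMap.ker (eval K A M V)) :=
      (Submodule.nontrivial_iff_ne_bot).2 hk
    obtain ⟨i, f, hf⟩ := hM.exists_injective_of_nontrivial (V := LinearMap.ker (eval K A M V))
    obtain ⟨u, hu⟩ := hM.exists_single _ i ((LinearMap.ker (eval K A M V)).subtype ∘ₗ f)
    have h0 : u = 0 := LinearMap.ext fun m => by
      rw [← eval_single (K := K), ← hu]
      exact (f m).2
    have := hM.isSimpleModule i
    have := IsSimpleModule.nontrivial A (M i)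
    obtain ⟨m, hm⟩ := exists_ne (0 : M i)
    refine hm (hf (Subtype.ext ((hu m).trans ?_)))
    rw [h0, TensorProduct.tmul_zero, Pi.single_zero, map_zero]
    rfl
  · rw [← LinearMap.range_eq_top, eq_top_iff, ← IsSemisimpleModule.sSup_simples_eq_top A V]
    refine sSup_le fun S hS => ?_
    obtain ⟨i, ⟨e⟩⟩ := hM.exists_equiv S hS
    intro v hv
    exact ⟨Pi.single i (e ⟨v, hv⟩ ⊗ₜ (S.subtype ∘ₗ e.symm.toLinearMap)), by
      rw [eval_single]; simp⟩

/-- Families of linear maps `Hom(M i, V) → Hom(M i, V')` come from linear maps `V → V'`. -/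
theorem exists_hom (φ : ∀ i, (M i →ₗ[A] V) →ₗ[K] (M i →ₗ[A] V')) :
    ∃ F : V →ₗ[A] V', ∀ (i : ι) (f : M i →ₗ[A] V), F ∘ₗ f = φ i f := by
  let e := LinearEquiv.ofBijective (eval K A M V) hM.eval_bijective
  refine ⟨eval K A M V' ∘ₗ LinearMap.pi (fun i =>
    TensorProduct.AlgebraTensorModule.lTensor A (M i) (φ i) ∘ₗ LinearMap.proj i) ∘ₗ
      e.symm.toLinearMap, fun i f => LinearMap.ext fun m => ?_⟩
  have h1 : e.symm (f m) = Pi.single i (m ⊗ₜ f) := by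
    rw [LinearEquiv.symm_apply_eq]
    exact (eval_single i m f).symm
  have h2 : LinearMap.pi (fun i => TensorProduct.AlgebraTensorModule.lTensor A (M i) (φ i) ∘ₗ
      LinearMap.proj i) (Pi.single i (m ⊗ₜ[K] f)) = Pi.single i (m ⊗ₜ[K] φ i f) := by
    funext j
    by_cases h : i = j
    · subst h
      simp
    · simp [Pi.single_eq_of_ne (Ne.symm h)]
  simp only [LinearMap.comp_apply, LinearEquiv.coe_coe, h1]
  rw [h2, eval_single]

omit [Fintype ι] in
/-- `Hom(M i, ⨁ M j ⊗ U j) ≃ U i`. -/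
theorem exists_equiv_hom (i : ι) : ∃ e : U i ≃ₗ[K] (M i →ₗ[A] (∀ j, M j ⊗[K] U j)),
    ∀ u m, e u m = Pi.single i (m ⊗ₜ u) := by
  let e : U i →ₗ[K] (M i →ₗ[A] (∀ j, M j ⊗[K] U j)) :=
    { toFun := fun u => LinearMap.single A (fun j => M j ⊗[K] U j) i ∘ₗ tmulRight A (M i) u
      map_add' := fun u v => by
        ext1 m
        simp [TensorProduct.tmul_add, Pi.single_add]
      map_smul' := fun c u => by
        ext1 m
        simp [Pi.single_smul] }
  refine ⟨LinearEquiv.ofBijective e ⟨fun u v h => ?_, fun f => ?_⟩, fun u m => rfl⟩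
  · refine hM.tmul_injective i fun m => ?_
    have := DFunLike.congr_fun h m
    exact Pi.single_injective (M := fun j => M j ⊗[K] U j) i this
  · obtain ⟨u, hu⟩ := hM.exists_single U i f
    exact ⟨u, LinearMap.ext fun m => (hu m).symm⟩

end IsIrrFamily

/-! ### The simple modules of a split `G`-algebra -/

namespace SplitGAlgebra

variable {G : Type v} {K : Type u} [Group G] [Field K] (A : SplitGAlgebra G K)

/-- Finite-dimensionality is not part of the definition; it follows from Wedderburn–Artin, since
splitness makes the division algebras that occur equal to `K`. -/
theorem finite_algebra : Module.Finite K A.A := by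
  have := A.semisimple
  obtain ⟨n, S, d, hS, hd, ⟨e⟩⟩ := IsSemisimpleRing.exists_algEquiv_pi_matrix_end_mulOpposite K A.A
  have h : ∀ i, Module.Finite K (Module.End A.A (S i)) := fun i => by
    have := hS i
    refine Module.Finite.of_surjective (Algebra.linearMap K (Module.End A.A (S i))) fun f => ?_
    obtain ⟨c, hc⟩ := A.split (S i) f
    refine ⟨c, LinearMap.ext fun m => (Eq.trans ?_ (hc m).symm)⟩
    rw [algebraMap_smul]
    rfl
  have h' : ∀ i, Module.Finite K (Module.End A.A (S i))ᵐᵒᵖ := fun i =>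
    Module.Finite.equiv (MulOpposite.opLinearEquiv K)
  exact Module.Finite.equiv e.symm.toLinearEquiv

theorem finite_of_isSimpleModule (M : ModuleCat.{u} A.A) [IsSimpleModule A.A M] :
    Module.Finite K M := by
  have := A.finite_algebra
  have : Module.Finite A.A M := inferInstance
  exact Module.Finite.trans A.A M

theorem exists_smul_of_isSimpleModule (M : ModuleCat.{u} A.A) [IsSimpleModule A.A M]
    (f : M →ₗ[A.A] M) : ∃ c : K, ∀ m, f m = c • m := by
  obtain ⟨c, hc⟩ := A.split M f
  exact ⟨c, fun m => by rw [hc, algebraMap_smul]⟩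

/-- A family of representatives of the simple modules. -/
structure IsIrr {X : Type u} (M : X → ModuleCat.{u} A.A) : Prop where
  isSimpleModule : ∀ x, IsSimpleModule A.A (M x)
  eq_of_iso : ∀ x y, Nonempty (M x ≅ M y) → x = y
  exists_iso : ∀ N : ModuleCat.{u} A.A, IsSimpleModule A.A N → ∃ x, Nonempty (N ≅ M x)

variable {A}

theorem IsIrr.isIrrFamily {X : Type u} {M : X → ModuleCat.{u} A.A} (hM : A.IsIrr M) :
    IsIrrFamily K A.A (fun x => M x) where
  isSemisimpleRing := A.semisimple
  isSimpleModule := hM.isSimpleModule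
  finite x := by
    have := hM.isSimpleModule x
    exact A.finite_of_isSimpleModule _
  exists_smul x := by
    have := hM.isSimpleModule x
    exact A.exists_smul_of_isSimpleModule _
  hom_eq_zero x y hxy f := by
    have := hM.isSimpleModule x
    have := hM.isSimpleModule y
    refine (LinearMap.bijective_or_eq_zero f).resolve_left fun hf => hxy (hM.eq_of_iso x y ?_)
    exact ⟨(LinearEquiv.ofBijective f hf).toModuleIso⟩
  exists_equiv N _ _ hN := by
    obtain ⟨x, ⟨e⟩⟩ := hM.exists_iso (ModuleCat.of A.A N) hN
    exact ⟨x, ⟨e.toLinearEquiv⟩⟩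

variable (A) in
/-- Linear maps `ρ` with `ρ(am) = g(a) ρ(m)`. -/
def IsSemilinear (g : G) {M N : ModuleCat.{u} A.A} (ρ : M ≃ₗ[K] N) : Prop :=
  ∀ (a : A.A) (m : M), ρ (a • m) = A.α g a • ρ m

variable {M N P : ModuleCat.{u} A.A}

theorem IsSemilinear.trans {g h : G} {ρ : M ≃ₗ[K] N} {σ : N ≃ₗ[K] P}
    (hρ : A.IsSemilinear h ρ) (hσ : A.IsSemilinear g σ) : A.IsSemilinear (g * h) (ρ.trans σ) :=
  fun a m => by
    rw [LinearEquiv.trans_apply, LinearEquiv.trans_apply, hρ, hσ, map_mul]; rfl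

theorem IsSemilinear.symm {g : G} {ρ : M ≃ₗ[K] N} (hρ : A.IsSemilinear g ρ) :
    A.IsSemilinear g⁻¹ ρ.symm := fun a m => by
  rw [LinearEquiv.symm_apply_eq, hρ, LinearEquiv.apply_symm_apply, ← AlgEquiv.mul_apply,
    ← map_mul, mul_inv_cancel, map_one, AlgEquiv.one_apply]

theorem IsSemilinear.refl : A.IsSemilinear 1 (LinearEquiv.refl K M) := fun a m => by
  rw [map_one]; rfl

theorem IsSemilinear.smul {g : G} {ρ : M ≃ₗ[K] N} (hρ : A.IsSemilinear g ρ) (c : Kˣ) :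
    A.IsSemilinear g (ρ.trans (LinearEquiv.smulOfUnit c)) := fun a m => by
  rw [LinearEquiv.trans_apply, hρ]
  exact smul_comm (c : K) (A.α g a) (ρ m)

theorem isSemilinear_of_iso (e : M ≅ N) :
    A.IsSemilinear 1 (e.toLinearEquiv.restrictScalars K) := fun a m => by
  rw [map_one]
  exact map_smul e.toLinearEquiv a m

theorem IsSemilinear.iso {ρ : M ≃ₗ[K] N} (hρ : A.IsSemilinear 1 ρ) : Nonempty (M ≅ N) :=
  ⟨LinearEquiv.toModuleIso { ρ with
    map_smul' := fun a m => by
      have := hρ a m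
      rwa [map_one] at this }⟩

/-- The semilinear map underlying an isomorphism with a twisted module. -/
def equivOfTwistIso {g : G} (e : N ≅ (A.twist g).obj M) : N ≃ₗ[K] M :=
  let e₀ : N → M := fun n => (e.toLinearEquiv n : (A.twist g).obj M)
  have h₀ : ∀ (a : A.A) (n : N), e₀ (a • n) = A.α g a • e₀ n :=
    fun a n => map_smul e.toLinearEquiv a n
  { toFun := e₀
    invFun := fun m => e.toLinearEquiv.symm (m : (A.twist g).obj M)
    left_inv := e.toLinearEquiv.left_inv
    right_inv := e.toLinearEquiv.right_inv
    map_add' := map_add e.toLinearEquiv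
    map_smul' := fun c n => by
      have h1 := h₀ (algebraMap K A.A c) n
      rwa [AlgEquiv.commutes, algebraMap_smul, algebraMap_smul] at h1 }

theorem isSemilinear_equivOfTwistIso {g : G} (e : N ≅ (A.twist g).obj M) :
    A.IsSemilinear g (equivOfTwistIso e) :=
  fun a n => map_smul e.toLinearEquiv a n

theorem exists_isSemilinear_of_twist_iso {g : G} (e : N ≅ (A.twist g⁻¹).obj M) :
    ∃ ρ : M ≃ₗ[K] N, A.IsSemilinear g ρ := by
  have := (isSemilinear_equivOfTwistIso e).symm
  rw [inv_inv] at this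
  exact ⟨_, this⟩

/-- The isomorphism with a twisted module defined by a semilinear map. -/
def IsSemilinear.twistIso {g : G} {ρ : N ≃ₗ[K] M} (hρ : A.IsSemilinear g ρ) :
    N ≅ (A.twist g).obj M :=
  let e : N ≃ₗ[A.A] ((A.twist g).obj M) :=
    { toFun := fun n => ρ n
      invFun := fun m => ρ.symm (m : M)
      left_inv := ρ.left_inv
      right_inv := ρ.right_inv
      map_add' := map_add ρ
      map_smul' := fun a n => hρ a n }
  e.toModuleIso

theorem IsSemilinear.twist_iso {g : G} {ρ : M ≃ₗ[K] N} (hρ : A.IsSemilinear g ρ) :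
    Nonempty (N ≅ (A.twist g⁻¹).obj M) :=
  ⟨hρ.symm.twistIso⟩

/-- σ⁻¹ρ is an `A`-linear endomorphism of a simple module, hence a scalar by splitness. This makes
the kernel of the semilinear extension exactly `Kˣ`. -/
theorem IsSemilinear.exists_eq_smul [IsSimpleModule A.A M] {g : G} {ρ σ : M ≃ₗ[K] N}
    (hρ : A.IsSemilinear g ρ) (hσ : A.IsSemilinear g σ) : ∃ c : Kˣ, ∀ m, ρ m = (c : K) • σ m := by
  have h := hρ.trans hσ.symm
  rw [inv_mul_cancel] at h
  obtain ⟨c, hc⟩ := A.exists_smul_of_isSimpleModule M { ρ.trans σ.symm with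
    map_smul' := fun a m => by
      have := h a m
      rwa [map_one] at this }
  have hc' : ∀ m, ρ m = c • σ m := fun m => by
    have := congrArg σ (hc m)
    rw [map_smul] at this
    rw [← this]
    exact (σ.apply_symm_apply _).symm
  have := IsSimpleModule.nontrivial A.A M
  obtain ⟨m, hm⟩ := exists_ne (0 : M)
  have hc0 : c ≠ 0 := by
    rintro rfl
    have := hc' m
    rw [zero_smul] at this
    exact hm (ρ.map_eq_zero_iff.1 this)
  exact ⟨Units.mk0 c hc0, hc'⟩

theorem IsSemilinear.isSimpleModule [IsSimpleModule A.A M] {g : G} {ρ : M ≃ₗ[K] N}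
    (hρ : A.IsSemilinear g ρ) : IsSimpleModule A.A N := by
  have hs := hρ.symm
  have : Nontrivial N := by
    have := IsSimpleModule.nontrivial A.A M
    exact ρ.symm.toEquiv.nontrivial
  refine { eq_bot_or_eq_top := fun S => ?_ }
  let T : Submodule A.A M :=
    { carrier := {m | ρ m ∈ S}
      add_mem' := fun {a b} ha hb => by
        change ρ (a + b) ∈ S
        rw [map_add]
        exact S.add_mem ha hb
      zero_mem' := by
        change ρ 0 ∈ S
        rw [map_zero]
        exact S.zero_mem
      smul_mem' := fun a m hm => by
        change ρ (a • m) ∈ S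
        rw [hρ]
        exact S.smul_mem _ hm }
  rcases eq_bot_or_eq_top T with h | h
  · left
    refine (Submodule.eq_bot_iff _).2 fun n hn => ?_
    have : ρ.symm n ∈ T := by
      change ρ (ρ.symm n) ∈ S
      rwa [ρ.apply_symm_apply]
    rw [h, Submodule.mem_bot] at this
    exact ρ.symm.map_eq_zero_iff.1 this
  · right
    refine Submodule.eq_top_iff'.2 fun n => ?_
    have : ρ.symm n ∈ T := h ▸ Submodule.mem_top
    change ρ (ρ.symm n) ∈ S at this
    rwa [ρ.apply_symm_apply] at this

/-! ### The central extension of semilinear maps between simple modules -/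

section Semilinear

variable {X : Type u} [MulAction G X]

variable (A) in
/-- Semilinear isomorphisms between the members of a family of modules indexed by a `G`-set. -/
@[ext]
structure SemilinearArrow (M : X → ModuleCat.{u} A.A) (x y : X) where
  g : G
  ρ : M x ≃ₗ[K] M y
  smul_eq : g • x = y
  isSemilinear : A.IsSemilinear g ρ

variable (A) in
/-- The groupoid of semilinear isomorphisms. -/
@[reducible]
def semilinearGroupoid (M : X → ModuleCat.{u} A.A) : Groupoid.{max u v} X where
  Hom := A.SemilinearArrow M
  id x := ⟨1, LinearEquiv.refl K _, one_smul _ _, IsSemilinear.refl⟩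
  comp a b := ⟨b.g * a.g, a.ρ.trans b.ρ, by rw [mul_smul, a.smul_eq, b.smul_eq],
    a.isSemilinear.trans b.isSemilinear⟩
  id_comp a := SemilinearArrow.ext (mul_one _) rfl
  comp_id a := SemilinearArrow.ext (one_mul _) rfl
  assoc a b c := SemilinearArrow.ext (mul_assoc _ _ _).symm rfl
  inv a := ⟨a.g⁻¹, a.ρ.symm, by rw [inv_smul_eq_iff, a.smul_eq], a.isSemilinear.symm⟩
  inv_comp a := SemilinearArrow.ext (mul_inv_cancel _) (LinearEquiv.symm_trans_self a.ρ)
  comp_inv a := SemilinearArrow.ext (inv_mul_cancel _) (LinearEquiv.self_trans_symm a.ρ)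

/-- Scalars as semilinear isomorphisms. -/
def SemilinearArrow.scalar (M : X → ModuleCat.{u} A.A) (x : X) (c : Kˣ) :
    A.SemilinearArrow M x x :=
  ⟨1, LinearEquiv.smulOfUnit c, one_smul _ _, IsSemilinear.refl.smul c⟩

variable [Finite X] {M : X → ModuleCat.{u} A.A}

/-- The central extension whose arrows over `g` are the `g`-semilinear isomorphisms between
simple modules. -/
def semilinearExtension (hM : ∀ x, IsSimpleModule A.A (M x))
    (hg : ∀ (g : G) x, ∃ ρ : M x ≃ₗ[K] M (g • x), A.IsSemilinear g ρ) :
    CentralExtension G K where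
  X := X
  groupoid := A.semilinearGroupoid M
  proj a := SemilinearArrow.g a
  proj_smul a := SemilinearArrow.smul_eq a
  proj_id _ := rfl
  proj_comp _ _ := rfl
  proj_surjective g x := by
    obtain ⟨ρ, hρ⟩ := hg g x
    exact ⟨(⟨g, ρ, rfl, hρ⟩ : A.SemilinearArrow M x (g • x)), rfl⟩
  incl x :=
    { toFun := fun c => SemilinearArrow.scalar M x c
      map_one' := SemilinearArrow.ext rfl (LinearEquiv.ext fun m => one_smul K m)
      map_mul' := fun c d => SemilinearArrow.ext (mul_one 1).symm
        (LinearEquiv.ext fun m => mul_smul (c : K) (d : K) m) }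
  incl_injective x c d h := by
    have := hM x
    have := IsSimpleModule.nontrivial A.A (M x)
    obtain ⟨m, hm⟩ := exists_ne (0 : M x)
    have h1 : (c : K) • m = (d : K) • m :=
      congrArg (fun a : A.SemilinearArrow M x x => a.ρ m) h
    exact Units.ext (smul_left_injective K hm h1)
  exact {x} a := by
    have := hM x
    constructor
    · intro hg
      obtain ⟨g, ρ, h, hρ⟩ := a
      obtain rfl : g = 1 := hg
      obtain ⟨c, hc⟩ := hρ.exists_eq_smul IsSemilinear.refl
      exact ⟨c, SemilinearArrow.ext rfl (LinearEquiv.ext fun m => (hc m).symm)⟩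
    · rintro ⟨d, hd⟩
      exact (congrArg (fun a : A.SemilinearArrow M x x => a.g) hd).symm
  central {x y} a c := SemilinearArrow.ext ((mul_one _).trans (one_mul _).symm)
    (LinearEquiv.ext fun m => map_smul (SemilinearArrow.ρ a) (c : K) m)

end Semilinear

section HasIrr

/-- A family of modules indexed by a `G`-set, together with semilinear isomorphisms with
cocycle `Θ`. -/
def HasCocycle (A : SplitGAlgebra G K) {X : Type u} [MulAction G X] (M : X → ModuleCat.{u} A.A)
    (Θ : G → G → X → Kˣ) : Prop :=
  ∃ ρ : ∀ (g : G) (x y : X), g • x = y → (M x ≃ₗ[K] M y),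
    (∀ g x y h, A.IsSemilinear g (ρ g x y h)) ∧
    ∀ g h x y z (hx : h • x = y) (hy : g • y = z) (m : M x),
      ρ g y z hy (ρ h x y hx m) =
        (Θ g h x : K) • ρ (g * h) x z (by rw [mul_smul, hx, hy]) m

theorem exists_semilinear_of_hasIrr_data {X : Type u} [MulAction G X] {M : X → ModuleCat.{u} A.A}
    (h : ∀ (g : G) x, Nonempty (M (g • x) ≅ (A.twist g⁻¹).obj (M x))) (g : G) (x : X) :
    ∃ ρ : M x ≃ₗ[K] M (g • x), A.IsSemilinear g ρ := by
  obtain ⟨e⟩ := h g x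
  exact exists_isSemilinear_of_twist_iso e

/-- The projective representations at the points are sections of the isotropy groups of the
semilinear extension. The result for extensions therefore replaces them by one family of semilinear
maps with the prescribed cocycle. -/
theorem HasIrr.exists_hasCocycle {X : DecoratedSet G K} (h : A.HasIrr X)
    {Θ : G → G → X.X → Kˣ} {hΘ : IsActionCocycle Θ} (hX : X.HasClass hΘ) :
    ∃ M : X.X → ModuleCat.{u} A.A, A.IsIrr M ∧ A.HasCocycle M Θ := by
  obtain ⟨M, h1, h2, h3, h4, h5⟩ := h
  let E := semilinearExtension h1 (exists_semilinear_of_hasIrr_data h4)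
  have hE : E.HasFrills X := by
    refine ⟨Equiv.refl X.X, fun _ _ => rfl, fun x => ?_⟩
    obtain ⟨ρ, θ, hρ, hθ, hx⟩ := h5 x
    refine ⟨fun g => (⟨g, ρ g, g.2, hρ g⟩ : A.SemilinearArrow M x x), θ, fun _ => rfl,
      fun g k => ?_, hx⟩
    exact SemilinearArrow.ext (one_mul _).symm (LinearEquiv.ext fun m => hθ g k m)
  obtain ⟨f, hf, σ, hσ, h⟩ := hE.exists_hasCocycle hX
  refine ⟨fun x => M (f x), ⟨fun x => h1 _, fun x y hxy => f.injective (h2 _ _ hxy),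
    fun N hN => ?_⟩, fun g x y hx => SemilinearArrow.ρ (σ g x y hx), fun g x y hx => ?_,
    fun g k x y z hx hy m => ?_⟩
  · obtain ⟨x, hx⟩ := h3 N hN
    obtain ⟨y, rfl⟩ := f.surjective x
    exact ⟨y, hx⟩
  · have := SemilinearArrow.isSemilinear (σ g x y hx)
    rwa [show SemilinearArrow.g (σ g x y hx) = g from hσ g x y hx] at this
  · exact congrArg (fun a => SemilinearArrow.ρ a m) (h g k x y z hx hy)

theorem HasCocycle.hasIrr {X : DecoratedSet G K} {M : X.X → ModuleCat.{u} A.A} (hM : A.IsIrr M)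
    {Θ : G → G → X.X → Kˣ} {hΘ : IsActionCocycle Θ} (h : A.HasCocycle M Θ) (hX : X.HasClass hΘ) :
    A.HasIrr X := by
  obtain ⟨ρ, hρ, h⟩ := h
  exact ⟨M, hM.1, hM.2, hM.3, fun g x => (hρ g x _ rfl).twist_iso, fun x =>
    ⟨fun g => ρ g x x g.2, hΘ.res x, fun g => hρ _ _ _ _,
      fun g k m => h g k x x x k.2 g.2 m, hX x⟩⟩

theorem IsIrr.exists_hasIrr {X : Type u} [MulAction G X] [Finite X]
    {M : X → ModuleCat.{u} A.A} (hM : A.IsIrr M)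
    (hg : ∀ (g : G) x, ∃ ρ : M x ≃ₗ[K] M (g • x), A.IsSemilinear g ρ) :
    ∃ X : DecoratedSet G K, A.HasIrr X := by
  let E := semilinearExtension hM.1 hg
  obtain ⟨Θ, hΘ, σ, hσ, h⟩ := CentralExtension.exists_hasCocycle (E := E) (Equiv.refl X)
    fun _ _ => rfl
  refine ⟨DecoratedSet.ofCocycle hΘ, HasCocycle.hasIrr (X := DecoratedSet.ofCocycle hΘ)
    (M := M) hM (hΘ := hΘ)
    ⟨fun g x y hx => SemilinearArrow.ρ (σ g x y hx), fun g x y hx => ?_, fun g k x y z hx hy m => ?_⟩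
    fun _ => rfl⟩
  · have := SemilinearArrow.isSemilinear (σ g x y hx)
    rwa [show SemilinearArrow.g (σ g x y hx) = g from hσ g x y hx] at this
  · exact congrArg (fun a => SemilinearArrow.ρ a m) (h g k x y z hx hy)

theorem HasIrr.congr_left {X Y : DecoratedSet G K} (h : A.HasIrr X) (hXY : X.Iso Y) :
    A.HasIrr Y := by
  obtain ⟨M, h1, h2, h3, h4, h5⟩ := h
  obtain ⟨e, he, hfr⟩ := DecoratedSet.iso_equivalence.symm hXY
  refine ⟨fun y => M (e y), fun y => h1 _, fun x y hxy => e.injective (h2 _ _ hxy),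
    fun N hN => ?_, fun g y => ?_, fun y => ?_⟩
  · obtain ⟨x, hx⟩ := h3 N hN
    exact ⟨e.symm x, by beta_reduce; rwa [e.apply_symm_apply]⟩
  · beta_reduce
    rw [he]
    exact h4 g (e y)
  · obtain ⟨ρ, θ, hρ, hθ, hx⟩ := h5 (e y)
    refine ⟨fun g => ρ (stabilizerMap e he y g), cocycle.pullback (stabilizerMap e he y) θ,
      fun g => hρ _, fun g k m => ?_, ?_⟩
    · exact (hθ _ _ m).trans (by rw [← map_mul]; rfl)
    · rw [hfr, ← hx]
      rfl

/-- The two families of simple modules are matched by isomorphisms, which carry the frills of `Y`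
into the semilinear extension built from `X`. Both decorated sets then belong to one extension. -/
theorem HasIrr.left_unique {X Y : DecoratedSet G K} (h : A.HasIrr X) (h' : A.HasIrr Y) :
    X.Iso Y := by
  obtain ⟨M, h1, h2, h3, h4, h5⟩ := h
  obtain ⟨N, k1, k2, k3, k4, k5⟩ := h'
  let E := semilinearExtension h1 (exists_semilinear_of_hasIrr_data h4)
  have hE : E.HasFrills X := by
    refine ⟨Equiv.refl X.X, fun _ _ => rfl, fun x => ?_⟩
    obtain ⟨ρ, θ, hρ, hθ, hx⟩ := h5 x
    refine ⟨fun g => (⟨g, ρ g, g.2, hρ g⟩ : A.SemilinearArrow M x x), θ, fun _ => rfl,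
      fun g k => ?_, hx⟩
    exact SemilinearArrow.ext (one_mul _).symm (LinearEquiv.ext fun m => hθ g k m)
  refine hE.left_unique ?_
  have hf : ∀ y, ∃ x, Nonempty (N y ≅ M x) := fun y => h3 _ (k1 y)
  choose f e using hf
  let e' : ∀ y, N y ≃ₗ[K] M (f y) := fun y => (e y).some.toLinearEquiv.restrictScalars K
  have he' : ∀ y, A.IsSemilinear 1 (e' y) := fun y => isSemilinear_of_iso _
  have hf : Function.Bijective f := by
    refine ⟨fun y y' hy => k2 _ _ ⟨(e y).some ≪≫ eqToIso (by rw [hy]) ≪≫ (e y').some.symm⟩,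
      fun x => ?_⟩
    obtain ⟨y, ⟨i⟩⟩ := k3 _ (h1 x)
    exact ⟨y, h2 _ _ ⟨(e y).some.symm ≪≫ i.symm⟩⟩
  have hfG : ∀ (g : G) y, f (g • y) = g • f y := fun g y => by
    obtain ⟨i⟩ := k4 g y
    obtain ⟨j⟩ := h4 g (f y)
    exact h2 _ _ ⟨(e (g • y)).some.symm ≪≫ i ≪≫ (A.twist g⁻¹).mapIso (e y).some ≪≫ j.symm⟩
  refine ⟨Equiv.ofBijective f hf, hfG, fun y => ?_⟩
  obtain ⟨ρ, θ, hρ, hθ, hy⟩ := k5 y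
  have hst : ∀ g : MulAction.stabilizer G y, (g : G) • f y = f y := fun g => by
    rw [← hfG]
    exact congrArg f g.2
  refine ⟨fun g => (⟨g, ((e' y).symm.trans (ρ g)).trans (e' y), hst g, ?_⟩ :
    A.SemilinearArrow M (f y) (f y)), θ, fun g => rfl, fun g k => ?_, hy⟩
  · have := ((he' y).symm.trans (hρ g)).trans (he' y)
    simpa using this
  · refine SemilinearArrow.ext (one_mul _).symm (LinearEquiv.ext fun m => ?_)
    change e' y (ρ g ((e' y).symm (e' y (ρ k ((e' y).symm m))))) =
      (θ.1 g k : K) • e' y (ρ (g * k) ((e' y).symm m))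
    rw [LinearEquiv.symm_apply_apply, hθ, map_smul]

end HasIrr

end SplitGAlgebra

/-! ### The decorated set of a split `G`-algebra -/

namespace SplitGAlgebra

variable {G : Type v} {K : Type u} [Group G] [Field K] {A B : SplitGAlgebra G K}

-- Simple modules correspond to isotypic components of the left regular module, of which there are
-- finitely many: every simple module is isomorphic to a left ideal.
variable (A) in
theorem exists_isIrr : ∃ (X : Type u) (_ : Finite X) (M : X → ModuleCat.{u} A.A), A.IsIrr M := by
  have := A.semisimple
  choose S hS h using fun c : isotypicComponents A.A A.A => c.2
  refine ⟨isotypicComponents A.A A.A, inferInstance, fun c => ModuleCat.of A.A (S c), hS,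
    fun c d ⟨e⟩ => Subtype.ext ?_, fun N hN => ?_⟩
  · rw [h c, h d]
    exact (e.toLinearEquiv : S c ≃ₗ[A.A] S d).isotypicComponent_eq
  · obtain ⟨I, ⟨e⟩⟩ := IsSemisimpleRing.exists_linearEquiv_ideal_of_isSimpleModule A.A N
    have hI : IsSimpleModule A.A I := IsSimpleModule.congr e.symm
    let c : isotypicComponents A.A A.A := ⟨isotypicComponent A.A A.A I, I, hI, rfl⟩
    have hc := IsIsotypic.isotypicComponents c.2
    have h1 : I ≤ c.1 := I.le_isotypicComponent
    have h2 : S c ≤ c.1 := (S c).le_isotypicComponent.trans (h c).ge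
    have := hS c
    have i1 : IsSimpleModule A.A (Submodule.comap c.1.subtype I) :=
      IsSimpleModule.congr (Submodule.comapSubtypeEquivOfLe h1)
    have i2 : IsSimpleModule A.A (Submodule.comap c.1.subtype (S c)) :=
      IsSimpleModule.congr (Submodule.comapSubtypeEquivOfLe h2)
    obtain ⟨i⟩ := hc (Submodule.comap c.1.subtype I) (Submodule.comap c.1.subtype (S c))
    exact ⟨c, ⟨(e.trans ((Submodule.comapSubtypeEquivOfLe h1).symm.trans
      (i.symm.trans (Submodule.comapSubtypeEquivOfLe h2)))).toModuleIso⟩⟩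

theorem IsIrr.eq_of_isSemilinear {X : Type u} {M : X → ModuleCat.{u} A.A} (hM : A.IsIrr M) {g : G}
    {x y z : X} {ρ : M x ≃ₗ[K] M y} {σ : M x ≃ₗ[K] M z} (hρ : A.IsSemilinear g ρ)
    (hσ : A.IsSemilinear g σ) : y = z := by
  have := hρ.symm.trans hσ
  rw [mul_inv_cancel] at this
  exact hM.eq_of_iso _ _ this.iso

-- Twisting a simple module gives a simple module. The index of the result is unique by
-- `IsIrr.eq_of_isSemilinear`, so the arbitrarily chosen targets satisfy the laws of an action.
variable (A) in
theorem exists_hasIrr : ∃ X : DecoratedSet G K, A.HasIrr X := by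
  obtain ⟨X, _, M, hM⟩ := A.exists_isIrr
  have h : ∀ (g : G) x, ∃ (y : X) (ρ : M x ≃ₗ[K] M y), A.IsSemilinear g ρ := fun g x => by
    have := hM.isSimpleModule x
    let e : M x ≃ₗ[K] (A.twist g⁻¹).obj (M x) := (equivOfTwistIso (Iso.refl _)).symm
    have he : A.IsSemilinear g e := by
      have := (isSemilinear_equivOfTwistIso (Iso.refl ((A.twist g⁻¹).obj (M x)))).symm
      rwa [inv_inv] at this
    obtain ⟨y, ⟨i⟩⟩ := hM.exists_iso _ he.isSimpleModule
    have := he.trans (isSemilinear_of_iso i)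
    rw [one_mul] at this
    exact ⟨y, _, this⟩
  choose f ρ hρ using h
  let _ : MulAction G X :=
    { smul := f
      one_smul := fun x => hM.eq_of_isSemilinear (hρ 1 x) IsSemilinear.refl
      mul_smul := fun g h x =>
        hM.eq_of_isSemilinear (hρ (g * h) x) ((hρ h x).trans (hρ g (f h x))) }
  exact hM.exists_hasIrr fun g x => ⟨ρ g x, hρ g x⟩

/-- The automorphisms fix `K`, so scalars act on a twisted module as on the original; `k` is the
same map regarded as taking values in the untwisted module. -/
theorem smul_hom_twist {g : G} {M N : ModuleCat.{u} A.A} (c : K) (f : N ⟶ (A.twist g).obj M)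
    (n : N) (k : N → M) (hk : ∀ n, k n = f.hom n) :
    (show M from (c • f).hom n) = c • k n := by
  rw [← algebraMap_smul A.A c (k n), ← AlgEquiv.commutes (A.α g), hk]
  rfl

/-- A semilinear operator on M is an isomorphism M ≅ M^[g], and the cocycle relation becomes an
identity between composites of these. In this form a linear functor with coherent β_g transports it
unchanged. -/
theorem HasIrr.congr_right {X : DecoratedSet G K} (h : A.HasIrr X) (hAB : A.GMorita B) :
    B.HasIrr X := by
  obtain ⟨M, h1, h2, h3, h4, h5⟩ := h
  obtain ⟨Φ, _, _, _, β, hβ⟩ := hAB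
  refine ⟨fun x => Φ.obj (M x), fun x => ?_, fun x y ⟨e⟩ => h2 x y ⟨Φ.preimageIso e⟩,
    fun N hN => ?_, fun g x => ?_, fun x => ?_⟩
  · have := h1 x
    have : Simple (M x) := (simple_iff_isSimpleModule' _).2 this
    exact (simple_iff_isSimpleModule' _).1 (simple_obj Φ (M x))
  · have : Simple N := (simple_iff_isSimpleModule' _).2 hN
    have : Simple (Φ.obj (Φ.objPreimage N)) := Simple.of_iso (Φ.objObjPreimageIso N)
    have : Simple (Φ.objPreimage N) := (simple_obj_iff Φ _).1 this
    obtain ⟨x, ⟨e⟩⟩ := h3 _ ((simple_iff_isSimpleModule' _).1 this)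
    exact ⟨x, ⟨(Φ.objObjPreimageIso N).symm ≪≫ Φ.mapIso e⟩⟩
  · obtain ⟨e⟩ := h4 g x
    exact ⟨Φ.mapIso e ≪≫ (β g⁻¹).app (M x)⟩
  · obtain ⟨ρ, θ, hρ, hθ, hx⟩ := h5 x
    let r : ∀ g : MulAction.stabilizer G x, M x ≅ (A.twist (g : G)).obj (M x) := fun g =>
      IsSemilinear.twistIso (hρ g)
    have hr : ∀ g h, (r h).hom ≫ (A.twist (h : G)).map (r g).hom ≫
        (A.twistMul g h).hom.app (M x) = (θ.1 g h : K) • (r (g * h)).hom := fun g h => by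
      ext m
      exact (hθ g h m).trans (smul_hom_twist _ (r (g * h)).hom m _ fun _ => rfl).symm
    let s : ∀ g : MulAction.stabilizer G x, Φ.obj (M x) ≅ (B.twist (g : G)).obj (Φ.obj (M x)) :=
      fun g => Φ.mapIso (r g) ≪≫ (β g).app (M x)
    have hs : ∀ g h, (s h).hom ≫ (B.twist (h : G)).map (s g).hom ≫
        (B.twistMul g h).hom.app (Φ.obj (M x)) = (θ.1 g h : K) • (s (g * h)).hom := fun g h => by
      have e1 := hβ g h (M x)
      have e2 := (β (h : G)).hom.naturality (r g).hom
      dsimp [s] at e1 e2 ⊢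
      rw [Functor.map_comp, Category.assoc, Category.assoc, ← reassoc_of% e2, e1,
        ← Φ.map_comp_assoc, ← Φ.map_comp_assoc, Category.assoc, hr, Φ.map_smul, Linear.smul_comp]
    refine ⟨fun g => equivOfTwistIso (s g), θ, fun g => isSemilinear_equivOfTwistIso (s g),
      fun g k m => ?_, hx⟩
    exact (congrArg (fun f => ModuleCat.Hom.hom f m) (hs g k)).trans
      (smul_hom_twist _ (s (g * k)).hom m _ fun _ => rfl)

end SplitGAlgebra

/-! ### Transfer of modules between algebras with the same simple modules -/

section Transfer

open scoped TensorProduct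

variable {K : Type u} [Field K] {A B : Type u} [Ring A] [Algebra K A] [Ring B] [Algebra K B]
  {ι : Type u}

/-- Postcomposition as a linear map over the base field. -/
def postcomp (K : Type*) [Field K] {A : Type*} [Ring A] [Algebra K A] (N : Type*) [AddCommGroup N]
    [Module A N] {V V' : Type*}
    [AddCommGroup V] [Module K V] [Module A V] [IsScalarTower K A V] [AddCommGroup V']
    [Module K V'] [Module A V'] [IsScalarTower K A V'] (F : V →ₗ[A] V') :
    (N →ₗ[A] V) →ₗ[K] (N →ₗ[A] V') where
  toFun f := F ∘ₗ f
  map_add' _ _ := LinearMap.comp_add _ _ _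
  map_smul' c f := LinearMap.ext fun n => LinearMap.map_smul_of_tower F c (f n)

/-- The functor `V ↦ ∏ N i ⊗ Hom(M i, V)`. -/
def transfer (M : ι → ModuleCat.{u} A) (N : ι → ModuleCat.{u} B) :
    ModuleCat.{u} A ⥤ ModuleCat.{u} B where
  obj V := ModuleCat.of B (∀ i, N i ⊗[K] (M i →ₗ[A] V))
  map F := ModuleCat.ofHom (LinearMap.pi fun i =>
    TensorProduct.AlgebraTensorModule.lTensor B (N i) (postcomp K (M i) F.hom) ∘ₗ LinearMap.proj i)
  map_id V := by
    ext x i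
    exact DFunLike.congr_fun (LinearMap.lTensor_id (N i) (M i →ₗ[A] V)) (x i)
  map_comp F F' := by
    ext x i
    exact DFunLike.congr_fun
      (LinearMap.lTensor_comp (N i) (postcomp K (M i) F'.hom) (postcomp K (M i) F.hom)) (x i)

variable (M : ι → ModuleCat.{u} A) (N : ι → ModuleCat.{u} B) {V V' : ModuleCat.{u} A}

/-- The pure tensors in a transferred module. -/
def transferTmul [DecidableEq ι] (i : ι) (n : N i) (f : M i →ₗ[A] V) :
    (transfer (K := K) M N).obj V :=
  (Pi.single i (n ⊗ₜ f) : ∀ i, N i ⊗[K] (M i →ₗ[A] V))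

theorem transfer_map_apply (F : V ⟶ V') (x : ∀ i, N i ⊗[K] (M i →ₗ[A] V)) (i : ι) :
    (show ∀ i, N i ⊗[K] (M i →ₗ[A] V') from
      ((transfer (K := K) M N).map F).hom (show (transfer (K := K) M N).obj V from x)) i =
    LinearMap.lTensor (N i) (postcomp K (M i) F.hom) (x i) := rfl

variable {N} in
theorem transfer_map_tmul [DecidableEq ι] (F : V ⟶ V') (i : ι) (n : N i) (f : M i →ₗ[A] V) :
    ((transfer (K := K) M N).map F).hom (transferTmul M N i n f) =
      transferTmul M N i n (F.hom ∘ₗ f) := by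
  refine funext fun j => (transfer_map_apply M N F _ j).trans ?_
  change LinearMap.lTensor (N j) (postcomp K (M j) F.hom)
      (Pi.single (M := fun i => N i ⊗[K] (M i →ₗ[A] V)) i (n ⊗ₜ f) j) =
    Pi.single (M := fun i => N i ⊗[K] (M i →ₗ[A] V')) i (n ⊗ₜ (F.hom ∘ₗ f)) j
  by_cases h : i = j
  · subst h
    simp only [Pi.single_eq_same]
    rfl
  · rw [Pi.single_eq_of_ne (Ne.symm h), Pi.single_eq_of_ne (Ne.symm h), map_zero]

instance : (transfer (K := K) M N).Additive where
  map_add {V V' F F'} := by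
    refine ModuleCat.hom_ext (LinearMap.ext fun x => funext fun i => ?_)
    refine (transfer_map_apply M N (F + F') x i).trans ?_
    rw [show postcomp K (M i) (F + F').hom = postcomp K (M i) F.hom + postcomp K (M i) F'.hom from
      rfl, LinearMap.lTensor_add]
    rfl

instance : (transfer (K := K) M N).Linear K where
  map_smul {V V'} F c := by
    refine ModuleCat.hom_ext (LinearMap.ext fun x => funext fun i => ?_)
    refine (transfer_map_apply M N (c • F) x i).trans ?_
    rw [show postcomp K (M i) (c • F).hom = c • postcomp K (M i) F.hom from rfl,
      LinearMap.lTensor_smul, LinearMap.smul_apply, ← algebraMap_smul B c]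
    rfl

variable {M N}

theorem transferTmul_add_right [DecidableEq ι] (i : ι) (n : N i) (f f' : M i →ₗ[A] V) :
    transferTmul (K := K) M N i n (f + f') = transferTmul M N i n f + transferTmul M N i n f' := by
  unfold transferTmul
  rw [TensorProduct.tmul_add, Pi.single_add]
  rfl

theorem transferTmul_smul_right [DecidableEq ι] (c : K) (i : ι) (n : N i) (f : M i →ₗ[A] V) :
    transferTmul (K := K) M N i n (c • f) = transferTmul M N i (c • n) f := by
  unfold transferTmul
  rw [TensorProduct.smul_tmul]

theorem transfer_hom_ext [DecidableEq ι] [Finite ι] {W : ModuleCat.{u} B}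
    {F F' : (transfer (K := K) M N).obj V ⟶ W}
    (h : ∀ i n f, F.hom (transferTmul M N i n f) = F'.hom (transferTmul M N i n f)) : F = F' := by
  have key : ∀ (i : ι) (x : N i ⊗[K] (M i →ₗ[A] V)),
      (show (∀ i, N i ⊗[K] (M i →ₗ[A] V)) →ₗ[B] W from F.hom) (Pi.single i x) =
        (show (∀ i, N i ⊗[K] (M i →ₗ[A] V)) →ₗ[B] W from F'.hom) (Pi.single i x) := fun i x => by
    induction x with
    | zero => rw [Pi.single_zero, map_zero, map_zero]
    | add x y hx hy => rw [Pi.single_add, map_add, map_add, hx, hy]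
    | tmul n f => exact h i n f
  exact ModuleCat.hom_ext (LinearMap.pi_ext key)

/-- A module over a split semisimple algebra is ∏ M_i ⊗ Hom(M_i, V), and its homomorphisms are
families of linear maps of multiplicity spaces. The functor keeps these spaces and only replaces M_i
by N_i. -/
theorem isEquivalence_transfer [Finite ι] (hM : IsIrrFamily K A (fun i => M i))
    (hN : IsIrrFamily K B (fun i => N i)) : (transfer (K := K) M N).IsEquivalence := by
  classical
  have := Fintype.ofFinite ι
  have faithful : (transfer (K := K) M N).Faithful := ⟨fun {V V' F F'} h => by
    apply ModuleCat.hom_ext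
    refine hM.hom_ext fun i f => hN.tmul_injective i fun n => ?_
    have := congrArg (fun T => ModuleCat.Hom.hom T (transferTmul M N i n f)) h
    beta_reduce at this
    rw [transfer_map_tmul, transfer_map_tmul] at this
    exact Pi.single_injective i this⟩
  have full : (transfer (K := K) M N).Full := ⟨fun {V V'} T => by
    let T₀ : (∀ i, N i ⊗[K] (M i →ₗ[A] V)) →ₗ[B] (∀ i, N i ⊗[K] (M i →ₗ[A] V')) := T.hom
    have hu : ∀ i f, ∃ u : M i →ₗ[A] V', ∀ n : N i,
        T.hom (transferTmul M N i n f) = transferTmul M N i n u := fun i f => by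
      obtain ⟨e, he⟩ := hN.exists_equiv_hom (fun i => M i →ₗ[A] V) i
      obtain ⟨u, hu⟩ := hN.exists_single (fun i => M i →ₗ[A] V') i (T₀ ∘ₗ e f)
      exact ⟨u, fun n => (congrArg T.hom (he f n).symm).trans (hu n)⟩
    choose u hu using hu
    have hu' : ∀ i f w, (∀ n : N i, T.hom (transferTmul M N i n f) = transferTmul M N i n w) →
        u i f = w := fun i f w hw => hN.tmul_injective i fun n => by
      have := (hu i f n).symm.trans (hw n)
      exact Pi.single_injective i this
    obtain ⟨F, hF⟩ := hM.exists_hom (V := V) (V' := V') fun i =>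
      { toFun := u i
        map_add' := fun f f' => hu' _ _ _ fun n => by
          rw [transferTmul_add_right, transferTmul_add_right, map_add, hu, hu]
        map_smul' := fun c f => hu' _ _ _ fun n => by
          rw [RingHom.id_apply, transferTmul_smul_right, transferTmul_smul_right, hu] }
    refine ⟨ModuleCat.ofHom F, transfer_hom_ext fun i n f => ?_⟩
    rw [transfer_map_tmul, hu]
    exact congrArg (fun w => transferTmul M N i n w) (hF i f)⟩
  have essSurj : (transfer (K := K) M N).EssSurj := ⟨fun W => by
    -- The module over `A` with the multiplicity spaces of `W`.
    let V : ModuleCat.{u} A := ModuleCat.of A (∀ i, M i ⊗[K] (N i →ₗ[B] W))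
    choose e he using fun i => hM.exists_equiv_hom (fun i => N i →ₗ[B] W) i
    let e₁ : (∀ i, N i ⊗[K] (M i →ₗ[A] V)) ≃ₗ[B] (∀ i, N i ⊗[K] (N i →ₗ[B] W)) :=
      LinearEquiv.piCongrRight fun i =>
        TensorProduct.AlgebraTensorModule.congr (LinearEquiv.refl B (N i)) (e i).symm
    exact ⟨V, ⟨(e₁.trans (LinearEquiv.ofBijective _ hN.eval_bijective)).toModuleIso⟩⟩⟩
  exact { }

end Transfer

namespace SplitGAlgebra

open scoped TensorProduct

variable {G : Type v} {K : Type u} [Group G] [Field K] {A B : SplitGAlgebra G K}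

/-- `Hom(M, V^[g]) ≃ Hom(N, V)` for a semilinear isomorphism `M ≃ N`. -/
def homTwist {M N : ModuleCat.{u} A.A} {g : G} {ρ : M ≃ₗ[K] N} (hρ : A.IsSemilinear g ρ)
    (V : ModuleCat.{u} A.A) : (M →ₗ[A.A] (A.twist g).obj V) ≃ₗ[K] (N →ₗ[A.A] V) :=
  let toHom : (M →ₗ[A.A] (A.twist g).obj V) → (N →ₗ[A.A] V) := fun f =>
    { toFun := fun n => (show V from f (ρ.symm n))
      map_add' := fun a b => by rw [map_add]; exact map_add f _ _
      map_smul' := fun a n => by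
        rw [hρ.symm]
        refine (map_smul f _ _).trans ?_
        change A.α g (A.α g⁻¹ a) • (show V from f (ρ.symm n)) = _
        rw [← AlgEquiv.mul_apply, ← map_mul, mul_inv_cancel, map_one]
        rfl }
  let invHom : (N →ₗ[A.A] V) → (M →ₗ[A.A] (A.twist g).obj V) := fun f =>
    { toFun := fun m => (show (A.twist g).obj V from f (ρ m))
      map_add' := fun a b => by rw [map_add]; exact map_add f _ _
      map_smul' := fun a m => by
        rw [hρ]
        exact map_smul f _ _ }
  { toFun := toHom
    invFun := invHom
    map_add' := fun f f' => rfl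
    map_smul' := fun c f => LinearMap.ext fun n => by
      change A.α g (algebraMap K A.A c) • (show V from f (ρ.symm n)) =
        c • (show V from f (ρ.symm n))
      rw [AlgEquiv.commutes, algebraMap_smul]
    left_inv := fun f => LinearMap.ext fun m => congrArg f (ρ.symm_apply_apply m)
    right_inv := fun f => LinearMap.ext fun m => congrArg f (ρ.apply_symm_apply m) }

theorem homTwist_apply {M N : ModuleCat.{u} A.A} {g : G} {ρ : M ≃ₗ[K] N} (hρ : A.IsSemilinear g ρ)
    (V : ModuleCat.{u} A.A) (f : M →ₗ[A.A] (A.twist g).obj V) (n : N) :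
    homTwist hρ V f n = f (ρ.symm n) := rfl

section

variable {X : Type u} [MulAction G X] {M : X → ModuleCat.{u} A.A} {N : X → ModuleCat.{u} B.A}
  {ρ : ∀ (g : G) (x y : X), g • x = y → (M x ≃ₗ[K] M y)}
  (hρ : ∀ g x y h, A.IsSemilinear g (ρ g x y h))
  {σ : ∀ (g : G) (x y : X), g • x = y → (N x ≃ₗ[K] N y)}
  (hσ : ∀ g x y h, B.IsSemilinear g (σ g x y h))

variable (σ) in
/-- The linear map underlying the isomorphism of the transfer of a twist with the twist of the
transfer. -/
def transferTwistEquiv (g : G) (V : ModuleCat.{u} A.A) :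
    (∀ x, N x ⊗[K] (M x →ₗ[A.A] (A.twist g).obj V)) ≃ₗ[K] (∀ x, N x ⊗[K] (M x →ₗ[A.A] V)) :=
  (LinearEquiv.piCongrRight fun x =>
    TensorProduct.congr (σ g x (g • x) rfl) (homTwist (hρ g x (g • x) rfl) V)).trans
  (LinearEquiv.piCongrLeft K (fun x => N x ⊗[K] (M x →ₗ[A.A] V)) (MulAction.toPerm g))

theorem transferTwistEquiv_apply (g : G) (V : ModuleCat.{u} A.A)
    (z : ∀ x, N x ⊗[K] (M x →ₗ[A.A] (A.twist g).obj V)) (x : X) :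
    transferTwistEquiv hρ σ g V z (g • x) =
      TensorProduct.congr (σ g x (g • x) rfl) (homTwist (hρ g x (g • x) rfl) V) (z x) :=
  Equiv.piCongrLeft_apply_apply (fun x => N x ⊗[K] (M x →ₗ[A.A] V)) (MulAction.toPerm g) _ x

theorem transferTwistEquiv_single [DecidableEq X] (g : G) (V : ModuleCat.{u} A.A) {x y : X}
    (h : g • x = y) (n : N x) (f : M x →ₗ[A.A] (A.twist g).obj V) :
    transferTwistEquiv hρ σ g V (Pi.single x (n ⊗ₜ f)) =
      Pi.single y (σ g x y h n ⊗ₜ homTwist (hρ g x y h) V f) := by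
  subst h
  funext j
  obtain ⟨j, rfl⟩ := MulAction.surjective g j
  rw [transferTwistEquiv_apply]
  by_cases h : x = j
  · subst h
    rw [Pi.single_eq_same, Pi.single_eq_same]
    rfl
  · rw [Pi.single_eq_of_ne (Ne.symm h), map_zero, Pi.single_eq_of_ne]
    exact fun h' => h (MulAction.injective g h').symm

include hσ in
theorem transferTwistEquiv_smul (g : G) (V : ModuleCat.{u} A.A) (b : B.A)
    (z : ∀ x, N x ⊗[K] (M x →ₗ[A.A] (A.twist g).obj V)) :
    transferTwistEquiv hρ σ g V (b • z) = B.α g b • transferTwistEquiv hρ σ g V z := by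
  funext j
  obtain ⟨j, rfl⟩ := MulAction.surjective g j
  rw [transferTwistEquiv_apply, Pi.smul_apply, Pi.smul_apply, transferTwistEquiv_apply]
  induction z j with
  | zero => simp
  | add x y hx hy => rw [smul_add, map_add, map_add, hx, hy, smul_add]
  | tmul n f =>
    rw [TensorProduct.smul_tmul', TensorProduct.congr_tmul, TensorProduct.congr_tmul, hσ,
      TensorProduct.smul_tmul']

/-- The transfer of a twist is the twist of the transfer. -/
def transferTwistIso (g : G) (V : ModuleCat.{u} A.A) :
    (transfer (K := K) M N).obj ((A.twist g).obj V) ≅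
      (B.twist g).obj ((transfer (K := K) M N).obj V) :=
  let e : (∀ x, N x ⊗[K] (M x →ₗ[A.A] (A.twist g).obj V)) ≃ₗ[B.A]
      (B.twist g).obj ((transfer (K := K) M N).obj V) :=
    { toFun := transferTwistEquiv hρ σ g V
      invFun := (transferTwistEquiv hρ σ g V).symm
      left_inv := (transferTwistEquiv hρ σ g V).left_inv
      right_inv := (transferTwistEquiv hρ σ g V).right_inv
      map_add' := map_add (transferTwistEquiv hρ σ g V)
      map_smul' := transferTwistEquiv_smul hρ hσ g V }
  e.toModuleIso

theorem transferTwistIso_tmul [DecidableEq X] (g : G) (V : ModuleCat.{u} A.A) {x y : X}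
    (h : g • x = y) (n : N x) (f : M x →ₗ[A.A] (A.twist g).obj V) :
    (show (transfer (K := K) M N).obj V from
      (transferTwistIso hρ hσ g V).hom.hom (transferTmul M N x n f)) =
      transferTmul M N y (σ g x y h n) (homTwist (hρ g x y h) V f) :=
  transferTwistEquiv_single hρ g V h n f

/-- The isomorphism with the twist is σ on N_x tensored with precomposition by ρ⁻¹ on Hom(M_x, V).
The first contributes `Θ` and the second `Θ`⁻¹, so coherence holds on the nose. -/
theorem HasCocycle.gMorita [Finite X] (hM : A.IsIrr M) (hN : B.IsIrr N)
    {Θ : G → G → X → Kˣ} (h : A.HasCocycle M Θ) (h' : B.HasCocycle N Θ) : A.GMorita B := by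
  classical
  obtain ⟨ρ, hρ, h⟩ := h
  obtain ⟨σ, hσ, h'⟩ := h'
  refine ⟨transfer (K := K) M N, isEquivalence_transfer hM.isIrrFamily hN.isIrrFamily,
    inferInstance, inferInstance, fun g =>
    NatIso.ofComponents (transferTwistIso hρ hσ g) fun {V V'} F => ?_, fun g k V => ?_⟩
  · refine transfer_hom_ext fun x n f => ?_
    refine (congrArg (transferTwistIso hρ hσ g V').hom.hom
      (transfer_map_tmul M ((A.twist g).map F) x n f)).trans ?_
    refine (transferTwistIso_tmul hρ hσ g V' rfl n _).trans ?_
    refine Eq.symm ((congrArg ((transfer (K := K) M N).map F).hom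
      (transferTwistIso_tmul hρ hσ g V rfl n f)).trans ?_)
    exact transfer_map_tmul M F _ _ _
  · refine transfer_hom_ext fun x n f => ?_
    have e1 := (congrArg (transferTwistIso hρ hσ g V).hom.hom
      (transferTwistIso_tmul hρ hσ k ((A.twist g).obj V) rfl n f)).trans
      (transferTwistIso_tmul hρ hσ g V rfl _ _)
    have e2 := (congrArg (transferTwistIso hρ hσ (g * k) V).hom.hom
      (transfer_map_tmul M ((A.twistMul g k).hom.app V) x n f)).trans
      (transferTwistIso_tmul hρ hσ (g * k) V (mul_smul g k x) n _)
    refine e1.trans (Eq.trans ?_ e2.symm)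
    -- The scalar produced by σ is moved across the tensor product, where it turns ρ_gk into ρ_g
    -- ρ_k.
    rw [h' g k x (k • x) (g • k • x) rfl rfl, ← transferTmul_smul_right]
    congr 1
    refine LinearMap.ext fun m => ?_
    obtain ⟨m, rfl⟩ := (ρ (g * k) x (g • k • x) (mul_smul g k x)).surjective m
    rw [LinearMap.smul_apply, ← LinearMap.map_smul_of_tower, ← h g k x (k • x) (g • k • x) rfl rfl,
      homTwist_apply, homTwist_apply, homTwist_apply, LinearEquiv.symm_apply_apply,
      LinearEquiv.symm_apply_apply, LinearEquiv.symm_apply_apply]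
    rfl

end

theorem HasIrr.right_unique {X : DecoratedSet G K} (h : A.HasIrr X) (h' : B.HasIrr X) :
    A.GMorita B := by
  obtain ⟨Θ, hΘ, hX⟩ := X.exists_hasClass
  obtain ⟨M, hM, h⟩ := h.exists_hasCocycle hX
  obtain ⟨N, hN, h'⟩ := h'.exists_hasCocycle hX
  exact h.gMorita hM hN h'

end SplitGAlgebra

/-! ### Products of endomorphism algebras -/

section PiEnd

variable {K : Type u} [Field K] {B : Type u} [Ring B] [Algebra K B] {X : Type u}
  {U : X → Type u} [∀ x, AddCommGroup (U x)] [∀ x, Module K (U x)]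
  (e : B ≃ₐ[K] ∀ x, Module.End K (U x))

include e in
theorem isSemisimpleRing_of_algEquiv_pi_end [Finite X] [∀ x, Module.Finite K (U x)] :
    IsSemisimpleRing B := by
  have : ∀ x, IsSemisimpleRing (Module.End K (U x)) := fun x => IsSemisimpleRing.moduleEnd K (U x)
  exact e.symm.toRingEquiv.isSemisimpleRing

section

variable [DecidableEq X]

/-- The element of the algebra acting as `v ↦ ξ(v) u` on `U x`, and by zero on the other modules. -/
def rankOne (x : X) (u : U x) (ξ : Module.Dual K (U x)) : B :=
  e.symm (Pi.single x (ξ.smulRight u))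

theorem mul_rankOne {x : X} (b : B) (u : U x) (ξ : Module.Dual K (U x)) :
    b * rankOne e x u ξ = rankOne e x (e b x u) ξ := by
  unfold rankOne
  rw [← e.symm_apply_apply b, ← map_mul, e.symm_apply_apply]
  congr 1
  funext y
  by_cases h : x = y
  · subst h
    rw [Pi.mul_apply, Pi.single_eq_same, Pi.single_eq_same]
    ext v
    simp
  · rw [Pi.mul_apply, Pi.single_eq_of_ne (Ne.symm h), Pi.single_eq_of_ne (Ne.symm h), mul_zero]

theorem sum_rankOne [Fintype X] {ι : X → Type*} [∀ x, Fintype (ι x)]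
    (b : ∀ x, Module.Basis (ι x) K (U x)) :
    ∑ x, ∑ i, rankOne e x (b x i) ((b x).coord i) = 1 := by
  unfold rankOne
  simp_rw [← map_sum]
  rw [← map_one e.symm]
  congr 1
  funext y
  rw [Finset.sum_apply, Finset.sum_eq_single y]
  · rw [Finset.sum_apply]
    simp only [Pi.single_eq_same]
    ext v
    simp only [LinearMap.sum_apply, LinearMap.smulRight_apply, Module.Basis.coord_apply]
    exact (b y).sum_repr v
  · intro x _ hx
    rw [Finset.sum_apply]
    simp [Pi.single_eq_of_ne (Ne.symm hx)]
  · simp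

variable [∀ x, Module B (U x)] (he : ∀ (b : B) (x : X) (u : U x), b • u = e b x u)

include he

theorem rankOne_smul_same {x : X} (u v : U x) (ξ : Module.Dual K (U x)) :
    rankOne e x u ξ • v = ξ v • u := by
  rw [he, rankOne, e.apply_symm_apply, Pi.single_eq_same, LinearMap.smulRight_apply]

theorem rankOne_smul_of_ne {x y : X} (h : x ≠ y) (u : U x) (v : U y) (ξ : Module.Dual K (U x)) :
    rankOne e x u ξ • v = 0 := by
  rw [he, rankOne, e.apply_symm_apply, Pi.single_eq_of_ne (Ne.symm h), LinearMap.zero_apply]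

/-- Rank-one operators carry any nonzero vector to any other vector. -/
theorem isSimpleModule_of_algEquiv_pi_end (x : X) [Nontrivial (U x)] : IsSimpleModule B (U x) := by
  refine { eq_bot_or_eq_top := fun S => or_iff_not_imp_left.2 fun hS => ?_ }
  obtain ⟨v, hv, h0⟩ := S.ne_bot_iff.1 hS
  obtain ⟨ξ, hξ⟩ : ∃ ξ : Module.Dual K (U x), ξ v ≠ 0 := by
    by_contra! hc
    exact h0 ((Module.forall_dual_apply_eq_zero_iff K v).1 hc)
  refine Submodule.eq_top_iff'.2 fun u => ?_
  have := S.smul_mem (rankOne e x ((ξ v)⁻¹ • u) ξ) hv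
  rwa [rankOne_smul_same e he, smul_inv_smul₀ hξ] at this

/-- A rank-one operator in the factor `x` acts by zero on `U y` for y ≠ x, but not on `U x`. -/
theorem eq_of_linearEquiv_of_algEquiv_pi_end {x y : X} [Nontrivial (U x)]
    (i : U x ≃ₗ[B] U y) : x = y := by
  by_contra h
  obtain ⟨v, h0⟩ := exists_ne (0 : U x)
  obtain ⟨ξ, hξ⟩ : ∃ ξ : Module.Dual K (U x), ξ v ≠ 0 := by
    by_contra! hc
    exact h0 ((Module.forall_dual_apply_eq_zero_iff K v).1 hc)
  have := i.map_smul (rankOne e x v ξ) v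
  rw [rankOne_smul_of_ne e he h, rankOne_smul_same e he, i.map_eq_zero_iff] at this
  exact smul_ne_zero hξ h0 this

theorem exists_eq_smul_of_algEquiv_pi_end {x : X} [Nontrivial (U x)] (f : U x →ₗ[B] U x) :
    ∃ c : K, ∀ u, f u = c • u := by
  obtain ⟨v, h0⟩ := exists_ne (0 : U x)
  obtain ⟨ξ, hξ⟩ : ∃ ξ : Module.Dual K (U x), ξ v ≠ 0 := by
    by_contra! hc
    exact h0 ((Module.forall_dual_apply_eq_zero_iff K v).1 hc)
  refine ⟨(ξ v)⁻¹ * ξ (f v), fun u => ?_⟩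
  have h1 : u = rankOne e x ((ξ v)⁻¹ • u) ξ • v := by
    rw [rankOne_smul_same e he, smul_inv_smul₀ hξ]
  rw [h1, map_smul, rankOne_smul_same e he, ← h1, smul_smul, mul_comm]

/-- The identity is a sum of rank-one elements, so one of them does not kill `n`. Letting its image
vector vary over `U x` while its functional stays fixed gives a nonzero map U x → N, which is
bijective by Schur's lemma. -/
theorem exists_linearEquiv_of_algEquiv_pi_end [Finite X] [∀ x, Module.Finite K (U x)]
    [∀ x, Nontrivial (U x)] (N : Type*)
    [AddCommGroup N] [Module B N] [IsSimpleModule B N] : ∃ x, Nonempty (N ≃ₗ[B] U x) := by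
  have := Fintype.ofFinite X
  have := IsSimpleModule.nontrivial B N
  obtain ⟨n, hn⟩ := exists_ne (0 : N)
  let b := fun x => Module.finBasis K (U x)
  obtain ⟨x, i, h⟩ : ∃ x i, rankOne e x (b x i) ((b x).coord i) • n ≠ 0 := by
    by_contra! hc
    refine hn ?_
    rw [← one_smul B n, ← sum_rankOne e b, Finset.sum_smul]
    refine Finset.sum_eq_zero fun x _ => ?_
    rw [Finset.sum_smul]
    exact Finset.sum_eq_zero fun i _ => hc x i
  have hs := isSimpleModule_of_algEquiv_pi_end e he x
  let f : U x →ₗ[B] N :=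
    { toFun := fun u => rankOne e x u ((b x).coord i) • n
      map_add' := fun u v => by
        rw [← add_smul, rankOne, rankOne, rankOne, ← map_add, ← Pi.single_add]
        congr 3
        ext w
        simp
      map_smul' := fun a u => by
        rw [he, ← mul_rankOne, mul_smul]
        rfl }
  have hf : f ≠ 0 := fun h0 => h (DFunLike.congr_fun h0 (b x i))
  exact ⟨x, ⟨(LinearEquiv.ofBijective f ((LinearMap.bijective_or_eq_zero f).resolve_right hf)).symm⟩⟩

end

end PiEnd

namespace SplitGAlgebra

variable {G : Type v} {K : Type u} [Group G] [Field K] {B : Type u} [Ring B] [Algebra K B]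
  {X : Type u} [Finite X] {U : X → Type u} [∀ x, AddCommGroup (U x)] [∀ x, Module K (U x)]
  [∀ x, Module.Finite K (U x)] [∀ x, Nontrivial (U x)]
  (α : G →* (B ≃ₐ[K] B)) (e : B ≃ₐ[K] ∀ x, Module.End K (U x))

/-- An algebra isomorphic to a product of endomorphism algebras is semisimple and split. -/
def ofAlgEquivPiEnd : SplitGAlgebra G K where
  A := B
  α := α
  semisimple := isSemisimpleRing_of_algEquiv_pi_end e
  split N _ _ _ f := by
    classical
    let _ : ∀ x, Module B (U x) := fun x =>
      Module.compHom (U x) ((Pi.evalRingHom _ x).comp (e : B →+* ∀ x, Module.End K (U x)))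
    have he : ∀ (b : B) (x : X) (u : U x), b • u = e b x u := fun _ _ _ => rfl
    obtain ⟨x, ⟨i⟩⟩ := exists_linearEquiv_of_algEquiv_pi_end e he N
    obtain ⟨c, hc⟩ := exists_eq_smul_of_algEquiv_pi_end e he
      (i.toLinearMap ∘ₗ f ∘ₗ i.symm.toLinearMap)
    refine ⟨c, fun m => i.injective ?_⟩
    have := hc (i m)
    simp only [LinearMap.comp_apply, LinearEquiv.coe_coe, LinearEquiv.symm_apply_apply] at this
    rw [this, map_smul, he, AlgEquiv.commutes]
    rfl

/-- The simple modules of an algebra isomorphic to a product of endomorphism algebras. -/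
def piEndModule (x : X) : ModuleCat.{u} (ofAlgEquivPiEnd α e).A :=
  let _ : Module B (U x) :=
    Module.compHom (U x) ((Pi.evalRingHom _ x).comp (e : B →+* ∀ x, Module.End K (U x)))
  ModuleCat.of B (U x)

theorem piEndModule_smul (x : X) (b : (ofAlgEquivPiEnd α e).A) (u : piEndModule α e x) :
    b • u = (show piEndModule α e x from e b x (show U x from u)) := rfl

theorem piEndModule_field_smul (x : X) (c : K) (u : piEndModule α e x) :
    c • u = (show piEndModule α e x from c • (show U x from u)) := by
  rw [← algebraMap_smul (ofAlgEquivPiEnd α e).A c u, piEndModule_smul]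
  exact DFunLike.congr_fun (congrFun (e.commutes c) x) _

theorem isIrr_piEndModule : (ofAlgEquivPiEnd α e).IsIrr (piEndModule α e) := by
  classical
  let _ : ∀ x, Module B (U x) := fun x =>
    Module.compHom (U x) ((Pi.evalRingHom _ x).comp (e : B →+* ∀ x, Module.End K (U x)))
  have he : ∀ (b : B) (x : X) (u : U x), b • u = e b x u := fun _ _ _ => rfl
  refine ⟨fun x => isSimpleModule_of_algEquiv_pi_end e he x,
    fun x y ⟨i⟩ => eq_of_linearEquiv_of_algEquiv_pi_end e he i.toLinearEquiv, fun N hN => ?_⟩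
  obtain ⟨x, ⟨i⟩⟩ := @exists_linearEquiv_of_algEquiv_pi_end K _ B _ _ X U _ _ e _ _ he _ _ _
    N _ N.isModule hN
  exact ⟨x, ⟨i.toModuleIso⟩⟩

/-- This is used twice: to construct an algebra with given frills, and to compute the simple modules
of an endomorphism algebra. -/
theorem hasIrr_ofAlgEquivPiEnd {X : DecoratedSet G K} {U : X.X → Type u}
    [∀ x, AddCommGroup (U x)] [∀ x, Module K (U x)]
    [∀ x, Module.Finite K (U x)] [∀ x, Nontrivial (U x)]
    (α : G →* (B ≃ₐ[K] B)) (e : B ≃ₐ[K] ∀ x, Module.End K (U x))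
    {Θ : G → G → X.X → Kˣ} {hΘ : IsActionCocycle Θ} (hX : X.HasClass hΘ)
    (ρ : ∀ (g : G) (x y : X.X), g • x = y → (U x ≃ₗ[K] U y))
    (hρ : ∀ g x y h b u, ρ g x y h (e b x u) = e (α g b) y (ρ g x y h u))
    (hρ' : ∀ g h x y z (hx : h • x = y) (hy : g • y = z) (u : U x),
      ρ g y z hy (ρ h x y hx u) =
        (Θ g h x : K) • ρ (g * h) x z (by rw [mul_smul, hx, hy]) u) :
    (ofAlgEquivPiEnd α e).HasIrr X := by
  let r : ∀ (g : G) (x y : X.X), g • x = y → (piEndModule α e x ≃ₗ[K] piEndModule α e y) :=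
    fun g x y h =>
    { toFun := ρ g x y h
      invFun := (ρ g x y h).symm
      left_inv := (ρ g x y h).left_inv
      right_inv := (ρ g x y h).right_inv
      map_add' := map_add (ρ g x y h)
      map_smul' := fun c u => (congrArg (ρ g x y h) (piEndModule_field_smul α e x c u)).trans
        ((map_smul (ρ g x y h) c (show U x from u)).trans
          (piEndModule_field_smul α e y c _).symm) }
  exact HasCocycle.hasIrr (isIrr_piEndModule α e) (hΘ := hΘ) ⟨r, fun g x y h => hρ g x y h,
    fun g h x y z hx hy m => (hρ' g h x y z hx hy m).trans
      (piEndModule_field_smul α e z _ _).symm⟩ hX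

end SplitGAlgebra

/-! ### Projective representations of action groupoids and the algebra of a decorated set -/

namespace SplitGAlgebra

variable {G : Type v} {K : Type u} [Group G] [Field K]

section

variable {X : Type u} [MulAction G X] {U : X → Type u} [∀ x, AddCommGroup (U x)]
  [∀ x, Module K (U x)] {Θ : G → G → X → Kˣ}
  (ρ : ∀ (g : G) (x y : X), g • x = y → (U x ≃ₗ[K] U y))

/-- Conjugation by a projective representation on a family of vector spaces. -/
def piConj (g : G) : (∀ x, Module.End K (U x)) →ₐ[K] (∀ x, Module.End K (U x)) :=
  AlgHom.pi fun y => ((ρ g (g⁻¹ • y) y (smul_inv_smul g y)).conjAlgEquiv K).toAlgHom.comp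
    (Pi.evalAlgHom K _ (g⁻¹ • y))

theorem piConj_apply_apply (g : G) (x y : X) (h : g • x = y) (b : ∀ x, Module.End K (U x))
    (u : U x) : piConj ρ g b y (ρ g x y h u) = ρ g x y h (b x u) := by
  obtain rfl : x = g⁻¹ • y := by rw [← h, inv_smul_smul]
  change ρ g _ y _ (b _ ((ρ g _ y _).symm _)) = _
  rw [LinearEquiv.symm_apply_apply]

/-- Scalars disappear under conjugation, so a projective representation gives an honest action on
the product of endomorphism algebras. -/
theorem exists_piConj (hρ : ∀ g h x y z (hx : h • x = y) (hy : g • y = z) (u : U x),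
      ρ g y z hy (ρ h x y hx u) =
        (Θ g h x : K) • ρ (g * h) x z (by rw [mul_smul, hx, hy]) u) :
    ∃ α : G →* ((∀ x, Module.End K (U x)) ≃ₐ[K] (∀ x, Module.End K (U x))),
      ∀ g x y h b u, ρ g x y h (b x u) = α g b y (ρ g x y h u) := by
  have h1 : piConj ρ 1 = AlgHom.id K _ := by
    refine AlgHom.ext fun b => funext fun x => LinearMap.ext fun u => ?_
    obtain ⟨u, rfl⟩ := (ρ 1 x x (one_smul _ _)).surjective u
    rw [piConj_apply_apply]
    have h2 : ∀ u, ρ 1 x x (one_smul _ _) u = (Θ 1 1 x : K) • u := fun u => by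
      apply (ρ 1 x x (one_smul _ _)).injective
      rw [hρ 1 1 x x x, map_smul]
      simp only [one_mul]
    rw [h2, h2, AlgHom.id_apply, map_smul]
  have h2 : ∀ g h, piConj ρ (g * h) = (piConj ρ g).comp (piConj ρ h) := fun g h => by
    refine AlgHom.ext fun b => funext fun z => LinearMap.ext fun u => ?_
    obtain ⟨y, rfl⟩ := MulAction.surjective g z
    obtain ⟨x, rfl⟩ := MulAction.surjective h y
    obtain ⟨u, rfl⟩ := (ρ (g * h) x _ (mul_smul g h x)).surjective u
    rw [piConj_apply_apply]
    have h3 : ∀ u, ρ (g * h) x _ (mul_smul g h x) u =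
        ((Θ g h x)⁻¹ : Kˣ) • ρ g _ _ rfl (ρ h x _ rfl u) := fun u => by
      rw [hρ g h x _ _ rfl rfl, ← Units.smul_def, inv_smul_smul]
    rw [h3, h3, AlgHom.comp_apply, Units.smul_def, Units.smul_def, map_smul, piConj_apply_apply,
      piConj_apply_apply]
  refine ⟨MonoidHom.mk' (fun g => AlgEquiv.ofAlgHom (piConj ρ g) (piConj ρ g⁻¹)
    (by rw [← h2, mul_inv_cancel, h1]) (by rw [← h2, inv_mul_cancel, h1])) fun g h => ?_,
    fun g x y h b u => (piConj_apply_apply ρ g x y h b u).symm⟩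
  exact AlgEquiv.ext fun b => DFunLike.congr_fun (h2 g h) b

end

variable [Finite G]

/-- This is the twisted regular representation: the fibre at x is spanned by the arrows σ_s ending
at x, one for each s in `G`, and σ_g acts by composition. Finiteness of `G` makes the fibres
finite-dimensional. -/
theorem exists_projective_representation {X : Type u} [MulAction G X] {Θ : G → G → X → Kˣ}
    (hΘ : IsActionCocycle Θ) : ∃ (n : ℕ) (_ : NeZero n)
      (ρ : ∀ (g : G) (x y : X), g • x = y → ((Fin n → K) ≃ₗ[K] (Fin n → K))),
      ∀ g h x y z (hx : h • x = y) (hy : g • y = z) (u : Fin n → K),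
      ρ g y z hy (ρ h x y hx u) =
        (Θ g h x : K) • ρ (g * h) x z (by rw [mul_smul, hx, hy]) u := by
  let s := Finite.equivFin G
  refine ⟨Nat.card G, ⟨Nat.card_pos.ne'⟩, fun g x y _ =>
    -- From σ_g σ_s' = Θ(g, s') σ_gs' with s = gs': the arrow s' = g⁻¹s has source s'⁻¹x = s⁻¹y,
    -- which is the point at which `Θ` is evaluated.
    { toFun := fun φ i => (Θ g (g⁻¹ * s.symm i) ((s.symm i)⁻¹ • y) : K) * φ (s (g⁻¹ * s.symm i))
      invFun := fun φ i => ((Θ g (s.symm i) ((s.symm i)⁻¹ • x))⁻¹ : Kˣ) * φ (s (g * s.symm i))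
      map_add' := fun φ ψ => funext fun i => mul_add _ _ _
      map_smul' := fun c φ => funext fun i => mul_left_comm _ _ _
      left_inv := fun φ => funext fun i => ?_
      right_inv := fun φ => funext fun i => ?_ }, fun g h x y z hx hy u => funext fun i => ?_⟩
  · subst y
    simp [mul_smul]
  · subst y
    simp [mul_smul]
  · subst hx hy
    have := hΘ g h (h⁻¹ * g⁻¹ * s.symm i) ((s.symm i)⁻¹ • g • h • x)
    simp only [mul_smul, mul_assoc, mul_inv_rev, mul_inv_cancel_left, smul_inv_smul, inv_smul_smul, LinearEquiv.coe_mk,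
      LinearMap.coe_mk, AddHom.coe_mk, Equiv.symm_apply_apply, inv_inv, Pi.smul_apply,
      smul_eq_mul] at this ⊢
    rw [← mul_assoc (Θ g h x : K), ← Units.val_mul, this]
    push_cast
    ring

theorem _root_.DecoratedSet.exists_hasIrr (X : DecoratedSet G K) :
    ∃ A : SplitGAlgebra G K, A.HasIrr X := by
  obtain ⟨Θ, hΘ, hX⟩ := X.exists_hasClass
  obtain ⟨n, _, ρ, hρ⟩ := exists_projective_representation hΘ
  obtain ⟨α, hα⟩ := exists_piConj (U := fun _ => Fin n → K) ρ hρ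
  exact ⟨_, hasIrr_ofAlgEquivPiEnd (U := fun _ => Fin n → K) α AlgEquiv.refl hX ρ hα hρ⟩

end SplitGAlgebra

/-! ### Twisted modules as vector spaces with operators -/

namespace TwistedModule

open scoped TensorProduct

variable {K : Type u} [Field K] {H : Type v} [Group H] {A : Type u} [Ring A] [Algebra K A]
  {α : H →* (A ≃ₐ[K] A)} {θ : cocycle K H}

/-- The vector space underlying a twisted module. -/
def carrier (M : TwistedModule α θ) : Type u := M.V

instance (M : TwistedModule α θ) : AddCommGroup M.carrier := inferInstanceAs (AddCommGroup M.V)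

instance (M : TwistedModule α θ) : Module K M.carrier := inferInstanceAs (Module K M.V)

instance (M : TwistedModule α θ) : Module.Finite K M.carrier :=
  inferInstanceAs (Module.Finite K M.V)

/-- The action of the algebra on the underlying vector space. -/
def actEnd (M : TwistedModule α θ) : A →ₐ[K] Module.End K M.carrier where
  toFun a := (M.act a).hom.hom
  map_one' := by rw [map_one]; rfl
  map_mul' a b := by rw [map_mul]; rfl
  map_zero' := by rw [map_zero]; rfl
  map_add' a b := by rw [map_add]; rfl
  commutes' c := by rw [AlgHom.commutes]; rfl

/-- The operators of the group on the underlying vector space. -/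
def op (M : TwistedModule α θ) (h : H) : Module.End K M.carrier := (M.ρ h).hom.hom

theorem op_op (M : TwistedModule α θ) (g h : H) (m : M.carrier) :
    M.op g (M.op h m) = (θ.1 g h : K) • M.op (g * h) m :=
  congrArg (fun f : End M.V => f.hom.hom m) (M.ρ_mul g h)

theorem op_one (M : TwistedModule α θ) (m : M.carrier) : M.op 1 m = (θ.1 1 1 : K) • m :=
  congrArg (fun f : End M.V => f.hom.hom m) M.ρ_one

theorem op_actEnd (M : TwistedModule α θ) (h : H) (a : A) (m : M.carrier) :
    M.op h (M.actEnd a m) = M.actEnd (α h a) (M.op h m) :=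
  congrArg (fun f : End M.V => f.hom.hom m) (M.ρ_act h a)

/-- Twisted modules from vector spaces with operators. -/
def ofOp (V : Type u) [AddCommGroup V] [Module K V] [Module.Finite K V]
    (act : A →ₐ[K] Module.End K V) (op : H → Module.End K V)
    (h₁ : ∀ v, op 1 v = (θ.1 1 1 : K) • v)
    (h₂ : ∀ g h v, op g (op h v) = (θ.1 g h : K) • op (g * h) v)
    (h₃ : ∀ h a v, op h (act a v) = act (α h a) (op h v)) : TwistedModule α θ where
  V := FGModuleCat.of K V
  act :=
    { toFun := fun a => FGModuleCat.ofHom (act a)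
      map_one' := by rw [map_one]; rfl
      map_mul' := fun a b => by rw [map_mul]; rfl
      map_zero' := by rw [map_zero]; rfl
      map_add' := fun a b => by rw [map_add]; rfl
      commutes' := fun c => by rw [AlgHom.commutes]; rfl }
  ρ h := FGModuleCat.ofHom (op h)
  ρ_one := FGModuleCat.hom_ext (LinearMap.ext h₁)
  ρ_mul g h := FGModuleCat.hom_ext (LinearMap.ext (h₂ g h))
  ρ_act h a := FGModuleCat.hom_ext (LinearMap.ext (h₃ h a))

/-- The linear map underlying a morphism. -/
def lin {M N : TwistedModule α θ} (f : M ⟶ N) : M.carrier →ₗ[K] N.carrier := f.hom.hom.hom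

section

variable {M N P : TwistedModule α θ}

theorem lin_injective : Function.Injective (lin (M := M) (N := N)) := fun _ _ h =>
  hom_ext (FGModuleCat.hom_ext h)

theorem lin_actEnd (f : M ⟶ N) (a : A) (m : M.carrier) :
    lin f (M.actEnd a m) = N.actEnd a (lin f m) :=
  congrArg (fun f : M.V ⟶ N.V => f.hom.hom m) (f.comm_act a)

theorem lin_op (f : M ⟶ N) (h : H) (m : M.carrier) : lin f (M.op h m) = N.op h (lin f m) :=
  congrArg (fun f : M.V ⟶ N.V => f.hom.hom m) (f.comm_ρ h)

/-- Morphisms from linear maps. -/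
def homMk (f : M.carrier →ₗ[K] N.carrier) (h₁ : ∀ a m, f (M.actEnd a m) = N.actEnd a (f m))
    (h₂ : ∀ h m, f (M.op h m) = N.op h (f m)) : M ⟶ N where
  hom := InducedCategory.homMk (ModuleCat.ofHom f)
  comm_act a := FGModuleCat.hom_ext (LinearMap.ext (h₁ a))
  comm_ρ h := FGModuleCat.hom_ext (LinearMap.ext (h₂ h))

/-- Isomorphisms from linear isomorphisms. -/
def isoOfEquiv (e : M.carrier ≃ₗ[K] N.carrier)
    (h₁ : ∀ a m, e (M.actEnd a m) = N.actEnd a (e m))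
    (h₂ : ∀ h m, e (M.op h m) = N.op h (e m)) : M ≅ N where
  hom := homMk e.toLinearMap h₁ h₂
  inv := homMk e.symm.toLinearMap
    (fun a n => by
      rw [LinearEquiv.coe_coe, LinearEquiv.symm_apply_eq, h₁, e.apply_symm_apply])
    (fun a n => by
      rw [LinearEquiv.coe_coe, LinearEquiv.symm_apply_eq, h₂, e.apply_symm_apply])
  hom_inv_id := lin_injective (LinearMap.ext e.symm_apply_apply)
  inv_hom_id := lin_injective (LinearMap.ext e.apply_symm_apply)

theorem actEnd_algebraMap (c : K) (m : M.carrier) : M.actEnd (algebraMap K A c) m = c • m := by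
  rw [AlgHom.commutes]; rfl

end

/-! ### Tensor products -/

section Tensor

variable {G : Type v} [Group G] (φ : H →* G) (M N : TwistedModule α θ) (W W' : FDRep K G)

/-- The space underlying `M ⊠ W`. -/
def tensorEquiv : (M.tensor φ W).carrier ≃ₗ[K] M.carrier ⊗[K] W := LinearEquiv.refl K _

variable {M W}

theorem lin_tensor_ext {f g : M.tensor φ W ⟶ N}
    (h : ∀ m w, lin f ((tensorEquiv φ M W).symm (m ⊗ₜ w)) =
      lin g ((tensorEquiv φ M W).symm (m ⊗ₜ w))) : f = g := by
  refine lin_injective ?_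
  have : (lin f ∘ₗ (tensorEquiv φ M W).symm.toLinearMap) =
      lin g ∘ₗ (tensorEquiv φ M W).symm.toLinearMap :=
    TensorProduct.ext' h
  exact this

theorem lin_tensor_ext₃ {f g : M.tensor φ (W ⊗ W') ⟶ N}
    (h : ∀ m w w', lin f ((tensorEquiv φ M (W ⊗ W')).symm (m ⊗ₜ (w ⊗ₜ w' : W ⊗[K] W'))) =
      lin g ((tensorEquiv φ M (W ⊗ W')).symm (m ⊗ₜ (w ⊗ₜ w' : W ⊗[K] W')))) : f = g := by
  refine lin_tensor_ext φ N fun m (x : W ⊗[K] W') => ?_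
  have : lin f ∘ₗ (tensorEquiv φ M (W ⊗ W')).symm.toLinearMap ∘ₗ
        TensorProduct.mk K M.carrier (W ⊗[K] W') m =
      lin g ∘ₗ (tensorEquiv φ M (W ⊗ W')).symm.toLinearMap ∘ₗ
        TensorProduct.mk K M.carrier (W ⊗[K] W') m := TensorProduct.ext' (h m)
  exact DFunLike.congr_fun this x

end Tensor

end TwistedModule

namespace TwistedModule

variable {K : Type u} [Field K] {H : Type v} [Group H] {A : Type u} [Ring A] [Algebra K A]
  {α : H →* (A ≃ₐ[K] A)} {θ : cocycle K H}

/-- The priority is low because for `A = K` this overlaps with the vector space structure. -/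
instance (priority := low) (M : TwistedModule α θ) : Module A M.carrier :=
  Module.compHom M.carrier (M.actEnd : A →+* Module.End K M.carrier)

theorem smul_eq_actEnd (M : TwistedModule α θ) (a : A) (m : M.carrier) :
    a • m = M.actEnd a m := rfl

instance (priority := low) (M : TwistedModule α θ) : IsScalarTower K A M.carrier where
  smul_assoc c a m := by
    rw [smul_eq_actEnd, map_smul, LinearMap.smul_apply, smul_eq_actEnd]

theorem op_smul (M : TwistedModule α θ) (h : H) (a : A) (m : M.carrier) :
    M.op h (a • m) = α h a • M.op h m := M.op_actEnd h a m

/-- A morphism as a linear map over the algebra. -/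
def linA {M N : TwistedModule α θ} (f : M ⟶ N) : M.carrier →ₗ[A] N.carrier :=
  { lin f with map_smul' := lin_actEnd f }

theorem op_op_of_one (M : TwistedModule α (1 : cocycle K H)) (g h : H) (m : M.carrier) :
    M.op g (M.op h m) = M.op (g * h) m :=
  (M.op_op g h m).trans (one_smul K _)

theorem op_one_of_one (M : TwistedModule α (1 : cocycle K H)) (m : M.carrier) : M.op 1 m = m :=
  (M.op_one m).trans (one_smul K _)

theorem op_inv_op (M : TwistedModule α (1 : cocycle K H)) (g : H) (m : M.carrier) :
    M.op g⁻¹ (M.op g m) = m := by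
  rw [op_op_of_one, inv_mul_cancel, op_one_of_one]

end TwistedModule

instance finite_linearMap_of_algebra {K A N V : Type*} [Field K] [Ring A] [Algebra K A]
    [AddCommGroup N] [Module K N] [Module A N] [IsScalarTower K A N] [AddCommGroup V] [Module K V]
    [Module A V] [IsScalarTower K A V] [Module.Finite K N] [Module.Finite K V] :
    Module.Finite K (N →ₗ[A] V) :=
  Module.Finite.of_injective (LinearMap.restrictScalarsₗ K A N V K)
    (LinearMap.restrictScalars_injective K)

/-! ### Multiplicity spaces Hom_A(N, V) as projective representations -/

namespace SplitGAlgebra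

open scoped TensorProduct

variable {G : Type v} {K : Type u} [Group G] [Field K] {A : SplitGAlgebra G K}
  {N N' N'' : ModuleCat.{u} A.A} (V V' : TwistedModule A.α (1 : cocycle K G))

/-- Conjugation of homomorphisms by semilinear maps. -/
def homConj {g : G} {σ : N ≃ₗ[K] N'} (hσ : A.IsSemilinear g σ) :
    (N →ₗ[A.A] V.carrier) →ₗ[K] (N' →ₗ[A.A] V.carrier) where
  toFun f :=
    { toFun := fun n => V.op g (f (σ.symm n))
      map_add' := fun a b => by rw [map_add, map_add, map_add]
      map_smul' := fun a n => by
        rw [hσ.symm, map_smul, V.op_smul, ← AlgEquiv.mul_apply, ← map_mul, mul_inv_cancel, map_one]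
        rfl }
  map_add' f f' := LinearMap.ext fun n => map_add (V.op g) _ _
  map_smul' c f := LinearMap.ext fun n => map_smul (V.op g) _ _

theorem homConj_apply {g : G} {σ : N ≃ₗ[K] N'} (hσ : A.IsSemilinear g σ) (f : N →ₗ[A.A] V.carrier)
    (n : N') : homConj V hσ f n = V.op g (f (σ.symm n)) := rfl

theorem homConj_apply_apply {g : G} {σ : N ≃ₗ[K] N'} (hσ : A.IsSemilinear g σ)
    (f : N →ₗ[A.A] V.carrier) (n : N) : homConj V hσ f (σ n) = V.op g (f n) := by
  rw [homConj_apply, LinearEquiv.symm_apply_apply]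

theorem homConj_symm_homConj {g : G} {σ : N ≃ₗ[K] N'} (hσ : A.IsSemilinear g σ)
    (f : N →ₗ[A.A] V.carrier) : homConj V hσ.symm (homConj V hσ f) = f := by
  refine LinearMap.ext fun n => ?_
  rw [homConj_apply, homConj_apply, V.op_inv_op]
  exact congrArg f (σ.symm_apply_apply n)

theorem homConj_homConj_symm {g : G} {σ : N ≃ₗ[K] N'} (hσ : A.IsSemilinear g σ)
    (f : N' →ₗ[A.A] V.carrier) : homConj V hσ (homConj V hσ.symm f) = f := by
  refine LinearMap.ext fun n => ?_
  rw [homConj_apply, homConj_apply, V.op_op_of_one, mul_inv_cancel, V.op_one_of_one]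
  exact congrArg f (σ.apply_symm_apply n)

/-- Conjugation uses the inverse of the operators on N while those on V are multiplicative. A
cocycle on N thus becomes its inverse on Hom_A(N, V). -/
theorem homConj_homConj {g h : G} {σ : N ≃ₗ[K] N'} {τ : N' ≃ₗ[K] N''} {κ : N ≃ₗ[K] N''}
    (hσ : A.IsSemilinear h σ) (hτ : A.IsSemilinear g τ) (hκ : A.IsSemilinear (g * h) κ) (c : Kˣ)
    (hc : ∀ n, τ (σ n) = ((c⁻¹ : Kˣ) : K) • κ n) (f : N →ₗ[A.A] V.carrier) :
    homConj V hτ (homConj V hσ f) = (c : K) • homConj V hκ f := by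
  refine LinearMap.ext fun n => ?_
  obtain ⟨m, rfl⟩ := (σ.trans τ).surjective n
  rw [LinearEquiv.trans_apply, homConj_apply_apply, homConj_apply_apply, LinearMap.smul_apply, hc,
    LinearMap.map_smul_of_tower, homConj_apply_apply, smul_smul, ← Units.val_mul, mul_inv_cancel,
    Units.val_one, one_smul, V.op_op_of_one]

theorem homConj_eq_smul {σ : N ≃ₗ[K] N} (hσ : A.IsSemilinear 1 σ) (c : K)
    (hc : ∀ n, n = c • σ n) (f : N →ₗ[A.A] V.carrier) :
    homConj V hσ f = c • f := by
  refine LinearMap.ext fun n => ?_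
  rw [homConj_apply, hc (σ.symm n), σ.apply_symm_apply, LinearMap.map_smul_of_tower, map_smul,
    V.op_one_of_one]
  rfl

section

variable {H : Subgroup G} {θ : cocycle K H} [Module.Finite K N] {r : H → (N ≃ₗ[K] N)}
  (hr : ∀ h : H, A.IsSemilinear (h : G) (r h))
  (hr' : ∀ (g h : H) n, r g (r h n) = (((θ.1 g h)⁻¹ : Kˣ) : K) • r (g * h) n)

/-- The functor `V ↦ Hom_A(N, V)` from `A * G`-modules to projective representations of a subgroup
acting projectively on `N`. -/
def homFunctor : TwistedModule A.α (1 : cocycle K G) ⥤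
    TwistedModule (1 : H →* (K ≃ₐ[K] K)) θ where
  obj V := TwistedModule.ofOp (N →ₗ[A.A] V.carrier) (Algebra.ofId K _) (fun h => homConj V (hr h))
    (fun f => homConj_eq_smul V (hr 1) _ (fun n => by
      obtain ⟨m, rfl⟩ := (r 1).surjective n
      rw [hr' 1 1, mul_one, smul_smul, ← Units.val_mul, mul_inv_cancel, Units.val_one, one_smul]) f)
    (fun g h f => homConj_homConj V (hr h) (hr g) (hr (g * h)) _ (hr' g h) f)
    (fun h c f => map_smul (homConj V (hr h)) c f)
  map F := TwistedModule.homMk (postcomp K N (TwistedModule.linA F))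
    (fun c f => map_smul (postcomp K N (TwistedModule.linA F)) c f)
    (fun h f => LinearMap.ext fun n => TwistedModule.lin_op F _ _)
  map_id V := rfl
  map_comp F F' := rfl

/-- The linear isomorphism `Hom_A(N, V) ⊠ W ≃ Hom_A(N, V ⊠ W)`. -/
def homFunctorTensorEquiv (W : FDRep K G) :
    (((homFunctor hr hr').obj V).tensor H.subtype W).carrier ≃ₗ[K]
      ((homFunctor hr hr').obj (V.tensor (MonoidHom.id G) W)).carrier :=
  homTensorEquiv K A.A N V.carrier W

/-- `Hom_A(N, V) ⊠ W ≃ Hom_A(N, V ⊠ W)`. -/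
def homFunctorTensorIso (W : FDRep K G) :
    ((homFunctor hr hr').obj V).tensor H.subtype W ≅
      (homFunctor hr hr').obj (V.tensor (MonoidHom.id G) W) :=
  TwistedModule.isoOfEquiv (homFunctorTensorEquiv V hr hr' W)
    (fun c x => by
      refine (congrArg _ (TwistedModule.actEnd_algebraMap c x)).trans ?_
      refine (map_smul (homFunctorTensorEquiv V hr hr' W) c x).trans ?_
      exact (TwistedModule.actEnd_algebraMap c _).symm)
    (fun h x => by
      let op₁ := (((homFunctor hr hr').obj V).tensor H.subtype W).op h
      let op₂ := ((homFunctor hr hr').obj (V.tensor (MonoidHom.id G) W)).op h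
      have : (homFunctorTensorEquiv V hr hr' W).toLinearMap ∘ₗ op₁ ∘ₗ
          (TwistedModule.tensorEquiv H.subtype ((homFunctor hr hr').obj V) W).symm.toLinearMap =
          op₂ ∘ₗ (homFunctorTensorEquiv V hr hr' W).toLinearMap ∘ₗ
            (TwistedModule.tensorEquiv H.subtype
              ((homFunctor hr hr').obj V) W).symm.toLinearMap := by
        refine TensorProduct.ext' fun f w => ?_
        refine LinearMap.ext fun n => ?_
        rfl
      exact DFunLike.congr_fun this x)

/-- The structure map is f ⊗ w ↦ (n ↦ f(n) ⊗ w). On pure tensors every axiom holds by definition. -/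
theorem nonempty_rightLinear_homFunctor :
    letI := TwistedModule.rightAction (α := A.α) (θ := (1 : cocycle K G)) (MonoidHom.id G)
    letI := TwistedModule.rightAction (α := (1 : H →* (K ≃ₐ[K] K))) (θ := θ) H.subtype
    Nonempty ((homFunctor hr hr').RightLinear (FDRep K G)) := by
  let _ := TwistedModule.rightAction (α := A.α) (θ := (1 : cocycle K G)) (MonoidHom.id G)
  let _ := TwistedModule.rightAction (α := (1 : H →* (K ≃ₐ[K] K))) (θ := θ) H.subtype
  refine ⟨rightLinearOfIso _ (fun V W => homFunctorTensorIso V hr hr' W) ?_ ?_ ?_ ?_⟩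
  · intro V W W' f
    refine TwistedModule.lin_tensor_ext H.subtype _ fun m w => ?_
    rfl
  · intro V V' f W
    refine TwistedModule.lin_tensor_ext H.subtype _ fun m w => ?_
    rfl
  · intro V W W'
    refine TwistedModule.lin_tensor_ext₃ H.subtype _ _ fun m w w' => ?_
    rfl
  · intro V
    refine TwistedModule.lin_tensor_ext H.subtype _ fun m c => ?_
    refine LinearMap.ext fun n => ?_
    rfl

end

end SplitGAlgebra

/-! ### Families of module functors -/

section PiFunctor

open MonoidalRightAction Functor.LaxRightLinear

variable {T : Type*} [Category* T] [MonoidalCategory T] {C : Type*} [Category.{u} C]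
  [MonoidalRightAction T C] {I : Type u} {D : I → Type v} [∀ i, Category.{u} (D i)]
  [∀ i, MonoidalRightAction T (D i)]

@[reducible]
def rightLinearPi (F : ∀ i, C ⥤ D i) [∀ i, (F i).RightLinear T] :
    (Functor.pi' F).RightLinear T :=
  rightLinearOfIso _ (fun d c => Pi.isoMk fun i => Functor.RightLinear.μᵣIso (F i) d c)
    (fun d _ _ f => funext fun i => μᵣ_naturality_right (F i) d f)
    (fun f c => funext fun i => μᵣ_naturality_left (F i) f c)
    (fun d c c' => funext fun i => μᵣ_associativity (F i) d c c')
    (fun d => funext fun i => μᵣ_unitality (F i) d)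

end PiFunctor

namespace IsIrrFamily

open scoped TensorProduct

variable {K : Type*} [Field K] {A : Type*} [Ring A] [Algebra K A] {ι : Type u} [Finite ι]
  {M : ι → Type u} [∀ i, AddCommGroup (M i)] [∀ i, Module K (M i)] [∀ i, Module A (M i)]
  [∀ i, IsScalarTower K A (M i)] (hM : IsIrrFamily K A M)
  {V : Type u} [AddCommGroup V] [Module K V] [Module A V] [IsScalarTower K A V]

-- A module is additively generated by the images of homomorphisms from the simple modules of the
-- family.
include hM in
theorem induction {P : V → Prop} (zero : P 0) (add : ∀ v w, P v → P w → P (v + w))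
    (apply : ∀ i (f : M i →ₗ[A] V) m, P (f m)) (v : V) : P v := by
  classical
  have := Fintype.ofFinite ι
  obtain ⟨x, rfl⟩ := hM.eval_bijective.2 v
  have h : ∀ i (y : M i ⊗[K] (M i →ₗ[A] V)), P (eval K A M V (Pi.single i y)) := fun i y => by
    induction y with
    | zero => rwa [Pi.single_zero, map_zero]
    | add y z hy hz => rw [Pi.single_add, map_add]; exact add _ _ hy hz
    | tmul m f => rw [eval_single]; exact apply i f m
  rw [← Finset.univ_sum_single x, map_sum]
  exact Finset.sum_induction _ P add zero fun i _ => h i _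

end IsIrrFamily

/-! ### Multiplicity spaces at orbit representatives: full faithfulness -/

namespace SplitGAlgebra

open scoped TensorProduct

variable {G : Type v} {K : Type u} [Group G] [Field K] {A : SplitGAlgebra G K}
  {I : Type u} {Y : I → Type u} [∀ i, MulAction G (Y i)] {p : ∀ i, Y i}
  {H : I → Subgroup G} {θ : ∀ i, cocycle K (H i)}
  {M : ∀ i, Y i → ModuleCat.{u} A.A}
  {r : ∀ i, H i → (M i (p i) ≃ₗ[K] M i (p i))}
  (hr : ∀ i (h : H i), A.IsSemilinear (h : G) (r i h))
  (hr' : ∀ i (g h : H i) n, r i g (r i h n) = ((((θ i).1 g h)⁻¹ : Kˣ) : K) • r i (g * h) n)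
  [∀ i, Module.Finite K (M i (p i))]

/-- The functor `V ↦ (Hom_A(M i, V))ᵢ` from `A * G`-modules to families of projective
representations. -/
def homFunctorPi : TwistedModule A.α (1 : cocycle K G) ⥤
    ∀ i, TwistedModule (1 : H i →* (K ≃ₐ[K] K)) (θ i) :=
  Functor.pi' fun i => homFunctor (hr i) (hr' i)

instance instAdditiveHomFunctorPi : (homFunctorPi hr hr').Additive where
  map_add := rfl

instance instLinearHomFunctorPi : (homFunctorPi hr hr').Linear K where
  map_smul _ _ := rfl

section Transport

variable {t : ∀ i, Y i → G} (ht : ∀ i y, t i y • p i = y) (ht' : ∀ i, t i (p i) = 1)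
  (hH : ∀ i g, g ∈ H i ↔ g • p i = p i)

/-- The element of the stabiliser of the base point corresponding to an arrow `y ⟶ z` of the action
groupoid. -/
def loop (i : I) (g : G) (y z : Y i) (h : g • y = z) : H i :=
  ⟨(t i z)⁻¹ * g * t i y, by
    rw [hH, mul_smul, mul_smul, ht, h, inv_smul_eq_iff, ht]⟩

theorem loop_mul (i : I) (g h : G) (x y z : Y i) (hx : h • x = y) (hy : g • y = z) :
    loop ht hH i g y z hy * loop ht hH i h x y hx =
      loop ht hH i (g * h) x z (by rw [mul_smul, hx, hy]) := by
  refine Subtype.ext ?_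
  change (t i z)⁻¹ * g * t i y * ((t i y)⁻¹ * h * t i x) = (t i z)⁻¹ * (g * h) * t i x
  group

include ht' in
theorem loop_base (i : I) (h : H i) :
    loop ht hH i h (p i) (p i) ((hH i h).1 h.2) = h := by
  refine Subtype.ext ?_
  change (t i (p i))⁻¹ * (h : G) * t i (p i) = h
  rw [ht', inv_one, one_mul, mul_one]

variable {τ : ∀ i y, M i (p i) ≃ₗ[K] M i y} (hτ : ∀ i y, A.IsSemilinear (t i y) (τ i y))
  (hτ' : ∀ i m, τ i (p i) m = m)

variable (r τ) in
/-- Semilinear maps between all modules of an orbit from those at the base point. -/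
def transportMap (i : I) (g : G) (y z : Y i) (h : g • y = z) : M i y ≃ₗ[K] M i z :=
  ((τ i y).symm.trans (r i (loop ht hH i g y z h))).trans (τ i z)

omit [∀ i, Module.Finite K (M i (p i))] in
include hr hτ in
theorem isSemilinear_transportMap (i : I) (g : G) (y z : Y i) (h : g • y = z) :
    A.IsSemilinear g (transportMap r ht hH τ i g y z h) := by
  have := ((hτ i y).symm.trans (hr i (loop ht hH i g y z h))).trans (hτ i z)
  rwa [show t i z * ((loop ht hH i g y z h : G) * (t i y)⁻¹) = g by
    change t i z * ((t i z)⁻¹ * g * t i y * (t i y)⁻¹) = g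
    group] at this

omit [∀ i, Module.Finite K (M i (p i))] in
include hr' in
theorem transportMap_transportMap (i : I) (g h : G) (x y z : Y i) (hx : h • x = y) (hy : g • y = z)
    (m : M i x) :
    transportMap r ht hH τ i g y z hy (transportMap r ht hH τ i h x y hx m) =
      ((((θ i).1 (loop ht hH i g y z hy) (loop ht hH i h x y hx))⁻¹ : Kˣ) : K) •
        transportMap r ht hH τ i (g * h) x z (by rw [mul_smul, hx, hy]) m := by
  simp only [transportMap, LinearEquiv.trans_apply, LinearEquiv.symm_apply_apply]
  rw [hr', loop_mul, map_smul]

omit [∀ i, Module.Finite K (M i (p i))] in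
include ht' hτ' in
theorem transportMap_base (i : I) (h : H i) (m : M i (p i)) :
    transportMap r ht hH τ i h (p i) (p i) ((hH i h).1 h.2) m = r i h m := by
  have : (τ i (p i)).symm m = m := by rw [LinearEquiv.symm_apply_eq, hτ']
  simp only [transportMap, LinearEquiv.trans_apply]
  rw [loop_base ht ht', hτ', this]

-- After all multiplicity spaces of an orbit are identified with the one at the base point through
-- τ, an arrow acts as its loop.
omit [∀ i, Module.Finite K (M i (p i))] in
theorem homConj_transportMap (V : TwistedModule A.α (1 : cocycle K G)) (i : I) (g : G) (y z : Y i)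
    (h : g • y = z) (f : M i y →ₗ[A.A] V.carrier) :
    homConj V (hτ i z).symm (homConj V (isSemilinear_transportMap hr ht hH hτ i g y z h) f) =
      homConj V (hr i (loop ht hH i g y z h)) (homConj V (hτ i y).symm f) := by
  refine LinearMap.ext fun n => ?_
  rw [homConj_apply, homConj_apply, homConj_apply, homConj_apply, V.op_op_of_one, V.op_op_of_one,
    show (loop ht hH i g y z h : G) * (t i y)⁻¹ = (t i z)⁻¹ * g by
      change (t i z)⁻¹ * g * t i y * (t i y)⁻¹ = (t i z)⁻¹ * g
      group]
  simp [transportMap]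

variable [Finite I] [∀ i, Finite (Y i)]

-- An equivariant family at the base points extends over each orbit by conjugation with τ.
-- Semisimplicity turns the extended family into an `A`-linear map, which commutes with `G` because
-- the family commutes with all arrows and not only with loops.
include ht ht' hH hτ hτ' in
theorem full_homFunctorPi (hM : A.IsIrr fun z : Σ i, Y i => M z.1 z.2) :
    (homFunctorPi hr hr').Full := by
  classical
  refine ⟨fun {V V'} φ => ?_⟩
  let φ' : ∀ i, (M i (p i) →ₗ[A.A] V.carrier) →ₗ[K] (M i (p i) →ₗ[A.A] V'.carrier) := fun i =>
    TwistedModule.lin (φ i)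
  have hφ' : ∀ i h f, φ' i (homConj V (hr i h) f) = homConj V' (hr i h) (φ' i f) := fun i h f =>
    TwistedModule.lin_op (φ i) h f
  let Φ : ∀ z : Σ i, Y i, (M z.1 z.2 →ₗ[A.A] V.carrier) →ₗ[K] (M z.1 z.2 →ₗ[A.A] V'.carrier) :=
    fun z => homConj V' (hτ z.1 z.2) ∘ₗ φ' z.1 ∘ₗ homConj V (hτ z.1 z.2).symm
  have hΦ : ∀ i g y f, Φ ⟨i, g • y⟩
      (homConj V (isSemilinear_transportMap hr ht hH hτ i g y (g • y) rfl) f) =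
      homConj V' (isSemilinear_transportMap hr ht hH hτ i g y (g • y) rfl) (Φ ⟨i, y⟩ f) := by
    intro i g y f
    have h1 := homConj_transportMap hr ht hH hτ V i g y (g • y) rfl f
    have h2 := homConj_transportMap hr ht hH hτ V' i g y (g • y) rfl (Φ ⟨i, y⟩ f)
    change homConj V' (hτ i (g • y)) (φ' i (homConj V (hτ i (g • y)).symm _)) = _
    rw [h1, hφ']
    change _ = homConj V' (hr i _) (homConj V' (hτ i y).symm (homConj V' (hτ i y) _)) at h2
    rw [homConj_symm_homConj] at h2
    change homConj V' (hτ i (g • y)) (homConj V' (hr i _)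
      ((φ' i ∘ₗ homConj V (hτ i y).symm) f)) = _
    rw [← h2, homConj_homConj_symm]
  -- The extension agrees with the given family at the base point because `t` and τ are trivial
  -- there.
  have hbase : ∀ i f, Φ ⟨i, p i⟩ f = φ' i f := by
    intro i f
    have h1 : ∀ (W : TwistedModule A.α (1 : cocycle K G)) (f : M i (p i) →ₗ[A.A] W.carrier),
        homConj W (hτ i (p i)) f = f := fun W f => LinearMap.ext fun m => by
      conv_lhs => rw [← hτ' i m]
      rw [homConj_apply_apply, ht', W.op_one_of_one]
    have h2 : homConj V (hτ i (p i)).symm f = f := by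
      conv_lhs => rw [← h1 V f]
      rw [homConj_symm_homConj]
    change homConj V' (hτ i (p i)) (φ' i (homConj V (hτ i (p i)).symm f)) = _
    rw [h2, h1]
  have := Fintype.ofFinite (Σ i, Y i)
  obtain ⟨F, hF⟩ := hM.isIrrFamily.exists_hom (V := V.carrier) (V' := V'.carrier) Φ
  refine ⟨TwistedModule.homMk (F.restrictScalars K) (fun a m => F.map_smul a m) (fun g v => ?_), ?_⟩
  · refine hM.isIrrFamily.induction (P := fun v => F (V.op g v) = V'.op g (F v)) (by simp)
      (fun v w hv hw => by rw [map_add, map_add, map_add, map_add, hv, hw]) ?_ v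
    rintro ⟨i, y⟩ f m
    have h1 := DFunLike.congr_fun (hF ⟨i, g • y⟩
      (homConj V (isSemilinear_transportMap hr ht hH hτ i g y (g • y) rfl) f))
        (transportMap r ht hH τ i g y (g • y) rfl m)
    have h2 := DFunLike.congr_fun (hF ⟨i, y⟩ f) m
    rw [hΦ, homConj_apply_apply, LinearMap.comp_apply, homConj_apply_apply, ← h2] at h1
    exact h1
  · refine funext fun i => TwistedModule.lin_injective (LinearMap.ext fun f => ?_)
    exact (hF ⟨i, p i⟩ f).trans (hbase i f)

-- Each homomorphism from a simple module of the orbit is a conjugate of one from the base point, so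
-- by equivariance values at the base point determine a morphism.
omit [∀ i, MulAction G (Y i)] in
include hτ in
theorem faithful_homFunctorPi (hM : A.IsIrr fun z : Σ i, Y i => M z.1 z.2) :
    (homFunctorPi hr hr').Faithful := by
  refine ⟨fun {V V' F F'} h => TwistedModule.lin_injective (LinearMap.ext fun v => ?_)⟩
  have h' : ∀ i (f : M i (p i) →ₗ[A.A] V.carrier) m,
      TwistedModule.lin F (f m) = TwistedModule.lin F' (f m) := fun i f m => by
    have h1 : postcomp K (M i (p i)) (TwistedModule.linA F) f =
      postcomp K (M i (p i)) (TwistedModule.linA F') f :=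
      DFunLike.congr_fun (congrArg TwistedModule.lin (congrFun h i)) f
    exact DFunLike.congr_fun h1 m
  refine hM.isIrrFamily.induction (P := fun v => TwistedModule.lin F v = TwistedModule.lin F' v)
    (by simp) (fun v w hv hw => by rw [map_add, map_add, hv, hw]) ?_ v
  rintro ⟨i, y⟩ f m
  have := h' i (homConj V (hτ i y).symm f) ((τ i y).symm m)
  rw [homConj_apply_apply, TwistedModule.lin_op, TwistedModule.lin_op] at this
  have h2 := congrArg (V'.op (t i y)) this
  rwa [V'.op_op_of_one, V'.op_op_of_one, mul_inv_cancel, V'.op_one_of_one, V'.op_one_of_one] at h2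

end Transport

end SplitGAlgebra

/-! ### Induction from the stabilisers and essential surjectivity -/

namespace SplitGAlgebra

open scoped TensorProduct

variable {G : Type v} {K : Type u} [Group G] [Field K] {A : SplitGAlgebra G K}
  {I : Type u} {Y : I → Type u} [∀ i, MulAction G (Y i)] {p : ∀ i, Y i}
  {H : I → Subgroup G} {θ : ∀ i, cocycle K (H i)}
  {M : ∀ i, Y i → ModuleCat.{u} A.A}
  {r : ∀ i, H i → (M i (p i) ≃ₗ[K] M i (p i))}
  (hr : ∀ i (h : H i), A.IsSemilinear (h : G) (r i h))
  (hr' : ∀ i (g h : H i) n, r i g (r i h n) = ((((θ i).1 g h)⁻¹ : Kˣ) : K) • r i (g * h) n)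
  {t : ∀ i, Y i → G} (ht : ∀ i y, t i y • p i = y) (ht' : ∀ i, t i (p i) = 1)
  (hH : ∀ i g, g ∈ H i ↔ g • p i = p i)
  {τ : ∀ i y, M i (p i) ≃ₗ[K] M i y} (hτ : ∀ i y, A.IsSemilinear (t i y) (τ i y))
  (hτ' : ∀ i m, τ i (p i) m = m)
  (W : ∀ i, TwistedModule (1 : H i →* (K ≃ₐ[K] K)) (θ i))

section Induced

variable (r τ) in
/-- The operators of the group on the module induced from projective representations. -/
def inducedOp (g : G) :
    Module.End K (∀ z : Σ i, Y i, M z.1 z.2 ⊗[K] (W z.1).carrier) :=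
  LinearMap.pi fun z => TensorProduct.map
    (transportMap r ht hH τ z.1 g (g⁻¹ • z.2) z.2 (smul_inv_smul g z.2)).toLinearMap
    ((W z.1).op (loop ht hH z.1 g (g⁻¹ • z.2) z.2 (smul_inv_smul g z.2))) ∘ₗ
      LinearMap.proj (φ := fun z : Σ i, Y i => M z.1 z.2 ⊗[K] (W z.1).carrier) ⟨z.1, g⁻¹ • z.2⟩

theorem inducedOp_apply (g : G) (v : ∀ z : Σ i, Y i, M z.1 z.2 ⊗[K] (W z.1).carrier)
    (i : I) (y z : Y i) (h : g • y = z) :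
    inducedOp r ht hH τ W g v ⟨i, z⟩ =
      TensorProduct.map (transportMap r ht hH τ i g y z h).toLinearMap
        ((W i).op (loop ht hH i g y z h)) (v ⟨i, y⟩) := by
  obtain rfl : y = g⁻¹ • z := by rw [← h, inv_smul_smul]
  rfl

-- The transport maps on the simple modules have cocycle θ⁻¹ and the operators on `W` have cocycle
-- θ, so their tensor product is an honest representation.
include hr' in
theorem inducedOp_inducedOp (g h : G)
    (v : ∀ z : Σ i, Y i, M z.1 z.2 ⊗[K] (W z.1).carrier) :
    inducedOp r ht hH τ W g (inducedOp r ht hH τ W h v) = inducedOp r ht hH τ W (g * h) v := by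
  funext ⟨i, z⟩
  obtain ⟨y, rfl⟩ := MulAction.surjective g z
  obtain ⟨x, rfl⟩ := MulAction.surjective h y
  rw [inducedOp_apply ht hH W g _ i (h • x) _ rfl, inducedOp_apply ht hH W h _ i x _ rfl,
    inducedOp_apply ht hH W (g * h) _ i x _ (mul_smul g h x)]
  induction v ⟨i, x⟩ with
  | zero => simp
  | add a b ha hb => simp only [map_add, ha, hb]
  | tmul m u =>
    simp only [TensorProduct.map_tmul, LinearEquiv.coe_coe]
    rw [transportMap_transportMap hr' ht hH i g h x _ _ rfl rfl, TwistedModule.op_op, loop_mul,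
      TensorProduct.smul_tmul]
    exact congrArg (fun w => _ ⊗ₜ[K] w) (inv_smul_smul ((θ i).1 _ _) _)

include hr' in
theorem inducedOp_one (v : ∀ z : Σ i, Y i, M z.1 z.2 ⊗[K] (W z.1).carrier) :
    inducedOp r ht hH τ W 1 v = v := by
  have h1 : ∀ i m, r i 1 m = ((((θ i).1 1 1)⁻¹ : Kˣ) : K) • m := fun i m => by
    apply (r i 1).injective
    rw [hr', mul_one, map_smul]
  funext ⟨i, y⟩
  have h2 : loop ht hH i 1 y y (one_smul G y) = 1 := Subtype.ext (by
    change (t i y)⁻¹ * 1 * t i y = 1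
    group)
  rw [inducedOp_apply ht hH W 1 _ i y _ (one_smul G y)]
  induction v ⟨i, y⟩ with
  | zero => simp
  | add a b ha hb => simp only [map_add, ha, hb]
  | tmul m u =>
    simp only [TensorProduct.map_tmul, LinearEquiv.coe_coe, transportMap, LinearEquiv.trans_apply]
    rw [h2, h1, TwistedModule.op_one, map_smul, LinearEquiv.apply_symm_apply,
      TensorProduct.smul_tmul, smul_smul, ← Units.val_mul, inv_mul_cancel, Units.val_one, one_smul]

include hr hτ in
theorem inducedOp_smul (g : G) (a : A.A)
    (v : ∀ z : Σ i, Y i, M z.1 z.2 ⊗[K] (W z.1).carrier) :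
    inducedOp r ht hH τ W g (a • v) = A.α g a • inducedOp r ht hH τ W g v := by
  funext ⟨i, z⟩
  obtain ⟨y, rfl⟩ := MulAction.surjective g z
  rw [inducedOp_apply ht hH W g _ i y _ rfl, Pi.smul_apply, Pi.smul_apply,
    inducedOp_apply ht hH W g _ i y _ rfl]
  induction v ⟨i, y⟩ with
  | zero => simp
  | add a b ha hb => simp only [smul_add, map_add, ha, hb]
  | tmul m u =>
    rw [TensorProduct.smul_tmul', TensorProduct.map_tmul, TensorProduct.map_tmul,
      TensorProduct.smul_tmul', LinearEquiv.coe_coe,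
      isSemilinear_transportMap hr ht hH hτ i g y _ rfl]

theorem inducedOp_single [DecidableEq (Σ i, Y i)] (g : G) (i : I) (y z : Y i) (h : g • y = z)
    (m : M i y) (u : (W i).carrier) :
    inducedOp r ht hH τ W g (Pi.single ⟨i, y⟩ (m ⊗ₜ u)) =
      Pi.single (M := fun z : Σ i, Y i => M z.1 z.2 ⊗[K] (W z.1).carrier) ⟨i, z⟩
        (transportMap r ht hH τ i g y z h m ⊗ₜ (W i).op (loop ht hH i g y z h) u) := by
  subst h
  funext ⟨j, w⟩
  obtain ⟨x, rfl⟩ := MulAction.surjective g w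
  rw [inducedOp_apply ht hH W g _ j x _ rfl]
  by_cases hx : (⟨i, y⟩ : Σ i, Y i) = ⟨j, x⟩
  · cases hx
    rw [Pi.single_eq_same, Pi.single_eq_same]
    rfl
  · rw [Pi.single_eq_of_ne (Ne.symm hx), map_zero, Pi.single_eq_of_ne]
    intro h
    rw [Sigma.mk.injEq] at h
    obtain ⟨rfl, h⟩ := h
    exact hx (by rw [MulAction.injective g (eq_of_heq h)])

variable [Finite I] [∀ i, Finite (Y i)]

/-- The module induced from projective representations. -/
def induced [∀ z : Σ i, Y i, Module.Finite K (M z.1 z.2)] : TwistedModule A.α (1 : cocycle K G) :=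
  TwistedModule.ofOp (∀ z : Σ i, Y i, M z.1 z.2 ⊗[K] (W z.1).carrier) (Algebra.lsmul K K _)
    (inducedOp r ht hH τ W)
    (fun v => (inducedOp_one hr' ht hH W v).trans (one_smul K v).symm)
    (fun g h v => (inducedOp_inducedOp hr' ht hH W g h v).trans (one_smul K _).symm)
    (inducedOp_smul hr ht hH hτ W)

end Induced

variable [Finite I] [∀ i, Finite (Y i)] [∀ i, Module.Finite K (M i (p i))]

-- The multiplicity space of M_p in the induced module is `W` again, via u ↦ (m ↦ m ⊗ u). It is
-- equivariant because transport along a loop at the base point is the given operator `r`.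
include ht ht' hH hτ hτ' in
theorem essSurj_homFunctorPi (hM : A.IsIrr fun z : Σ i, Y i => M z.1 z.2) :
    (homFunctorPi hr hr').EssSurj := by
  classical
  have hfin := hM.isIrrFamily.finite
  refine ⟨fun W => ⟨induced hr hr' ht hH hτ W, ⟨Pi.isoMk fun i => ?_⟩⟩⟩
  choose e he using fun z : Σ i, Y i =>
    hM.isIrrFamily.exists_equiv_hom (fun z => (W z.1).carrier) z
  let e' : ((W i).carrier) ≃ₗ[K] (M i (p i) →ₗ[A.A] (induced hr hr' ht hH hτ W).carrier) :=
    e ⟨i, p i⟩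
  refine (TwistedModule.isoOfEquiv (M := W i)
    (N := (homFunctor (hr i) (hr' i)).obj (induced hr hr' ht hH hτ W)) e'
    (fun c u => ?_) (fun h u => LinearMap.ext fun m => ?_)).symm
  · refine (congrArg e' (TwistedModule.actEnd_algebraMap c u)).trans ?_
    exact (map_smul e' c u).trans (TwistedModule.actEnd_algebraMap (M := (homFunctor (hr i)
      (hr' i)).obj (induced hr hr' ht hH hτ W)) c (e' u)).symm
  · obtain ⟨m, rfl⟩ := (r i h).surjective m
    refine Eq.trans ?_ (homConj_apply_apply (induced hr hr' ht hH hτ W) (hr i h) (e' u) m).symm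
    refine (he ⟨i, p i⟩ ((W i).op h u) (r i h m)).trans ?_
    refine Eq.trans ?_ (congrArg (inducedOp r ht hH τ W h) (he ⟨i, p i⟩ u m).symm)
    rw [inducedOp_single ht hH W h i (p i) (p i) ((hH i h).1 h.2),
      transportMap_base ht ht' hH hτ', loop_base ht ht' hH]

end SplitGAlgebra

/-! ### The decomposition of A * G-Mod over orbits -/

namespace SplitGAlgebra

variable {G : Type v} {K : Type u} [Group G] [Field K] {A : SplitGAlgebra G K}

theorem skewMod_equivalent_directSum {I : Type u} {Y : I → Type u} [∀ i, MulAction G (Y i)]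
    {p : ∀ i, Y i} {H : I → Subgroup G} {θ : ∀ i, cocycle K (H i)}
    {M : ∀ i, Y i → ModuleCat.{u} A.A} [Finite I] [∀ i, Finite (Y i)]
    (hM : A.IsIrr fun z : Σ i, Y i => M z.1 z.2)
    (hH : ∀ i g, g ∈ H i ↔ g • p i = p i)
    (hτ : ∀ i y, ∃ (t : G) (τ : M i (p i) ≃ₗ[K] M i y), t • p i = y ∧ A.IsSemilinear t τ)
    {r : ∀ i, H i → (M i (p i) ≃ₗ[K] M i (p i))}
    (hr : ∀ i (h : H i), A.IsSemilinear (h : G) (r i h))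
    (hr' : ∀ i (g h : H i) n, r i g (r i h n) =
      ((((θ i).1 g h)⁻¹ : Kˣ) : K) • r i (g * h) n) :
    A.skewMod.Equivalent (ModuleCategory.directSum fun i => projMod (H i) (θ i)) := by
  classical
  -- The transporting elements are chosen again so as to be trivial at the base point; otherwise
  -- loops and operators there would be recovered only up to conjugation.
  have hτ' : ∀ i y, ∃ (t : G) (τ : M i (p i) ≃ₗ[K] M i y), t • p i = y ∧ A.IsSemilinear t τ ∧
      ∀ h : p i = y, t = 1 ∧ ∀ m, τ m = h ▸ m := fun i y => by
    by_cases h : p i = y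
    · subst h
      exact ⟨1, LinearEquiv.refl K _, one_smul _ _, IsSemilinear.refl, fun _ => ⟨rfl, fun m => rfl⟩⟩
    · obtain ⟨t, τ, h1, h2⟩ := hτ i y
      exact ⟨t, τ, h1, h2, fun h' => absurd h' h⟩
  choose t τ ht hτ hbase using hτ'
  have hfin := fun i => hM.isIrrFamily.finite ⟨i, p i⟩
  have ht' : ∀ i, t i (p i) = 1 := fun i => (hbase i (p i) rfl).1
  have hτ' : ∀ i m, τ i (p i) m = m := fun i => (hbase i (p i) rfl).2
  have h1 := full_homFunctorPi hr hr' ht ht' hH hτ hτ' hM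
  have h2 := faithful_homFunctorPi hr hr' hτ hM
  have h3 := essSurj_homFunctorPi hr hr' ht ht' hH hτ hτ' hM
  have h4 : (homFunctorPi hr hr').IsEquivalence := { }
  let _ := TwistedModule.rightAction (α := A.α) (θ := (1 : cocycle K G)) (MonoidHom.id G)
  let _ : ∀ i, MonoidalRightAction (FDRep K G) (TwistedModule (1 : H i →* (K ≃ₐ[K] K)) (θ i)) :=
    fun i => TwistedModule.rightAction (H i).subtype
  let inst : ∀ i, (homFunctor (hr i) (hr' i)).RightLinear (FDRep K G) :=
    fun i => (nonempty_rightLinear_homFunctor (hr i) (hr' i)).some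
  exact ⟨homFunctorPi hr hr', h4, instAdditiveHomFunctorPi hr hr', instLinearHomFunctorPi hr hr',
    ⟨@rightLinearPi _ _ _ _ _ _ _ _ _ _ (fun i => homFunctor (hr i) (hr' i)) inst⟩⟩

/-- `A * G-Mod` is the direct sum, over representatives of the orbits in `Irr(A)`, of categories of
projective representations. -/
theorem HasIrr.skewMod_equivalent {X : DecoratedSet G K} (h : A.HasIrr X) {I : Type u} [Finite I]
    (p : I → X.X) (hp : ∀ x, ∃ i, x ∈ MulAction.orbit G (p i))
    (hp' : ∀ i j, p i ∈ MulAction.orbit G (p j) → i = j)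
    (θ : ∀ i, cocycle K (MulAction.stabilizer G (p i)))
    (hθ : ∀ i, SchurMul.mk (θ i) = (X.frill (p i))⁻¹) :
    A.skewMod.Equivalent (ModuleCategory.directSum fun i =>
      projMod (MulAction.stabilizer G (p i)) (θ i)) := by
  obtain ⟨M, h1, h2, h3, h4, h5⟩ := h
  have hM : A.IsIrr fun z : Σ i, MulAction.orbit G (p i) => M z.2 := by
    refine ⟨fun z => h1 _, fun z w e => ?_, fun N hN => ?_⟩
    · obtain ⟨i, z, hz⟩ := z
      obtain ⟨j, w, hw⟩ := w
      obtain rfl : z = w := h2 _ _ e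
      obtain rfl : i = j := hp' i j ((MulAction.orbit_eq_iff.2 hz).symm.trans
        (MulAction.orbit_eq_iff.2 hw) ▸ MulAction.mem_orbit_self _)
      rfl
    · obtain ⟨x, e⟩ := h3 N hN
      obtain ⟨i, hi⟩ := hp x
      exact ⟨⟨i, x, hi⟩, e⟩
  have hr : ∀ i, ∃ r : MulAction.stabilizer G (p i) → (M (p i) ≃ₗ[K] M (p i)),
      (∀ h : MulAction.stabilizer G (p i), A.IsSemilinear (h : G) (r h)) ∧ ∀ (g h : MulAction.stabilizer G (p i)) n, r g (r h n) =
        ((((θ i).1 g h)⁻¹ : Kˣ) : K) • r (g * h) n := fun i => by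
    obtain ⟨ρ, θ', hρ, hθ', hx⟩ := h5 (p i)
    have : SchurMul.mk θ' = SchurMul.mk (θ i)⁻¹ := by
      rw [hx, SchurMul.mk_inv, hθ]
      exact (inv_inv (X.frill (p i))).symm
    obtain ⟨c, hc⟩ := SchurMul.mk_eq_mk_iff.1 this
    -- The frill gives θ⁻¹ only up to a coboundary; rescaling the operators makes the cocycle
    -- exactly θ⁻¹.
    refine ⟨fun h => (ρ h).trans (LinearEquiv.smulOfUnit (c h)), fun h => IsSemilinear.smul (hρ h) _,
      fun g h n => ?_⟩
    change (c g : K) • ρ g ((c h : K) • ρ h n) = _ • (c (g * h) : K) • ρ (g * h) n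
    rw [map_smul, hθ', smul_smul, smul_smul, smul_smul, ← Units.val_mul, ← Units.val_mul,
      ← Units.val_mul, show ((θ i).1 g h)⁻¹ = _ from hc g h]
    congr 2
    rw [mul_assoc (θ'.1 g h), inv_mul_cancel_right, mul_comm]
  choose r hr hr' using hr
  exact skewMod_equivalent_directSum (Y := fun i => MulAction.orbit G (p i))
    (p := fun i => ⟨p i, MulAction.mem_orbit_self _⟩)
    (M := fun i y => M y) hM (fun i g => ⟨fun h => Subtype.ext h, fun h => Subtype.ext_iff.1 h⟩)
    (fun i y => by
      obtain ⟨y, g, rfl⟩ := y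
      obtain ⟨ρ, hρ⟩ := exists_semilinear_of_hasIrr_data h4 g (p i)
      exact ⟨g, ρ, rfl, hρ⟩) hr hr'

end SplitGAlgebra

/-! ### Realising arbitrary subgroups and cocycles -/

namespace SplitGAlgebra

variable {G : Type v} {K : Type u} [Group G] [Field K]

section

variable {I : Type u} {Y : I → Type u} [∀ i, MulAction G (Y i)] {p : ∀ i, Y i}
  {H : I → Subgroup G} (θ : ∀ i, cocycle K (H i))
  {t : ∀ i, Y i → G} (ht : ∀ i y, t i y • p i = y)
  (hH : ∀ i g, g ∈ H i ↔ g • p i = p i)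

/-- The cocycle on a `G`-set induced from cocycles on the stabilisers of base points of the
orbits. -/
def inducedCocycle (g h : G) (z : Σ i, Y i) : Kˣ :=
  (θ z.1).1 (loop ht hH z.1 g (h • z.2) _ rfl) (loop ht hH z.1 h z.2 _ rfl)

/-- It is the pullback of θ along the multiplicative assignment of loops to arrows. -/
theorem isActionCocycle_inducedCocycle : IsActionCocycle (inducedCocycle θ ht hH) := by
  rintro g h k ⟨i, x⟩
  have h1 : ∀ (g h : G) (x : Y i), loop ht hH i g (h • x) _ rfl * loop ht hH i h x _ rfl =
      loop ht hH i (g * h) x _ rfl := fun g h x => Subtype.ext (by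
    change (t i (g • h • x))⁻¹ * g * t i (h • x) * ((t i (h • x))⁻¹ * h * t i x) =
      (t i ((g * h) • x))⁻¹ * (g * h) * t i x
    rw [mul_smul]
    group)
  have h2 := (θ i).2 (loop ht hH i g (h • k • x) _ rfl) (loop ht hH i h (k • x) _ rfl)
    (loop ht hH i k x _ rfl)
  rw [h1, h1] at h2
  have h3 : inducedCocycle θ ht hH g (h * k) ⟨i, x⟩ =
      (θ i).1 (loop ht hH i g (h • k • x) _ rfl) (loop ht hH i (h * k) x _ rfl) := by
    have : loop ht hH i g ((h * k) • x) _ rfl = loop ht hH i g (h • k • x) _ rfl :=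
      Subtype.ext (by
      change (t i (g • (h * k) • x))⁻¹ * g * t i ((h * k) • x) =
        (t i (g • h • k • x))⁻¹ * g * t i (h • k • x)
      rw [mul_smul])
    exact congrArg (fun a => (θ i).1 a _) this
  rw [h3]
  exact h2

theorem inducedCocycle_base (ht' : ∀ i, t i (p i) = 1) (i : I) (g h : H i) :
    inducedCocycle θ ht hH g h ⟨i, p i⟩ = (θ i).1 g h := by
  have h1 : ∀ (g : H i) (y : Y i), y = p i → loop ht hH i g y _ rfl = g := fun g y hy =>
    Subtype.ext (by
      subst hy
      change (t i ((g : G) • p i))⁻¹ * (g : G) * t i (p i) = g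
      rw [(hH i g).1 g.2, ht', inv_one, one_mul, mul_one])
  unfold inducedCocycle
  rw [h1 g _ ((hH i h).1 h.2), h1 h _ rfl]

end

/-- The algebra is one whose simple modules form the disjoint union of the G / H_i, with cocycle
induced from the inverses of the θ_i. -/
theorem exists_skewMod_equivalent_directSum [Finite G] {I : Type u} [Finite I]
    (H : I → Subgroup G) (θ : ∀ i, cocycle K (H i)) :
    ∃ A : SplitGAlgebra G K,
      A.skewMod.Equivalent (ModuleCategory.directSum fun i => projMod (H i) (θ i)) := by
  classical
  -- `G` and the underlying sets of decorated sets live in different universes; finiteness of `G`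
  -- allows the coset spaces to be moved.
  let Y : I → Type u := fun i => Shrink.{u} (G ⧸ H i)
  let q : ∀ i, G ⧸ H i ≃ Y i := fun i => equivShrink.{u} _
  let _ : ∀ i, MulAction G (Y i) := fun i => (q i).symm.mulAction G
  let p : ∀ i, Y i := fun i => q i ((1 : G) : G ⧸ H i)
  have hsmul : ∀ (i : I) (g h : G), g • q i (h : G ⧸ H i) =
      q i ((g * h : G) : G ⧸ H i) := fun i g h =>
    congrArg (fun z => q i (g • z)) ((q i).symm_apply_apply _)
  have hH : ∀ i g, g ∈ H i ↔ g • p i = p i := fun i g => by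
    rw [hsmul, (q i).apply_eq_iff_eq, mul_one, eq_comm, QuotientGroup.eq, inv_one,
      one_mul]
  have ht : ∀ i (y : Y i), ∃ t : G, t • p i = y ∧ (y = p i → t = 1) := fun i y => by
    by_cases h : y = p i
    · exact ⟨1, by rw [one_smul, h], fun _ => rfl⟩
    · obtain ⟨y, rfl⟩ := (q i).surjective y
      obtain ⟨g, rfl⟩ := QuotientGroup.mk_surjective y
      exact ⟨g, by rw [hsmul, mul_one], fun h' => absurd h' h⟩
  choose t ht ht' using ht
  -- Inverted because passing to multiplicity spaces inverts the cocycle once more.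
  have hΘ := (isActionCocycle_inducedCocycle θ ht hH).inv
  obtain ⟨A, hA⟩ := (DecoratedSet.ofCocycle hΘ).exists_hasIrr
  obtain ⟨M, hM, ρ, hρ, hρ'⟩ := hA.exists_hasCocycle (hΘ := hΘ) fun _ => rfl
  refine ⟨A, skewMod_equivalent_directSum (M := fun i y => M ⟨i, y⟩) hM hH
    (fun i y => ⟨t i y, ρ (t i y) ⟨i, p i⟩ ⟨i, y⟩ (congrArg (Sigma.mk i) (ht i y)), ht i y, hρ _ _ _ _⟩)
    (r := fun i h => ρ h ⟨i, p i⟩ ⟨i, p i⟩ (congrArg (Sigma.mk i) ((hH i h).1 h.2)))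
    (fun i h => hρ _ _ _ _) fun i g h n => ?_⟩
  refine (hρ' g h ⟨i, p i⟩ ⟨i, p i⟩ ⟨i, p i⟩ _ _ n).trans ?_
  have := inducedCocycle_base θ ht hH (fun i => ht' i _ rfl) i g h
  change (((inducedCocycle θ ht hH g h ⟨i, p i⟩)⁻¹ : Kˣ) : K) • _ = _
  rw [this]
  rfl

end SplitGAlgebra

/-! ### Convolution of morphisms out of V ⊙ c -/

section IndexedHom

open MonoidalRightAction Functor.LaxRightLinear

variable {T : Type*} [Category* T] [MonoidalCategory T] {C : Type*} [Category* C] {D : Type*}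
  [Category* D] [MonoidalRightAction T C] [MonoidalRightAction T D]

/-- Composition of morphisms `V ⊙ c ⟶ V'` and `V' ⊙ c ⟶ V''` along a comultiplication of `c`. -/
def convComp {c : T} (Δ : c ⟶ c ⊗ c) {V V' V'' : C} (f : V ⊙ᵣ c ⟶ V') (f' : V' ⊙ᵣ c ⟶ V'') :
    V ⊙ᵣ c ⟶ V'' :=
  V ⊴ᵣ Δ ≫ (αᵣ V c c).hom ≫ f ⊵ᵣ c ≫ f'

variable (F : C ⥤ D) [F.RightLinear T]

/-- The image under a module functor of a morphism `V ⊙ c ⟶ V'`. -/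
def mapTensorHom {c : T} {V V' : C} (f : V ⊙ᵣ c ⟶ V') : F.obj V ⊙ᵣ c ⟶ F.obj V' :=
  μᵣ F V c ≫ F.map f

theorem mapTensorHom_whiskerRight {c c' : T} {V V' : C} (r : c ⟶ c') (f : V ⊙ᵣ c' ⟶ V') :
    mapTensorHom F (V ⊴ᵣ r ≫ f) = F.obj V ⊴ᵣ r ≫ mapTensorHom F f := by
  simp [mapTensorHom]

/-- Convolution is expressed by the module structure alone, so associativity and naturality of the
structure maps let a module functor preserve it. -/
theorem mapTensorHom_convComp {c : T} (Δ : c ⟶ c ⊗ c) {V V' V'' : C} (f : V ⊙ᵣ c ⟶ V')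
    (f' : V' ⊙ᵣ c ⟶ V'') :
    mapTensorHom F (convComp Δ f f') = convComp Δ (mapTensorHom F f) (mapTensorHom F f') := by
  have := μᵣ_associativity F V c c
  simp only [mapTensorHom, convComp, Functor.map_comp, Category.assoc, comp_actionHomLeft]
  rw [μᵣ_naturality_left_assoc, ← μᵣ_associativity_assoc, μᵣ_naturality_right_assoc]

theorem mapTensorHom_bijective [F.Full] [F.Faithful] {c : T} {V V' : C} :
    Function.Bijective (mapTensorHom F (c := c) (V := V) (V' := V')) := by
  refine ⟨fun f f' h => F.map_injective ((cancel_epi (Functor.RightLinear.μᵣIso F V c).hom).1 h),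
    fun f => ?_⟩
  obtain ⟨f', hf'⟩ := F.map_surjective ((Functor.RightLinear.μᵣIso F V c).inv ≫ f)
  refine ⟨f', ?_⟩
  rw [mapTensorHom, hf']
  exact (Functor.RightLinear.μᵣIso F V c).hom_inv_id_assoc f

end IndexedHom

/-! ### The regular representation as a coalgebra -/

section Regular

open scoped TensorProduct

/-- Morphisms of representations from linear maps. -/
def FDRep.homOfLinear {K : Type u} [Field K] {G : Type v} [Group G] {V W : FDRep K G}
    (f : V →ₗ[K] W) (h : ∀ g v, f (V.ρ g v) = W.ρ g (f v)) : V ⟶ W where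
  hom := InducedCategory.homMk (ModuleCat.ofHom f)
  comm g := FGModuleCat.hom_ext (LinearMap.ext (h g))

/-- The space underlying a tensor product of representations. -/
def FDRep.tensorEquiv {K : Type u} [Field K] {G : Type v} [Group G] (V W : FDRep K G) :
    (V ⊗ W : FDRep K G) ≃ₗ[K] V ⊗[K] W := LinearEquiv.refl K _

theorem FDRep.ρ_tensorEquiv_symm {K : Type u} [Field K] {G : Type v} [Group G] (V W : FDRep K G)
    (g : G) (v : V) (w : W) :
    (V ⊗ W : FDRep K G).ρ g ((FDRep.tensorEquiv V W).symm (v ⊗ₜ w)) =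
      (FDRep.tensorEquiv V W).symm (V.ρ g v ⊗ₜ W.ρ g w) := rfl

variable (K : Type u) [Field K] {G : Type v} [Group G] {Γ : Type u} [Finite Γ] (q : Γ ≃ G)

/-- The regular representation of `G` on the functions on a copy `Γ` of `G`. -/
def regularRep : FDRep K G :=
  FDRep.of (V := Γ →₀ K)
    { toFun := fun g => Finsupp.lmapDomain K K fun s => q.symm (g * q s)
      map_one' := by
        refine Finsupp.lhom_ext fun s c => ?_
        simp
      map_mul' := fun g h => by
        refine Finsupp.lhom_ext fun s c => ?_
        simp [mul_assoc] }

/-- The basis vectors of the regular representation. -/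
def regularVec (s : G) : regularRep K q := Finsupp.single (q.symm s) (1 : K)

theorem regularRep_ρ_vec (g s : G) :
    (regularRep K q).ρ g (regularVec K q s) = regularVec K q (g * s) := by
  refine (Finsupp.mapDomain_single).trans ?_
  rw [q.apply_symm_apply]
  rfl

variable {K q} in
theorem regularRep_hom_ext {W : Type*} [AddCommGroup W] [Module K W]
    {f f' : regularRep K q →ₗ[K] W} (h : ∀ s, f (regularVec K q s) = f' (regularVec K q s)) :
    f = f' :=
  Finsupp.lhom_ext' fun s => LinearMap.ext_ring (by
    have := h (q s)
    rwa [regularVec, q.symm_apply_apply] at this)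

/-- The linear map on the regular representation with given values on basis vectors. -/
def regularLift {W : Type*} [AddCommGroup W] [Module K W] (w : G → W) :
    regularRep K q →ₗ[K] W :=
  Finsupp.linearCombination K fun s => w (q s)

theorem regularLift_vec {W : Type*} [AddCommGroup W] [Module K W] (w : G → W) (s : G) :
    regularLift K q w (regularVec K q s) = w s := by
  refine (Finsupp.linearCombination_single K (1 : K) (q.symm s)).trans ?_
  rw [one_smul, q.apply_symm_apply]

theorem regular_comm {W : FDRep K G} {f : regularRep K q →ₗ[K] W}
    (h : ∀ g s, f (regularVec K q (g * s)) = W.ρ g (f (regularVec K q s))) (g : G)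
    (v : regularRep K q) : f ((regularRep K q).ρ g v) = W.ρ g (f v) := by
  have : f ∘ₗ (regularRep K q).ρ g = W.ρ g ∘ₗ f := regularRep_hom_ext fun s => by
    rw [LinearMap.comp_apply, LinearMap.comp_apply, regularRep_ρ_vec, h]
  exact DFunLike.congr_fun this v

/-- Right translation on the regular representation. -/
def regularRight (h : G) : regularRep K q ⟶ regularRep K q :=
  FDRep.homOfLinear (regularLift K q fun s => regularVec K q (s * h))
    (regular_comm K q fun g s => by
      rw [regularLift_vec, regularLift_vec, regularRep_ρ_vec, mul_assoc])

/-- The comultiplication of the regular representation. -/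
def regularComul : regularRep K q ⟶ regularRep K q ⊗ regularRep K q :=
  FDRep.homOfLinear (regularLift K q fun s => (FDRep.tensorEquiv _ _).symm
      (regularVec K q s ⊗ₜ[K] regularVec K q s))
    (regular_comm K q fun g s => by
      rw [regularLift_vec, regularLift_vec, FDRep.ρ_tensorEquiv_symm, regularRep_ρ_vec])

end Regular

/-! ### Recovering A-linear maps from V ⊠ K[G] -/

namespace TwistedModule

open scoped TensorProduct

variable {K : Type u} [Field K] {G : Type v} [Group G] {A : Type u} [Ring A] [Algebra K A]
  {α : G →* (A ≃ₐ[K] A)} {V V' V'' : TwistedModule α (1 : cocycle K G)}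
  {Γ : Type u} [Finite Γ] (q : Γ ≃ G)

/-- The value at `v ⊗ s` of a morphism from the tensor product with the regular representation. -/
def regularApply (f : V.tensor (MonoidHom.id G) (regularRep K q) ⟶ V') (v : V.carrier) (s : G) :
    V'.carrier :=
  lin f ((tensorEquiv (MonoidHom.id G) V (regularRep K q)).symm (v ⊗ₜ regularVec K q s))

theorem regularApply_op (f : V.tensor (MonoidHom.id G) (regularRep K q) ⟶ V') (g : G)
    (v : V.carrier) (s : G) :
    regularApply q f (V.op g v) (g * s) = V'.op g (regularApply q f v s) := by
  unfold regularApply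
  rw [← lin_op, ← regularRep_ρ_vec]
  rfl

/-- `G` permutes the basis vectors of K[G] simply transitively, so equivariance reduces every value
to the one at 1. -/
theorem regularApply_eq (f : V.tensor (MonoidHom.id G) (regularRep K q) ⟶ V') (v : V.carrier)
    (s : G) : regularApply q f v s = V'.op s (regularApply q f (V.op s⁻¹ v) 1) := by
  rw [← regularApply_op, op_op_of_one, mul_inv_cancel, op_one_of_one, mul_one]

/-- Restriction of morphisms `V ⊠ K[G] ⟶ V'` to `A`-linear maps on `V`. -/
def regularHom : (V.tensor (MonoidHom.id G) (regularRep K q) ⟶ V') →ₗ[K]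
    (V.carrier →ₗ[A] V'.carrier) where
  toFun f :=
    { toFun := fun v => regularApply q f v 1
      map_add' := fun v w => by
        unfold regularApply
        rw [TensorProduct.add_tmul, map_add, map_add]
      map_smul' := fun a v => lin_actEnd f a
        ((tensorEquiv (MonoidHom.id G) V (regularRep K q)).symm (v ⊗ₜ regularVec K q 1)) }
  map_add' f f' := rfl
  map_smul' c f := rfl

theorem regularHom_apply (f : V.tensor (MonoidHom.id G) (regularRep K q) ⟶ V') (v : V.carrier) :
    regularHom q f v = regularApply q f v 1 := rfl

/-- The inverse sends φ to v ⊗ s ↦ s φ(s⁻¹ v). -/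
theorem regularHom_bijective : Function.Bijective (regularHom (V := V) (V' := V') q) := by
  refine ⟨fun f f' h => lin_tensor_ext _ _ fun m w => ?_, fun φ => ?_⟩
  · let l (f : V.tensor (MonoidHom.id G) (regularRep K q) ⟶ V') :
        regularRep K q →ₗ[K] V'.carrier :=
      lin f ∘ₗ (tensorEquiv (MonoidHom.id G) V (regularRep K q)).symm.toLinearMap ∘ₗ
        TensorProduct.mk K V.carrier (regularRep K q) m
    have : l f = l f' := regularRep_hom_ext fun s => by
      change regularApply q f m s = regularApply q f' m s
      rw [regularApply_eq, regularApply_eq q f', ← regularHom_apply, ← regularHom_apply, h]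
    exact DFunLike.congr_fun this w
  · let B : V.carrier ⊗[K] regularRep K q →ₗ[K] V'.carrier :=
      TensorProduct.lift (LinearMap.flip (regularLift K q (fun s =>
        (V'.op s ∘ₗ φ.restrictScalars K ∘ₗ V.op s⁻¹ : V.carrier →ₗ[K] V'.carrier))))
    have hB : ∀ v s, B (v ⊗ₜ regularVec K q s) = V'.op s (φ (V.op s⁻¹ v)) := fun v s => by
      refine (TensorProduct.lift.tmul _ _).trans ?_
      rw [LinearMap.flip_apply]
      rw [regularLift_vec]
      rfl
    have ext : ∀ {L L' : V.carrier ⊗[K] regularRep K q →ₗ[K] V'.carrier},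
        (∀ v s, L (v ⊗ₜ regularVec K q s) = L' (v ⊗ₜ regularVec K q s)) → L = L' :=
      fun h => TensorProduct.ext (LinearMap.ext fun v => regularRep_hom_ext fun s => h v s)
    have h1 : ∀ a x, B (TensorProduct.map (V.actEnd a) LinearMap.id x) = V'.actEnd a (B x) :=
      fun a x => by
        refine DFunLike.congr_fun (ext (L := B ∘ₗ TensorProduct.map (V.actEnd a) LinearMap.id)
          (L' := V'.actEnd a ∘ₗ B) fun v s => ?_) x
        rw [LinearMap.comp_apply, LinearMap.comp_apply, TensorProduct.map_tmul,
          LinearMap.id_apply, hB, hB, op_actEnd]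
        refine (congrArg (V'.op s) (φ.map_smul _ _)).trans ?_
        refine (op_actEnd V' s _ _).trans ?_
        rw [← AlgEquiv.mul_apply, ← map_mul, mul_inv_cancel, map_one]
        rfl
    have h2 : ∀ g x, B (TensorProduct.map (V.op g) ((regularRep K q).ρ g) x) = V'.op g (B x) :=
      fun g x => by
        refine DFunLike.congr_fun (ext
          (L := B ∘ₗ TensorProduct.map (V.op g) ((regularRep K q).ρ g))
          (L' := V'.op g ∘ₗ B) fun v s => ?_) x
        rw [LinearMap.comp_apply, LinearMap.comp_apply, TensorProduct.map_tmul,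
          regularRep_ρ_vec, hB, hB, op_op_of_one, op_op_of_one, mul_inv_rev,
          inv_mul_cancel_right]
    refine ⟨homMk (M := V.tensor (MonoidHom.id G) (regularRep K q)) B h1 h2,
      LinearMap.ext fun v => ?_⟩
    refine (hB v 1).trans ?_
    rw [inv_one, op_one_of_one, op_one_of_one]

/-- Morphisms `V ⊠ K[G] ⟶ V'` are the same as `A`-linear maps `V → V'`. -/
def regularHomEquiv : (V.tensor (MonoidHom.id G) (regularRep K q) ⟶ V') ≃ₗ[K]
    (V.carrier →ₗ[A] V'.carrier) :=
  LinearEquiv.ofBijective (regularHom q) (regularHom_bijective q)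

/-- The action of `G` on Hom_A(V, V') by conjugation is thus visible in the module category, through
right translations of K[G]. -/
theorem regularHom_right (h : G) (f : V.tensor (MonoidHom.id G) (regularRep K q) ⟶ V')
    (v : V.carrier) :
    letI := rightAction (α := α) (θ := (1 : cocycle K G)) (MonoidHom.id G)
    regularHom q (MonoidalRightAction.actionHomRight V (regularRight K q h) ≫ f) v =
      V'.op h (regularHom q f (V.op h⁻¹ v)) := by
  have : regularLift K q (fun s => regularVec K q (s * h)) (regularVec K q 1) =
      regularVec K q h := by rw [regularLift_vec, one_mul]
  refine Eq.trans ?_ (regularApply_eq q f v h)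
  exact congrArg (fun w => lin f
    ((tensorEquiv (MonoidHom.id G) V (regularRep K q)).symm (v ⊗ₜ w))) this

/-- The comultiplication is diagonal on basis vectors, so the value at 1 of a convolution involves
only the values of both factors at 1. -/
theorem regularHom_convComp (f : V.tensor (MonoidHom.id G) (regularRep K q) ⟶ V')
    (f' : V'.tensor (MonoidHom.id G) (regularRep K q) ⟶ V'') (v : V.carrier) :
    letI := rightAction (α := α) (θ := (1 : cocycle K G)) (MonoidHom.id G)
    regularHom q (convComp (regularComul K q) f f') v = regularHom q f' (regularHom q f v) := by
  have : regularLift K q (fun s => (FDRep.tensorEquiv _ _).symm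
      (regularVec K q s ⊗ₜ[K] regularVec K q s)) (regularVec K q 1) =
      (FDRep.tensorEquiv _ _).symm (regularVec K q 1 ⊗ₜ[K] regularVec K q 1) := by
    rw [regularLift_vec]
  let _ := rightAction (α := α) (θ := (1 : cocycle K G)) (MonoidHom.id G)
  exact congrArg (fun w => lin ((MonoidalRightAction.actionAssocIso V _ _).hom ≫
      MonoidalRightAction.actionHomLeft f (regularRep K q) ≫ f')
    ((tensorEquiv (MonoidHom.id G) V (regularRep K q ⊗ regularRep K q)).symm (v ⊗ₜ w))) this

end TwistedModule

/-! ### Endomorphism algebras of equivariant modules and recovery of Irr(A) -/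

namespace SplitGAlgebra

variable {G : Type v} {K : Type u} [Group G] [Field K] {A B : SplitGAlgebra G K}

/-- The endomorphisms of a semisimple module act on its multiplicity spaces. -/
def multiplicityHom {X : Type u} (M : X → ModuleCat.{u} A.A)
    (V : TwistedModule A.α (1 : cocycle K G)) :
    Module.End A.A V.carrier →ₐ[K] ∀ x, Module.End K (M x →ₗ[A.A] V.carrier) where
  toFun φ x := postcomp K (M x) φ
  map_one' := rfl
  map_mul' _ _ := rfl
  map_zero' := rfl
  map_add' _ _ := rfl
  commutes' _ := rfl

/-- This combines uniqueness and existence of `A`-linear maps with prescribed action on the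
multiplicity spaces. -/
theorem multiplicityHom_bijective {X : Type u} [Finite X] {M : X → ModuleCat.{u} A.A}
    (hM : A.IsIrr M) (V : TwistedModule A.α (1 : cocycle K G)) :
    Function.Bijective (multiplicityHom M V) := by
  classical
  have := Fintype.ofFinite X
  refine ⟨fun φ ψ h => hM.isIrrFamily.hom_ext fun x f => ?_, fun φ => ?_⟩
  · exact DFunLike.congr_fun (congrFun h x) f
  · obtain ⟨F, hF⟩ := hM.isIrrFamily.exists_hom φ
    exact ⟨F, funext fun x => LinearMap.ext fun f => hF x f⟩

/-- Conjugation of homomorphisms by semilinear isomorphisms, as a linear isomorphism. -/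
def homConjEquiv {N N' : ModuleCat.{u} A.A} (V : TwistedModule A.α (1 : cocycle K G)) {g : G}
    {σ : N ≃ₗ[K] N'} (hσ : A.IsSemilinear g σ) :
    (N →ₗ[A.A] V.carrier) ≃ₗ[K] (N' →ₗ[A.A] V.carrier) where
  __ := homConj V hσ
  invFun := homConj V hσ.symm
  left_inv := homConj_symm_homConj V hσ
  right_inv := homConj_homConj_symm V hσ

/-- End_A(V) is the product of the End_K(Hom_A(M_x, V)). By `hV` no multiplicity space is zero, so
these are its simple modules, and conjugation acts on them with the inverse cocycle. -/
theorem HasIrr.hasIrr_end {X : DecoratedSet G K} (h : A.HasIrr X)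
    {V : TwistedModule A.α (1 : cocycle K G)}
    (hV : ∀ N : ModuleCat.{u} A.A, IsSimpleModule A.A N → Nontrivial (N →ₗ[A.A] V.carrier))
    {C : Type u} [Ring C] [Algebra K C] (β : G →* (C ≃ₐ[K] C))
    (Ψ : C ≃ₐ[K] Module.End A.A V.carrier)
    (hΨ : ∀ g c v, Ψ (β g c) (V.op g v) = V.op g (Ψ c v)) :
    ∃ S : SplitGAlgebra G K, S.HasIrr X.inv ∧
      -- Recording the data of `S` lets two applications with the same `C` and `β`, but different
      -- modules, yield the same algebra up to proofs.
      ∃ hs hp, S = { A := C, α := β, semisimple := hs, split := hp } := by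
  obtain ⟨Θ, hΘ, hX⟩ := X.exists_hasClass
  obtain ⟨M, hM, ρ, hρ, hρ'⟩ := h.exists_hasCocycle hX
  have hX' : X.inv.HasClass hΘ.inv := fun x => by
    exact (SchurMul.mk_inv (hΘ.res x)).trans (congrArg _ (hX x))
  have : ∀ x : X.inv.X, Nontrivial (M x →ₗ[A.A] V.carrier) := fun x =>
    hV (M x) (hM.isSimpleModule x)
  have hfin : ∀ x, Module.Finite K (M x) := hM.isIrrFamily.finite
  have : ∀ x : X.inv.X, Module.Finite K (M x →ₗ[A.A] V.carrier) := fun x =>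
    @finite_linearMap_of_algebra K A.A (M x) V.carrier _ _ _ _ _ _ _ _ _ _ _ (hfin x) _
  let e := Ψ.trans (AlgEquiv.ofBijective _ (multiplicityHom_bijective hM V))
  refine ⟨_, hasIrr_ofAlgEquivPiEnd (X := X.inv) (U := fun x => M x →ₗ[A.A] V.carrier)
    β e hX'
    (fun g x y hx => homConjEquiv V (hρ g x y hx)) (fun g x y hx c u => LinearMap.ext fun m => ?_)
    (fun g k x y z hx hy u => ?_), _, _, rfl⟩
  · exact (hΨ g c _).symm
  · refine homConj_homConj V (hρ _ _ _ _) (hρ _ _ _ _) (hρ _ _ _ _) ((Θ g k x)⁻¹) (fun n => ?_) u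
    rw [inv_inv]
    exact hρ' g k x y z hx hy n

/-- Conjugation by the operators of the group on the endomorphisms of a twisted module. -/
def endConjHom (V : TwistedModule A.α (1 : cocycle K G)) (g : G) :
    Module.End A.A V.carrier →ₐ[K] Module.End A.A V.carrier where
  toFun φ :=
    { toFun := fun v => V.op g (φ (V.op g⁻¹ v))
      map_add' := fun v w => by rw [map_add, map_add, map_add]
      map_smul' := fun a v => by
        rw [V.op_smul, map_smul, V.op_smul, ← AlgEquiv.mul_apply, ← map_mul, mul_inv_cancel,
          map_one]
        rfl }
  map_one' := LinearMap.ext fun v => by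
    change V.op g (V.op g⁻¹ v) = v
    rw [V.op_op_of_one, mul_inv_cancel, V.op_one_of_one]
  map_mul' φ ψ := LinearMap.ext fun v => by
    change V.op g (φ (ψ (V.op g⁻¹ v))) = V.op g (φ (V.op g⁻¹ (V.op g (ψ (V.op g⁻¹ v)))))
    rw [V.op_inv_op]
  map_zero' := LinearMap.ext fun v => map_zero (V.op g)
  map_add' φ ψ := LinearMap.ext fun v => map_add (V.op g) _ _
  commutes' c := LinearMap.ext fun v => by
    change V.op g (c • V.op g⁻¹ v) = c • v
    rw [map_smul, V.op_op_of_one, mul_inv_cancel, V.op_one_of_one]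

theorem endConjHom_endConjHom (V : TwistedModule A.α (1 : cocycle K G)) (g h : G)
    (φ : Module.End A.A V.carrier) :
    endConjHom V g (endConjHom V h φ) = endConjHom V (g * h) φ := LinearMap.ext fun v => by
  change V.op g (V.op h (φ (V.op h⁻¹ (V.op g⁻¹ v)))) = V.op (g * h) (φ (V.op (g * h)⁻¹ v))
  rw [V.op_op_of_one, V.op_op_of_one, mul_inv_rev]

theorem endConjHom_one (V : TwistedModule A.α (1 : cocycle K G))
    (φ : Module.End A.A V.carrier) : endConjHom V 1 φ = φ := LinearMap.ext fun v => by
  change V.op 1 (φ (V.op 1⁻¹ v)) = φ v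
  rw [inv_one, V.op_one_of_one, V.op_one_of_one]

/-- The action of the group on the endomorphisms of a twisted module. -/
def endConj (V : TwistedModule A.α (1 : cocycle K G)) :
    G →* (Module.End A.A V.carrier ≃ₐ[K] Module.End A.A V.carrier) where
  toFun g := AlgEquiv.ofAlgHom (endConjHom V g) (endConjHom V g⁻¹)
    (AlgHom.ext fun φ => (endConjHom_endConjHom V _ _ φ).trans (by
      rw [mul_inv_cancel, endConjHom_one]; rfl))
    (AlgHom.ext fun φ => (endConjHom_endConjHom V _ _ φ).trans (by
      rw [inv_mul_cancel, endConjHom_one]; rfl))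
  map_one' := AlgEquiv.ext fun φ => endConjHom_one V φ
  map_mul' g h := AlgEquiv.ext fun φ => (endConjHom_endConjHom V g h φ).symm

theorem endConj_apply_op (V : TwistedModule A.α (1 : cocycle K G)) (g : G)
    (φ : Module.End A.A V.carrier) (v : V.carrier) :
    endConj V g φ (V.op g v) = V.op g (φ v) := by
  change V.op g (φ (V.op g⁻¹ (V.op g v))) = _
  rw [V.op_inv_op]

/-- The algebra as an equivariant module over itself. -/
def regularModule (A : SplitGAlgebra G K) : TwistedModule A.α (1 : cocycle K G) :=
  haveI := A.finite_algebra
  TwistedModule.ofOp A.A (Algebra.lmul K A.A) (fun g => (A.α g).toLinearMap)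
    (fun a => by
      rw [map_one]
      exact (one_smul K a).symm)
    (fun g h a => by
      rw [map_mul]
      exact (one_smul K _).symm)
    (fun g a b => map_mul (A.α g) a b)

/-- A simple module is a quotient of the left regular module, and the quotient map splits by
projectivity. -/
theorem nontrivial_hom_regularModule (A : SplitGAlgebra G K) (N : ModuleCat.{u} A.A)
    (hN : IsSimpleModule A.A N) : Nontrivial (N →ₗ[A.A] A.regularModule.carrier) := by
  have := A.semisimple
  have := hN.nontrivial
  obtain ⟨n, hn⟩ := exists_ne (0 : N)
  have : Module.Projective A.A N := Module.projective_of_isSemisimpleRing A.A N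
  obtain ⟨f, hf⟩ := Module.projective_lifting_property (LinearMap.toSpanSingleton A.A N n)
    LinearMap.id (IsSimpleModule.toSpanSingleton_surjective A.A hn)
  let f' : N →ₗ[A.A] A.regularModule.carrier :=
    { toFun := f
      map_add' := map_add f
      map_smul' := map_smul f }
  refine ⟨f', 0, fun h => hn ?_⟩
  have h1 : f n = 0 := DFunLike.congr_fun h n
  have h2 : f n • n = n := DFunLike.congr_fun hf n
  rw [← h2, h1, zero_smul]

end SplitGAlgebra

namespace SplitGAlgebra

variable {G : Type v} {K : Type u} [Group G] [Field K] {A B : SplitGAlgebra G K}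

instance : MonoidalRightAction (FDRep K G) (TwistedModule A.α (1 : cocycle K G)) :=
  TwistedModule.rightAction (MonoidHom.id G)

section

variable {Γ : Type u} [Finite Γ] (q : Γ ≃ G)
  (F : TwistedModule A.α (1 : cocycle K G) ⥤ TwistedModule B.α (1 : cocycle K G))
  [F.Additive] [F.Linear K] [F.RightLinear (FDRep K G)]
  (V : TwistedModule A.α (1 : cocycle K G))

/-- The map induced by a module functor on morphisms from the tensor product with the regular
representation. -/
def regularMap : (V.tensor (MonoidHom.id G) (regularRep K q) ⟶ V) →ₗ[K]
    ((F.obj V).tensor (MonoidHom.id G) (regularRep K q) ⟶ F.obj V) where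
  toFun f := mapTensorHom F (c := regularRep K q) f
  map_add' f g := by simp only [mapTensorHom, F.map_add, Preadditive.comp_add]
  map_smul' c f := by simp only [mapTensorHom, F.map_smul, Linear.comp_smul, RingHom.id_apply]

/-- The map induced by a module functor on endomorphisms over the algebra. -/
def endMap : Module.End A.A V.carrier →ₗ[K] Module.End B.A (F.obj V).carrier :=
  TwistedModule.regularHom q ∘ₗ regularMap q F V ∘ₗ
    (TwistedModule.regularHomEquiv q).symm.toLinearMap

theorem endMap_regularHom
    (f : V.tensor (MonoidHom.id G) (regularRep K q) ⟶ V) :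
    endMap q F V (TwistedModule.regularHom q f) =
      TwistedModule.regularHom q (mapTensorHom F (c := regularRep K q) f) :=
  congrArg (fun f => TwistedModule.regularHom q (mapTensorHom F (c := regularRep K q) f))
    ((TwistedModule.regularHomEquiv q).symm_apply_apply f)

theorem endMap_bijective [F.Full] [F.Faithful] : Function.Bijective (endMap q F V) :=
  (TwistedModule.regularHom_bijective q).comp ((mapTensorHom_bijective F).comp
    (TwistedModule.regularHomEquiv q).symm.bijective)

/-- Composition is convolution along the comultiplication of K[G], which a module functor preserves.
-/
theorem endMap_mul (φ ψ : Module.End A.A V.carrier) :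
    endMap q F V (φ * ψ) = endMap q F V φ * endMap q F V ψ := by
  obtain ⟨f, rfl⟩ := (TwistedModule.regularHom_bijective q).2 φ
  obtain ⟨g, rfl⟩ := (TwistedModule.regularHom_bijective q).2 ψ
  have h : ∀ {A : SplitGAlgebra G K} (V : TwistedModule A.α (1 : cocycle K G))
      (f g : V.tensor (MonoidHom.id G) (regularRep K q) ⟶ V),
      TwistedModule.regularHom q f * TwistedModule.regularHom q g =
        TwistedModule.regularHom q (convComp (regularComul K q) g f) := fun V f g =>
    LinearMap.ext fun v => (TwistedModule.regularHom_convComp q g f v).symm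
  rw [h, endMap_regularHom, endMap_regularHom, endMap_regularHom, h]
  exact congrArg _ (mapTensorHom_convComp F (regularComul K q) g f)

/-- Conjugation by `g` is precomposition with a right translation of K[G], and the structure maps of
`F` are natural in K[G]. -/
theorem endMap_endConj (g : G) (φ : Module.End A.A V.carrier) :
    endMap q F V (endConj V g φ) = endConj (F.obj V) g (endMap q F V φ) := by
  obtain ⟨f, rfl⟩ := (TwistedModule.regularHom_bijective q).2 φ
  have h : ∀ {A : SplitGAlgebra G K} (V : TwistedModule A.α (1 : cocycle K G))
      (f : V.tensor (MonoidHom.id G) (regularRep K q) ⟶ V),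
      endConj V g (TwistedModule.regularHom q f) =
        TwistedModule.regularHom q
          (MonoidalRightAction.actionHomRight V (regularRight K q g) ≫ f) := fun V f =>
    LinearMap.ext fun v => (TwistedModule.regularHom_right q g f v).symm
  rw [h, endMap_regularHom, endMap_regularHom, h]
  exact congrArg _ (mapTensorHom_whiskerRight F (regularRight K q g) f)

/-- The algebra isomorphism induced by an equivalence of module categories on endomorphisms over the
algebras. -/
def endAlgEquiv [F.Full] [F.Faithful] :
    Module.End A.A V.carrier ≃ₐ[K] Module.End B.A (F.obj V).carrier :=
  let e : Module.End A.A V.carrier ≃* Module.End B.A (F.obj V).carrier :=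
    MulEquiv.ofBijective (⟨endMap q F V, endMap_mul q F V⟩ :
      Module.End A.A V.carrier →ₙ* Module.End B.A (F.obj V).carrier) (endMap_bijective q F V)
  AlgEquiv.ofLinearEquiv (LinearEquiv.ofBijective _ (endMap_bijective q F V)) (map_one e)
    (map_mul e)

end

/-- The direct sum of two equivariant modules. -/
def prodModule (V W : TwistedModule A.α (1 : cocycle K G)) :
    TwistedModule A.α (1 : cocycle K G) :=
  TwistedModule.ofOp (V.carrier × W.carrier) (Algebra.lsmul K K _)
    (fun g => (V.op g).prodMap (W.op g))
    (fun v => Prod.ext (V.op_one v.1) (W.op_one v.2))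
    (fun g h v => Prod.ext (V.op_op g h v.1) (W.op_op g h v.2))
    (fun g a v => Prod.ext (V.op_smul g a v.1) (W.op_smul g a v.2))

/-- The inclusion of the first summand. -/
def prodInl (V W : TwistedModule A.α (1 : cocycle K G)) : V ⟶ prodModule V W :=
  TwistedModule.homMk (N := prodModule V W) (LinearMap.inl K V.carrier W.carrier)
    (fun a _ => Prod.ext rfl (map_zero (W.actEnd a)).symm)
    (fun g _ => Prod.ext rfl (map_zero (W.op g)).symm)

/-- The inclusion of the second summand. -/
def prodInr (V W : TwistedModule A.α (1 : cocycle K G)) : W ⟶ prodModule V W :=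
  TwistedModule.homMk (N := prodModule V W) (LinearMap.inr K V.carrier W.carrier)
    (fun a _ => Prod.ext (map_zero (V.actEnd a)).symm rfl)
    (fun g _ => Prod.ext (map_zero (V.op g)).symm rfl)

/-- The projection to the second summand. -/
def prodSnd (V W : TwistedModule A.α (1 : cocycle K G)) : prodModule V W ⟶ W :=
  TwistedModule.homMk (M := prodModule V W) (LinearMap.snd K V.carrier W.carrier)
    (fun _ _ => rfl) (fun _ _ => rfl)

theorem nontrivial_hom_of_injective {N V V' : Type*} [AddCommGroup N] [AddCommGroup V]
    [AddCommGroup V'] {R : Type*} [Ring R] [Module R N] [Module R V] [Module R V']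
    [Nontrivial (N →ₗ[R] V)] (f : V →ₗ[R] V') (hf : Function.Injective f) :
    Nontrivial (N →ₗ[R] V') := by
  obtain ⟨g, hg⟩ := exists_ne (0 : N →ₗ[R] V)
  refine ⟨f ∘ₗ g, 0, fun h => hg (LinearMap.ext fun n => hf ?_)⟩
  rw [LinearMap.zero_apply, map_zero]
  exact DFunLike.congr_fun h n

theorem linA_injective_of_comp_eq_id {V W : TwistedModule A.α (1 : cocycle K G)} {f : V ⟶ W}
    {g : W ⟶ V} (h : f ≫ g = 𝟙 V) : Function.Injective (TwistedModule.linA f) :=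
  Function.LeftInverse.injective (g := TwistedModule.linA g) fun v =>
    congrArg (fun l => TwistedModule.lin l v) h

/-- The decorated set of simple modules is determined by the module category `A * G-Mod`. -/
theorem HasIrr.iso_of_skewMod_equivalent [Finite G] {X Y : DecoratedSet G K} (hX : A.HasIrr X)
    (hY : B.HasIrr Y) (h : A.skewMod.Equivalent B.skewMod) : X.Iso Y := by
  obtain ⟨F, h1, h2, h3, ⟨h4⟩⟩ := h
  obtain ⟨n, ⟨q⟩⟩ := Finite.exists_equiv_fin G
  let q : ULift.{u} (Fin n) ≃ G := Equiv.ulift.trans q.symm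
  let F : TwistedModule A.α (1 : cocycle K G) ⥤ TwistedModule B.α (1 : cocycle K G) := F
  have : F.IsEquivalence := h1
  have : F.Additive := h2
  have : F.Linear K := h3
  let _ : F.RightLinear (FDRep K G) := h4
  -- Every simple `A`-module occurs in the first summand of `V`, and every simple `B`-module occurs
  -- in the image of the second, because F W is the regular module of `B`.
  let W := F.objPreimage B.regularModule
  let i : F.obj W ≅ B.regularModule := F.objObjPreimageIso B.regularModule
  let V := prodModule A.regularModule W
  have hV : ∀ N : ModuleCat.{u} A.A, IsSimpleModule A.A N →
      Nontrivial (N →ₗ[A.A] V.carrier) := fun N hN => by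
    have := A.nontrivial_hom_regularModule N hN
    exact nontrivial_hom_of_injective (V := A.regularModule.carrier)
      (TwistedModule.linA (prodInl A.regularModule W)) fun v w h => (Prod.ext_iff.1 h).1
  have hV' : ∀ N : ModuleCat.{u} B.A, IsSimpleModule B.A N →
      Nontrivial (N →ₗ[B.A] (F.obj V).carrier) := fun N hN => by
    have := B.nontrivial_hom_regularModule N hN
    refine nontrivial_hom_of_injective (V := B.regularModule.carrier)
      (TwistedModule.linA (i.inv ≫ F.map (prodInr A.regularModule W))) ?_
    refine linA_injective_of_comp_eq_id (g := F.map (prodSnd A.regularModule W) ≫ i.hom) ?_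
    rw [Category.assoc, ← F.map_comp_assoc,
      show prodInr A.regularModule W ≫ prodSnd A.regularModule W = 𝟙 W from rfl, F.map_id,
      Category.id_comp, i.inv_hom_id]
  -- The single `G`-algebra End_A(V) is read in two ways: acting on `V`, and through `F` on F V. Its
  -- decorated set is therefore the inverse of `X` and also the inverse of `Y`.
  obtain ⟨S, hS, _, _, rfl⟩ := hX.hasIrr_end hV (endConj V) AlgEquiv.refl (endConj_apply_op V)
  obtain ⟨S', hS', _, _, rfl⟩ := hY.hasIrr_end hV' (endConj V) (endAlgEquiv q F V)
    (fun g φ v => by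
      refine (congrArg (fun ψ : Module.End B.A (F.obj V).carrier => ψ ((F.obj V).op g v))
        (endMap_endConj q F V g φ)).trans ?_
      exact endConj_apply_op (F.obj V) g _ v)
  exact (hS.left_unique hS').of_inv

end SplitGAlgebra

/-! ### The correspondence between decorated sets and module categories -/

namespace DecoratedSet

variable {G : Type v} {K : Type u} [Group G] [Field K]

/-- The module category `M` corresponds to the decorated set `X`: it is equivalent to `A * G-Mod`
for a `G`-algebra `A` with `Irr(A)` isomorphic to `X`. -/
def HasModuleCategory (X : DecoratedSet G K) (M : ModuleCategory G K) : Prop :=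
  ∃ A : SplitGAlgebra G K, A.HasIrr X ∧ M.Equivalent A.skewMod

theorem exists_orbit_representatives (X : DecoratedSet G K) :
    ∃ (I : Type u) (_ : Finite I) (p : I → X.X), (∀ x, ∃ i, x ∈ MulAction.orbit G (p i)) ∧
      ∀ i j, p i ∈ MulAction.orbit G (p j) → i = j := by
  refine ⟨MulAction.orbitRel.Quotient G X.X, inferInstance, Quotient.out, fun x => ⟨⟦x⟧, ?_⟩,
    fun i j h => ?_⟩
  · exact (MulAction.orbitRel G X.X).symm (Quotient.mk_out (s := MulAction.orbitRel G X.X) x)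
  · have := Quotient.sound (s := MulAction.orbitRel G X.X) h
    rwa [Quotient.out_eq, Quotient.out_eq] at this

theorem exists_skewMod_equivalent (X : DecoratedSet G K) :
    ∃ (I : Type u) (_ : Finite I) (H : I → Subgroup G) (θ : ∀ i, cocycle K (H i)),
      ∀ A : SplitGAlgebra G K, A.HasIrr X →
        A.skewMod.Equivalent (ModuleCategory.directSum fun i => projMod (H i) (θ i)) := by
  obtain ⟨I, _, p, hp, hp'⟩ := X.exists_orbit_representatives
  choose θ hθ using fun i => SchurMul.mk_surjective (X.frill (p i))⁻¹
  exact ⟨I, inferInstance, _, θ, fun A hA => hA.skewMod_equivalent p hp hp' θ hθ⟩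

theorem _root_.SplitGAlgebra.isSpecial_skewMod (A : SplitGAlgebra G K) : A.skewMod.IsSpecial := by
  obtain ⟨X, hX⟩ := A.exists_hasIrr
  obtain ⟨I, hI, H, θ, h⟩ := X.exists_skewMod_equivalent
  exact ⟨I, hI, H, θ, h A hX⟩

theorem _root_.SplitGAlgebra.HasIrr.skewMod_equivalent_skewMod {X : DecoratedSet G K}
    {A B : SplitGAlgebra G K} (hA : A.HasIrr X) (hB : B.HasIrr X) :
    A.skewMod.Equivalent B.skewMod := by
  obtain ⟨I, hI, H, θ, h⟩ := X.exists_skewMod_equivalent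
  exact ModuleCategory.equivalent_equivalence.trans (h A hA)
    (ModuleCategory.equivalent_equivalence.symm (h B hB))

namespace HasModuleCategory

variable {X Y : DecoratedSet G K} {M N : ModuleCategory G K}

theorem congr_right (h : X.HasModuleCategory M) (hMN : M.Equivalent N) :
    X.HasModuleCategory N := by
  obtain ⟨A, hA, hM⟩ := h
  exact ⟨A, hA, ModuleCategory.equivalent_equivalence.trans
    (ModuleCategory.equivalent_equivalence.symm hMN) hM⟩

theorem congr_left (h : X.HasModuleCategory M) (hXY : X.Iso Y) : Y.HasModuleCategory M := by
  obtain ⟨A, hA, hM⟩ := h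
  exact ⟨A, hA.congr_left hXY, hM⟩

theorem equivalent_skewMod (h : X.HasModuleCategory M) {A : SplitGAlgebra G K} (hA : A.HasIrr X) :
    M.Equivalent A.skewMod := by
  obtain ⟨B, hB, hM⟩ := h
  exact ModuleCategory.equivalent_equivalence.trans hM (hB.skewMod_equivalent_skewMod hA)

theorem right_unique (h : X.HasModuleCategory M) (h' : X.HasModuleCategory N) :
    M.Equivalent N := by
  obtain ⟨A, hA, hN⟩ := h'
  exact ModuleCategory.equivalent_equivalence.trans (h.equivalent_skewMod hA)
    (ModuleCategory.equivalent_equivalence.symm hN)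

theorem left_unique [Finite G] (h : X.HasModuleCategory M) (h' : Y.HasModuleCategory M) :
    X.Iso Y := by
  obtain ⟨A, hA, hM⟩ := h
  obtain ⟨B, hB, hM'⟩ := h'
  exact hA.iso_of_skewMod_equivalent hB (ModuleCategory.equivalent_equivalence.trans
    (ModuleCategory.equivalent_equivalence.symm hM) hM')

end HasModuleCategory

theorem exists_hasModuleCategory [Finite G] (X : DecoratedSet G K) :
    ∃ M : SpecialModuleCategory G K, X.HasModuleCategory M.1 := by
  obtain ⟨A, hA⟩ := X.exists_hasIrr
  exact ⟨⟨A.skewMod, A.isSpecial_skewMod⟩, A, hA, ModuleCategory.equivalent_equivalence.refl _⟩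

theorem _root_.SpecialModuleCategory.exists_hasModuleCategory [Finite G]
    (M : SpecialModuleCategory G K) : ∃ X : DecoratedSet G K, X.HasModuleCategory M.1 := by
  obtain ⟨M, I, _, H, θ, h⟩ := M
  obtain ⟨A, hA⟩ := SplitGAlgebra.exists_skewMod_equivalent_directSum H θ
  obtain ⟨X, hX⟩ := A.exists_hasIrr
  exact ⟨X, A, hX, ModuleCategory.equivalent_equivalence.trans h
    (ModuleCategory.equivalent_equivalence.symm hA)⟩

end DecoratedSet

end

/-! ### The four bijections -/

theorem mainTheorem1 (G : Type v) (K : Type u) [Group G] [Finite G] [Field K] :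
    -- the four notions of isomorphism / equivalence are equivalence relations
    (Equivalence (DecoratedSet.Iso (G := G) (K := K)) ∧
      Equivalence (CentralExtension.Iso (G := G) (K := K)) ∧
      Equivalence (SplitGAlgebra.GMorita (G := G) (K := K)) ∧
      Equivalence (SpecialModuleCategory.Equivalent (G := G) (K := K))) ∧
    -- bijections between the four sets of classes
    ∃ (e₂ : Quot (DecoratedSet.Iso (G := G) (K := K)) ≃
          Quot (CentralExtension.Iso (G := G) (K := K)))
      (e₃ : Quot (DecoratedSet.Iso (G := G) (K := K)) ≃
          Quot (SplitGAlgebra.GMorita (G := G) (K := K)))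
      (e₄ : Quot (DecoratedSet.Iso (G := G) (K := K)) ≃
          Quot (SpecialModuleCategory.Equivalent (G := G) (K := K))),
      -- the frills are the classes of the isotropy extensions
      (∀ (X : DecoratedSet G K) (E : CentralExtension G K),
        e₂ (Quot.mk _ X) = Quot.mk _ E ↔ E.HasFrills X) ∧
      -- `[Irr(A)]` corresponds to `[A]`
      (∀ (X : DecoratedSet G K) (A : SplitGAlgebra G K),
        e₃ (Quot.mk _ X) = Quot.mk _ A ↔ A.HasIrr X) ∧
      -- `[Irr(A)]` corresponds to `[A * G-Mod]`
      (∀ (A : SplitGAlgebra G K) (M : SpecialModuleCategory G K),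
        e₄ (e₃.symm (Quot.mk _ A)) = Quot.mk _ M ↔ M.1.Equivalent A.skewMod) ∧
      -- `[X]` corresponds to the direct sum, over representatives `x` of the orbits, of the
      -- categories of projective representations of `G_x` with class inverse to the frill of `x`
      (∀ (X : DecoratedSet G K) (S : Set X.X) (_ : ∀ x, ∃! s, s ∈ S ∧ s ∈ MulAction.orbit G x)
        (θ : ∀ s : S, cocycle K (MulAction.stabilizer G (s : X.X)))
        (_ : ∀ s : S, SchurMul.mk (θ s) = (X.frill s)⁻¹) (M : SpecialModuleCategory G K),
        e₄ (Quot.mk _ X) = Quot.mk _ M ↔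
          M.1.Equivalent (ModuleCategory.directSum fun s : S =>
            projMod (MulAction.stabilizer G (s : X.X)) (θ s))) := by
  obtain ⟨e₂, h₂⟩ := exists_quot_equiv DecoratedSet.iso_equivalence
    CentralExtension.iso_equivalence (fun (X : DecoratedSet G K) E => E.HasFrills X)
    DecoratedSet.exists_hasFrills CentralExtension.exists_hasFrills
    CentralExtension.HasFrills.congr_right CentralExtension.HasFrills.congr_left
    CentralExtension.HasFrills.left_unique CentralExtension.HasFrills.right_unique
  obtain ⟨e₃, h₃⟩ := exists_quot_equiv DecoratedSet.iso_equivalence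
    SplitGAlgebra.gMorita_equivalence (fun (X : DecoratedSet G K) A => A.HasIrr X)
    DecoratedSet.exists_hasIrr SplitGAlgebra.exists_hasIrr
    SplitGAlgebra.HasIrr.congr_right SplitGAlgebra.HasIrr.congr_left
    SplitGAlgebra.HasIrr.left_unique SplitGAlgebra.HasIrr.right_unique
  obtain ⟨e₄, h₄⟩ := exists_quot_equiv DecoratedSet.iso_equivalence
    SpecialModuleCategory.equivalent_equivalence
    (fun (X : DecoratedSet G K) (M : SpecialModuleCategory G K) => X.HasModuleCategory M.1)
    DecoratedSet.exists_hasModuleCategory SpecialModuleCategory.exists_hasModuleCategory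
    DecoratedSet.HasModuleCategory.congr_right DecoratedSet.HasModuleCategory.congr_left
    DecoratedSet.HasModuleCategory.left_unique DecoratedSet.HasModuleCategory.right_unique
  refine ⟨⟨DecoratedSet.iso_equivalence, CentralExtension.iso_equivalence,
    SplitGAlgebra.gMorita_equivalence, SpecialModuleCategory.equivalent_equivalence⟩,
    e₂, e₃, e₄, h₂, h₃, fun A M => ?_, fun X S hS θ hθ M => ?_⟩
  -- With X = Irr(A), the composite bijection is evaluated at `X`; any algebra witnessing the
  -- relation for `X` can be replaced by `A`.
  · obtain ⟨X, hX⟩ := A.exists_hasIrr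
    rw [← (h₃ X A).2 hX, Equiv.symm_apply_apply, h₄]
    exact ⟨fun h => h.equivalent_skewMod hX, fun h => ⟨A, hX, h⟩⟩
  · rw [h₄]
    obtain ⟨A, hA⟩ := X.exists_hasIrr
    have h := hA.skewMod_equivalent (Subtype.val : S → X.X)
      (fun x => by
        obtain ⟨s, ⟨hs, hx⟩, _⟩ := hS x
        exact ⟨⟨s, hs⟩, MulAction.mem_orbit_symm.1 hx⟩)
      (fun i j hij => Subtype.ext ((hS j).unique ⟨i.2, hij⟩ ⟨j.2, MulAction.mem_orbit_self _⟩))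
      θ hθ
    exact ⟨fun hM => ModuleCategory.equivalent_equivalence.trans (hM.equivalent_skewMod hA) h,
      fun hM => ⟨A, hA, ModuleCategory.equivalent_equivalence.trans hM
        (ModuleCategory.equivalent_equivalence.symm h)⟩⟩
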